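/- **Theorem (Weak local semicircle law).** Fix $\Sigma\ge 3$ and $C_{\mathrm m},C_{\mathrm q}>0$. There is $\nu>0$, depending only on $\Sigma,C_{\mathrm m},C_{\mathrm q}$, such that for all $a_0>0$ and $A_0\ge 10$ there are $C>0$ and $N_0\in\mathbb N$, depending only on $\Sigma,C_{\mathrm m},C_{\mathrm q},a_0,A_0$, such that the following holds for every $N\ge N_0$ and all real $\xi,L,q$ with $$1+a_0\le \xi\le A_0\log\log N,\qquad L\ge 8\xi,\qquad (\log N)^{3\xi}\le q\le C_{\mathrm q}N^{1/2}.$$ Let $H=(h_{ij})$ be a real symmetric $N\times N$ random matrix whose entries $h_{ij}$, $i\le j$, are independent and satisfy, for all $1\le i,j\le N$ and all integers $p$ with $3\le p\le(\log N)^{A_0\log\log N}$, $$\mathbb E h_{ij}=0,\qquad \mathbb E|h_{ij}|^2=\frac1N,\qquad \mathbb E|h_{ij}|^p\le\frac{C_{\mathrm m}^p}{Nq^{p-2}}.$$ For $\operatorname{Im} z>0$ put $$G(z)=(H-z)^{-1},\qquad m(z)=\frac1N\operatorname{Tr}G(z),\qquad m_{sc}(z)=\int_{\mathbb R}\frac{1}{2\pi}\,\frac{\sqrt{\max(4-x^2,0)}}{x-z}\,dx,$$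 and let $D_L=\{z=E+i\eta:\ |E|\le\Sigma,\ (\log N)^LN^{-1}\le\eta\le 3\}$. Then each of the three events $$\bigcap_{z\in D_L}\Big\{\max_{i\ne j}|G_{ij}(z)|\le\frac Cq+\frac{C(\log N)^{2\xi}}{\sqrt{N\eta}}\Big\},$$ $$\bigcap_{z\in D_L}\Big\{\max_i|G_{ii}(z)-m(z)|\le\frac{C(\log N)^{\xi}}q+\frac{C(\log N)^{2\xi}}{\sqrt{N\eta}}\Big\},$$ $$\bigcap_{z\in D_L}\Big\{|m(z)-m_{sc}(z)|\le\frac{C(\log N)^{\xi}}{\sqrt q}+\frac{C(\log N)^{2\xi}}{(N\eta)^{1/3}}\Big\}$$ has probability at least $1-e^{-\nu(\log N)^\xi}$. -/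

import Mathlib

open MeasureTheory ProbabilityTheory

noncomputable section

/-- `H` is an `N × N` real symmetric random matrix, with entries independent up to symmetry, centred,
of variance `1 / N`, whose moments of order `3 ≤ p ≤ (log N) ^ (A₀ log log N)` are at most
`Cm ^ p / (N q ^ (p - 2))`, the sparseness parameter `q` being subject to
`(log N) ^ (3 ξ) ≤ q ≤ Cq √N`. -/
structure IsSparseRandomMatrix {Ω : Type*} [MeasurableSpace Ω] (μ : Measure Ω) {N : ℕ}
    (A₀ ξ Cm Cq q : ℝ) (H : Ω → Matrix (Fin N) (Fin N) ℝ) : Prop where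
  measurable : ∀ i j, Measurable fun ω => H ω i j
  symm : ∀ ω i j, H ω i j = H ω j i
  indep : iIndepFun
    (fun (p : {p : Fin N × Fin N // p.1 ≤ p.2}) ω => H ω p.1.1 p.1.2) μ
  memLp_two : ∀ i j, MemLp (fun ω => H ω i j) 2 μ
  mean : ∀ i j, ∫ ω, H ω i j ∂μ = 0
  variance : ∀ i j, ∫ ω, |H ω i j| ^ 2 ∂μ = 1 / (N : ℝ)
  moments : ∀ i j, ∀ p : ℕ, 3 ≤ p →
    (p : ℝ) ≤ Real.log N ^ (A₀ * Real.log (Real.log N)) →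
    Integrable (fun ω => |H ω i j| ^ p) μ ∧
      ∫ ω, |H ω i j| ^ p ∂μ ≤ Cm ^ p / ((N : ℝ) * q ^ (p - 2))
  q_lower : Real.log N ^ (3 * ξ) ≤ q
  q_upper : q ≤ Cq * √(N : ℝ)

/-- The resolvent `G(z) = (H - z)⁻¹`. -/
def resolventMatrix {N : ℕ} (H : Matrix (Fin N) (Fin N) ℝ) (z : ℂ) : Matrix (Fin N) (Fin N) ℂ :=
  (H.map (fun x : ℝ => (x : ℂ)) - z • (1 : Matrix (Fin N) (Fin N) ℂ))⁻¹

/-- The Stieltjes transform `m(z) = N⁻¹ Tr G(z)` of the empirical eigenvalue density. -/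
def empiricalStieltjes {N : ℕ} (H : Matrix (Fin N) (Fin N) ℝ) (z : ℂ) : ℂ :=
  (1 / (N : ℂ)) * (resolventMatrix H z).trace

/-- The density of the semicircle law. -/
def semicircleDensity (x : ℝ) : ℝ :=
  1 / (2 * Real.pi) * √(max (4 - x ^ 2) 0)

/-- The Stieltjes transform of the semicircle law. -/
def semicircleStieltjes (z : ℂ) : ℂ :=
  ∫ x : ℝ, (semicircleDensity x : ℂ) / ((x : ℂ) - z)

/-- The spectral domain `D_L = {E + iη : |E| ≤ S, (log N) ^ L / N ≤ η ≤ 3}`. -/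
def spectralDomain (S : ℝ) (N : ℕ) (L : ℝ) : Set ℂ :=
  {z : ℂ | |z.re| ≤ S ∧ Real.log N ^ L / (N : ℝ) ≤ z.im ∧ z.im ≤ 3}

/-- The bound `P(Aᶜ) ≤ exp (-ν (log N) ^ ξ)` required of an event of `(ξ, ν)`-high probability at the
given `N`. -/
def HighProbBound {Ω : Type*} [MeasurableSpace Ω] (μ : Measure Ω) (N : ℕ) (ξ ν : ℝ)
    (A : Set Ω) : Prop :=
  μ Aᶜ ≤ ENNReal.ofReal (Real.exp (-(ν * Real.log N ^ ξ)))

end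

/-! Write ℓ = (log N)^ξ, η = Im z, t = (Nη)^(-1/2), s = m_sc(z), and G^(i) for the resolvent of H
with row and column i set to zero. Schur's formula expresses 1/G_ii through h_ii - z and the
quadratic form ∑ h_ik G^(i)_kl h_li, whose coefficients are independent of row i. The form
concentrates around N⁻¹ ∑_{k≠i} G^(i)_kk, which is close to m, so G_ii (-z - m + Y_i) = 1 with Y_i
small. Comparing these equations shows that the G_ii are close to each other; averaging them gives
m² + zm + 1 ≈ 0, whose exact roots are s and -z - s. Off-diagonal entries are linear forms in a row
and are small for the same reason (`RowFormBounds.improve`).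

By Ward's identity the fluctuations are of order ℓ/q + ℓ² t d, where d² bounds all Im G_ii. Since Im
G_ii is in turn controlled by Im m, the bound on the product of the distances of m to the two roots
is circular; solving it (`exists_dist_root_mul_le`, `selfImproving_bound`) produces the rates
q^(-1/2) and (Nη)^(-1/3).

All this presupposes an a priori bound |G_ij - δ_ij s| ≤ 1/K. At η = 3 it follows from |G_ij| ≤ 1/η.
It is carried down the vertical lines of a grid of mesh N⁻⁴, on which G, m and s hardly change
between neighbours (`StrongBound.step`). The correct root is followed by a dichotomy: if the roots
are further apart than the error, m cannot jump from one to the other in a single step; if they are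
not, closeness to either root is enough.

The probabilistic input is a large deviation bound for linear and quadratic forms, from moments of
an even order p close to ℓ/2, built up by adding one variable at a time (`moment_step`). It leaves a
failure probability of order e^(-p) per event. Polynomially many events are needed, and ξ ≥ 1 + a₀
makes ℓ much larger than log N, so the union bound is affordable. -/

/-! ### The Stieltjes transform of the semicircle law. -/

/-- For `Im z > 0` the equation `w ^ 2 + z w + 1 = 0` has a root in the open unit disc. -/
theorem exists_root_in_disc {z : ℂ} (hz : 0 < z.im) :
    ∃ w : ℂ, w ^ 2 + z * w + 1 = 0 ∧ ‖w‖ < 1 := by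
  obtain ⟨d, hd⟩ := IsAlgClosed.exists_pow_nat_eq (z ^ 2 - 4) (n := 2) (by norm_num)
  set w₁ := (-z + d) / 2 with hw₁
  set w₂ := (-z - d) / 2 with hw₂
  have h1 : w₁ ^ 2 + z * w₁ + 1 = 0 := by rw [hw₁]; linear_combination hd / 4
  have h2 : w₂ ^ 2 + z * w₂ + 1 = 0 := by rw [hw₂]; linear_combination hd / 4
  have h12 : w₁ * w₂ = 1 := by rw [hw₁, hw₂]; linear_combination - hd / 4
  have hn : ‖w₁‖ * ‖w₂‖ = 1 := by rw [← norm_mul, h12, norm_one]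
  -- The roots have product one, so one of them is in the open disc unless both have modulus one. A
  -- root with |w| = 1 has inverse equal to its conjugate, which would make z = -(w + conj w) real.
  have hne : ∀ w : ℂ, w ^ 2 + z * w + 1 = 0 → ‖w‖ ≠ 1 := by
    intro w hw hw1
    have hcw : (starRingEnd ℂ) w * w = 1 := by
      rw [mul_comm, Complex.mul_conj, Complex.normSq_eq_norm_sq, hw1]; norm_num
    have hzc : z = -(w + (starRingEnd ℂ) w) := by
      linear_combination (-z - w) * hcw + (starRingEnd ℂ) w * hw
    have := congrArg Complex.im hzc
    simp at this
    linarith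
  rcases lt_trichotomy ‖w₁‖ 1 with h | h | h
  · exact ⟨w₁, h1, h⟩
  · exact absurd h (hne _ h1)
  · refine ⟨w₂, h2, ?_⟩
    by_contra hcon
    push Not at hcon
    nlinarith [norm_nonneg w₁]

theorem semicircleStieltjes_eq_intervalIntegral (z : ℂ) :
    semicircleStieltjes z =
      ∫ x in (-2 : ℝ)..2, (semicircleDensity x : ℂ) / ((x : ℂ) - z) := by
  rw [intervalIntegral.integral_of_le (by norm_num), semicircleStieltjes,
    ← setIntegral_eq_integral_of_forall_compl_eq_zero]
  intro x hx
  have : max (4 - x ^ 2) 0 = 0 := by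
    apply max_eq_right
    simp only [Set.mem_Ioc, not_and_or, not_lt, not_le] at hx
    rcases hx with h | h <;> nlinarith
  simp [semicircleDensity, this]

theorem im_ofReal_sub_ne_zero {z : ℂ} (hz : 0 < z.im) (x : ℝ) : (x : ℂ) - z ≠ 0 := by
  intro h
  have := congrArg Complex.im h
  simp at this
  linarith

theorem continuous_semicircle_integrand {z : ℂ} (hz : 0 < z.im) :
    Continuous fun x : ℝ => (semicircleDensity x : ℂ) / ((x : ℂ) - z) := by
  refine Continuous.div ?_ (by fun_prop) (im_ofReal_sub_ne_zero hz)
  unfold semicircleDensity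
  fun_prop

/-- Substitution x = 2 cos t. On [-π, 0] the cosine increases from -1 to 1, so the orientation is
kept, and sin t ≤ 0 makes the square root equal to -2 sin t. -/
theorem semicircleStieltjes_eq_trig {z : ℂ} (hz : 0 < z.im) :
    semicircleStieltjes z = ∫ t in (-Real.pi)..0,
      (1 / (2 * Real.pi) * (4 * Real.sin t ^ 2) : ℝ) / ((2 * Real.cos t : ℝ) - z) := by
  have hsub := intervalIntegral.integral_deriv_smul_comp (a := -Real.pi) (b := 0)
    (f := fun t : ℝ => 2 * Real.cos t) (f' := fun t => 2 * (-Real.sin t))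
    (g := fun x : ℝ => (semicircleDensity x : ℂ) / ((x : ℂ) - z))
    (fun x _ => (Real.hasDerivAt_cos x).const_mul 2) (by fun_prop)
    (continuous_semicircle_integrand hz)
  rw [semicircleStieltjes_eq_intervalIntegral]
  simp only [Real.cos_neg, Real.cos_pi, Real.cos_zero] at hsub
  norm_num at hsub
  rw [← hsub, ← intervalIntegral.integral_neg]
  refine intervalIntegral.integral_congr fun t ht => ?_
  rw [Set.uIcc_of_le (by linarith [Real.pi_pos])] at ht
  have hs : Real.sin t ≤ 0 := Real.sin_nonpos_of_nonpos_of_neg_pi_le ht.2 ht.1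
  have hd : semicircleDensity (2 * Real.cos t) = 1 / (2 * Real.pi) * (2 * -Real.sin t) := by
    rw [semicircleDensity]
    congr 1
    have : max (4 - (2 * Real.cos t) ^ 2) 0 = (2 * -Real.sin t) ^ 2 := by
      rw [max_eq_left] <;> nlinarith [Real.sin_sq_add_cos_sq t]
    rw [this, Real.sqrt_sq (by linarith)]
  simp only [hd]
  push_cast
  ring

theorem exp_mul_I_mul_exp_neg (t : ℝ) :
    Complex.exp (t * Complex.I) * Complex.exp (-(t * Complex.I)) = 1 := by
  rw [← Complex.exp_add]; simp

/-- With ζ = e^{it} one has wζ(ζ + ζ⁻¹ - z) = (1 + wζ)(ζ + w), so this is a contour integral over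
the unit circle with a simple pole at -w inside; 1 + wζ has no zero in the closed disc. Cauchy's
formula applies, and the remaining factor equals 1 at -w. The numerator has only the positive
frequency of 4 sin² t, which avoids a pole at the origin. -/
theorem integral_trig_kernel {z w : ℂ} (hz : 0 < z.im) (hw : w ^ 2 + z * w + 1 = 0)
    (hw1 : ‖w‖ < 1) :
    ∫ t in (0 : ℝ)..(2 * Real.pi), (2 - 2 * Complex.exp (t * Complex.I) ^ 2) /
      ((2 * Real.cos t : ℝ) - z) = 4 * Real.pi * w := by
  have hne : ∀ ζ : ℂ, ‖ζ‖ ≤ 1 → 1 + w * ζ ≠ 0 := by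
    intro ζ hζ h
    have : ‖w * ζ‖ = 1 := by
      rw [show w * ζ = -1 by linear_combination h]; simp
    rw [norm_mul] at this
    nlinarith [norm_nonneg w, norm_nonneg ζ]
  have hc := Complex.circleIntegral_div_sub_of_differentiable_on_off_countable
    (R := 1) (c := 0) (w := -w) (s := ∅) (f := fun ζ => (1 - ζ ^ 2) / (1 + w * ζ))
    Set.countable_empty (by simpa using hw1)
    (by
      refine ContinuousOn.div (by fun_prop) (by fun_prop) fun ζ hζ => hne ζ ?_
      simpa using hζ)
    (by
      intro ζ hζ
      have : ‖ζ‖ ≤ 1 := by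
        have := hζ.1
        simp at this
        exact this.le
      have := hne ζ this
      fun_prop (disch := assumption))
  have hw2 : 1 + w * -w ≠ 0 := hne (-w) (by simpa using hw1.le)
  have hf : (1 - (-w) ^ 2) / (1 + w * -w) = 1 := by
    rw [div_eq_one_iff_eq hw2]; ring
  rw [hf, circleIntegral] at hc
  have hw0 : w ≠ 0 := by
    rintro rfl
    simp at hw
  have key : ∀ t : ℝ, (2 - 2 * Complex.exp (t * Complex.I) ^ 2) / ((2 * Real.cos t : ℝ) - z) =
      (2 * w / Complex.I) * (deriv (circleMap 0 1) t •
        ((1 - circleMap 0 1 t ^ 2) / (1 + w * circleMap 0 1 t) / (circleMap 0 1 t - -w))) := by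
    intro t
    have hz' := im_ofReal_sub_ne_zero hz (2 * Real.cos t)
    have hcos : ((2 * Real.cos t : ℝ) : ℂ) =
        Complex.exp (t * Complex.I) + Complex.exp (-(t * Complex.I)) := by
      push_cast
      rw [Complex.cos]
      ring_nf
    have hcm : circleMap 0 1 t = Complex.exp (t * Complex.I) := by simp [circleMap]
    rw [deriv_circleMap, hcm]
    rw [hcos] at hz' ⊢
    have he := exp_mul_I_mul_exp_neg t
    set e := Complex.exp (t * Complex.I) with hedef
    set e' := Complex.exp (-(t * Complex.I)) with hedef'
    have hn : ‖e‖ = 1 := by rw [hedef, Complex.norm_exp_ofReal_mul_I]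
    have hA : 1 + w * e ≠ 0 := hne e hn.le
    have hB : e - -w ≠ 0 := by
      intro h
      have : e = -w := by linear_combination h
      rw [this, norm_neg] at hn
      linarith
    have hprod : w * e * (e + e' - z) = (1 + w * e) * (e - -w) := by
      linear_combination w * he - e * hw
    have hI := Complex.I_ne_zero
    have he0 : e ≠ 0 := Complex.exp_ne_zero _
    rw [smul_eq_mul, div_eq_iff hz', div_div, ← hprod]
    have h2 : w * e * (e + e' - z) ≠ 0 := by rw [hprod]; exact mul_ne_zero hA hB
    field_simp
  simp_rw [key]
  rw [intervalIntegral.integral_const_mul, hc]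
  field_simp
  norm_num

/-- The Stieltjes transform of the semicircle law is the root of `w ^ 2 + z w + 1 = 0` in the
unit disc. -/
theorem semicircleStieltjes_eq_of_root {z w : ℂ} (hz : 0 < z.im) (hw : w ^ 2 + z * w + 1 = 0)
    (hw1 : ‖w‖ < 1) : semicircleStieltjes z = w := by
  set h : ℝ → ℂ := fun t => (2 - 2 * Complex.exp (t * Complex.I) ^ 2) /
      ((2 * Real.cos t : ℝ) - z) with hh
  have hcont : Continuous h := by
    refine Continuous.div (by fun_prop) (by fun_prop) fun t => im_ofReal_sub_ne_zero hz _
  have hper : Function.Periodic h (2 * Real.pi) := by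
    intro t
    simp only [hh]
    rw [Real.cos_add_two_pi]
    congr 4
    rw [show ((t + 2 * Real.pi : ℝ) : ℂ) * Complex.I = t * Complex.I + 2 * Real.pi * Complex.I by
      push_cast; ring]
    exact Complex.exp_periodic _
  have hJ : ∫ t in (-Real.pi)..Real.pi, h t = 4 * Real.pi * w := by
    rw [← integral_trig_kernel hz hw hw1]
    have := hper.intervalIntegral_add_eq (-Real.pi) 0
    rw [zero_add, show -Real.pi + 2 * Real.pi = Real.pi by ring] at this
    exact this
  -- Folding at t = 0 adds the negative frequency: the denominator is even in t, and h(t) + h(-t)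
  -- has numerator 8 sin² t.
  have hsplit : ∫ t in (-Real.pi)..Real.pi, h t =
      ∫ t in (-Real.pi)..0, (h t + h (-t)) := by
    have hneg : Continuous fun t => h (-t) := hcont.comp continuous_neg
    rw [← intervalIntegral.integral_add_adjacent_intervals (b := 0)
      (hcont.intervalIntegrable _ _) (hcont.intervalIntegrable _ _),
      intervalIntegral.integral_add (hcont.intervalIntegrable _ _)
      (hneg.intervalIntegrable _ _)]
    congr 1
    rw [intervalIntegral.integral_comp_neg (fun t => h t)]
    simp
  rw [semicircleStieltjes_eq_trig hz]
  have hpt : ∀ t : ℝ, ((1 / (2 * Real.pi) * (4 * Real.sin t ^ 2) : ℝ) : ℂ) /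
      ((2 * Real.cos t : ℝ) - z) = (1 / (4 * Real.pi)) * (h t + h (-t)) := by
    intro t
    simp only [hh]
    have hz' := im_ofReal_sub_ne_zero hz (2 * Real.cos t)
    rw [Real.cos_neg]
    have hpi : (Real.pi : ℂ) ≠ 0 := by exact_mod_cast Real.pi_ne_zero
    have he := exp_mul_I_mul_exp_neg t
    have hs : 4 * ((Real.sin t : ℝ) : ℂ) ^ 2 = 2 - Complex.exp (t * Complex.I) ^ 2 -
        Complex.exp (-(t * Complex.I)) ^ 2 := by
      push_cast
      rw [Complex.sin, show -(t : ℂ) * Complex.I = -(t * Complex.I) by ring]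
      have := Complex.I_sq
      linear_combination (Complex.exp (-(t * Complex.I)) - Complex.exp (t * Complex.I)) ^ 2 * this
        + 2 * he
    rw [show ((-t : ℝ) : ℂ) * Complex.I = -(t * Complex.I) by push_cast; ring]
    rw [← add_div]
    rw [show ((1 / (2 * Real.pi) * (4 * Real.sin t ^ 2) : ℝ) : ℂ) =
      1 / (2 * Real.pi) * (4 * ((Real.sin t : ℝ) : ℂ) ^ 2) by push_cast; ring, hs]
    field_simp
    ring
  simp_rw [hpt]
  rw [intervalIntegral.integral_const_mul, ← hsplit, hJ]
  have hpi : (Real.pi : ℂ) ≠ 0 := by exact_mod_cast Real.pi_ne_zero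
  field_simp

theorem semicircleStieltjes_sq_add {z : ℂ} (hz : 0 < z.im) :
    semicircleStieltjes z ^ 2 + z * semicircleStieltjes z + 1 = 0 := by
  obtain ⟨w, hw, hw1⟩ := exists_root_in_disc hz
  rwa [semicircleStieltjes_eq_of_root hz hw hw1]

theorem norm_semicircleStieltjes_lt_one {z : ℂ} (hz : 0 < z.im) :
    ‖semicircleStieltjes z‖ < 1 := by
  obtain ⟨w, hw, hw1⟩ := exists_root_in_disc hz
  rwa [semicircleStieltjes_eq_of_root hz hw hw1]

theorem semicircleStieltjes_mul_add {z : ℂ} (hz : 0 < z.im) :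
    semicircleStieltjes z * (-z - semicircleStieltjes z) = 1 := by
  linear_combination - semicircleStieltjes_sq_add hz

/-- The imaginary parts of the two roots of `w ^ 2 + z w + 1 = 0`. -/
theorem semicircleStieltjes_im {z : ℂ} (hz : 0 < z.im) :
    0 < (semicircleStieltjes z).im ∧ (-z - semicircleStieltjes z).im < 0 := by
  have h := semicircleStieltjes_mul_add hz
  have h1 := norm_semicircleStieltjes_lt_one hz
  set s := semicircleStieltjes z
  have hs0 : s ≠ 0 := by rintro h0; rw [h0] at h; simp at h
  have hinv : -z - s = s⁻¹ := by field_simp; linear_combination h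
  have him : (-z - s).im = -s.im / Complex.normSq s := by rw [hinv, Complex.inv_im]
  have hn : 0 < Complex.normSq s := Complex.normSq_pos.2 hs0
  have hn1 : Complex.normSq s < 1 := by
    rw [Complex.normSq_eq_norm_sq]; nlinarith [norm_nonneg s]
  have him2 : (-z - s).im = -z.im - s.im := by simp
  have hpos : 0 < s.im := by
    by_contra hcon
    push Not at hcon
    rw [him2, eq_div_iff hn.ne'] at him
    nlinarith
  exact ⟨hpos, by rw [him2]; linarith⟩

/-- Subtracting the two quadratic equations gives (s - t)(s + t + z) = -(z - z')t. Here |t| < 1, and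
Im(s + t + z) ≥ Im z because s and t lie in the upper half plane. -/
theorem norm_semicircleStieltjes_sub_le {z z' : ℂ} (hz : 0 < z.im) (hz' : 0 < z'.im) :
    ‖semicircleStieltjes z - semicircleStieltjes z'‖ ≤ ‖z - z'‖ / z.im := by
  have h := semicircleStieltjes_sq_add hz
  have h' := semicircleStieltjes_sq_add hz'
  have h1 := norm_semicircleStieltjes_lt_one hz'
  have hi := (semicircleStieltjes_im hz).1
  have hi' := (semicircleStieltjes_im hz').1
  set s := semicircleStieltjes z
  set t := semicircleStieltjes z'
  have heq : (s - t) * (s + t + z) = -((z - z') * t) := by linear_combination h - h'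
  have him : z.im ≤ ‖s + t + z‖ := by
    refine le_trans ?_ (Complex.abs_im_le_norm _)
    rw [abs_of_pos (by simp; linarith)]
    simp; linarith
  have hn := congrArg norm heq
  rw [norm_mul, norm_neg, norm_mul] at hn
  rw [le_div_iff₀ hz]
  nlinarith [norm_nonneg (s - t), norm_nonneg (z - z')]

/-- The other root -z - s is the inverse of s and has modulus at most |z| + 1. This keeps s, and
later the diagonal of G, away from zero on bounded domains. -/
theorem inv_le_norm_semicircleStieltjes {z : ℂ} (hz : 0 < z.im) :
    1 ≤ ‖semicircleStieltjes z‖ * (‖z‖ + 1) := by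
  have h := congrArg norm (semicircleStieltjes_mul_add hz)
  have h1 := norm_semicircleStieltjes_lt_one hz
  rw [norm_mul, norm_one] at h
  have h2 : ‖-z - semicircleStieltjes z‖ ≤ ‖z‖ + 1 := by
    calc ‖-z - semicircleStieltjes z‖ ≤ ‖-z‖ + ‖semicircleStieltjes z‖ := norm_sub_le _ _
      _ ≤ ‖z‖ + 1 := by rw [norm_neg]; linarith
  nlinarith [norm_nonneg (semicircleStieltjes z)]

/-! ### Resolvent identities: Ward, minors, Schur complement. -/

section Resolvent

variable {N : ℕ}

/-- A kernel vector v would satisfy ⟨v, Hv⟩ = z‖v‖², but the left side is real because H is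
symmetric. -/
theorem isUnit_det_map_sub_smul {H : Matrix (Fin N) (Fin N) ℝ} (hH : ∀ i j, H i j = H j i) {z : ℂ}
    (hz : 0 < z.im) :
    IsUnit (H.map (fun x : ℝ => (x : ℂ)) - z • (1 : Matrix (Fin N) (Fin N) ℂ)).det := by
  rw [isUnit_iff_ne_zero]
  intro h
  obtain ⟨v, hv, hv0⟩ := Matrix.exists_mulVec_eq_zero_iff.2 h
  have hherm : (H.map (fun x : ℝ => (x : ℂ))).IsHermitian := by
    ext i j
    simp [hH j i]
  have him := hherm.im_star_dotProduct_mulVec_self v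
  rw [Matrix.sub_mulVec, Matrix.smul_mulVec, Matrix.one_mulVec, sub_eq_zero] at hv0
  rw [hv0, dotProduct_smul, smul_eq_mul] at him
  have hre : star v ⬝ᵥ v = ((∑ i, ‖v i‖ ^ 2 : ℝ) : ℂ) := by
    simp only [dotProduct, Pi.star_apply, RCLike.star_def]
    push_cast
    exact Finset.sum_congr rfl fun i _ => by
      rw [mul_comm, Complex.mul_conj, Complex.normSq_eq_norm_sq]; push_cast; rfl
  rw [hre] at him
  have him' : z.im * ∑ i, ‖v i‖ ^ 2 = 0 := by
    have : (z * ((∑ i, ‖v i‖ ^ 2 : ℝ) : ℂ)).im = 0 := him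
    rwa [Complex.im_mul_ofReal] at this
  have hsum : ∑ i, ‖v i‖ ^ 2 = 0 := by
    rcases mul_eq_zero.1 him' with h | h
    · exact absurd h hz.ne'
    · exact h
  apply hv
  ext i
  have := (Finset.sum_eq_zero_iff_of_nonneg fun i _ => by positivity).1 hsum i (Finset.mem_univ i)
  simpa using this

variable {H : Matrix (Fin N) (Fin N) ℝ} {z : ℂ}

theorem sub_mul_resolventMatrix (hH : ∀ i j, H i j = H j i) (hz : 0 < z.im) :
    (H.map (fun x : ℝ => (x : ℂ)) - z • (1 : Matrix (Fin N) (Fin N) ℂ)) *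
      resolventMatrix H z = 1 :=
  Matrix.mul_nonsing_inv _ (isUnit_det_map_sub_smul hH hz)

theorem resolventMatrix_mul_sub (hH : ∀ i j, H i j = H j i) (hz : 0 < z.im) :
    resolventMatrix H z *
      (H.map (fun x : ℝ => (x : ℂ)) - z • (1 : Matrix (Fin N) (Fin N) ℂ)) = 1 :=
  Matrix.nonsing_inv_mul _ (isUnit_det_map_sub_smul hH hz)

theorem resolventMatrix_symm (hH : ∀ i j, H i j = H j i) (i j : Fin N) :
    resolventMatrix H z i j = resolventMatrix H z j i := by
  have hA : (H.map (fun x : ℝ => (x : ℂ)) - z • (1 : Matrix (Fin N) (Fin N) ℂ)).transpose =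
      H.map (fun x : ℝ => (x : ℂ)) - z • (1 : Matrix (Fin N) (Fin N) ℂ) := by
    ext i j
    simp [Matrix.one_apply, hH j i, eq_comm]
  have := Matrix.transpose_nonsing_inv
    (H.map (fun x : ℝ => (x : ℂ)) - z • (1 : Matrix (Fin N) (Fin N) ℂ))
  rw [hA] at this
  exact congrFun (congrFun this j) i

/-- The Ward identity. -/
theorem sum_norm_sq_resolventMatrix (hH : ∀ i j, H i j = H j i) (hz : 0 < z.im) (i : Fin N) :
    ∑ k, ‖resolventMatrix H z i k‖ ^ 2 = (resolventMatrix H z i i).im / z.im := by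
  set A := H.map (fun x : ℝ => (x : ℂ)) - z • (1 : Matrix (Fin N) (Fin N) ℂ) with hA
  set G := resolventMatrix H z with hG
  have h1 : G * A = 1 := resolventMatrix_mul_sub hH hz
  have h2 : A.conjTranspose * G.conjTranspose = 1 := by
    rw [← Matrix.conjTranspose_mul, h1, Matrix.conjTranspose_one]
  have hAA : A.conjTranspose - A = (2 * z.im * Complex.I) • (1 : Matrix (Fin N) (Fin N) ℂ) := by
    have hherm : (H.map (fun x : ℝ => (x : ℂ))).conjTranspose = H.map (fun x : ℝ => (x : ℂ)) := by
      ext i j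
      simp [hH j i]
    rw [hA, Matrix.conjTranspose_sub, hherm, Matrix.conjTranspose_smul, Matrix.conjTranspose_one]
    have : 2 * (z.im : ℂ) * Complex.I = z - star z := by
      rw [RCLike.star_def, Complex.sub_conj]; push_cast; ring
    rw [this, sub_smul]
    abel
  -- With A = H - z the adjoint satisfies A* - A = 2iη; the diagonal entries of this identity are
  -- Ward's identity.
  have h3 : G - G.conjTranspose = (2 * z.im * Complex.I) • (G * G.conjTranspose) := by
    calc G - G.conjTranspose = G * (A.conjTranspose - A) * G.conjTranspose := by
          rw [mul_sub, sub_mul, h1, mul_assoc, h2, mul_one, one_mul]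
      _ = _ := by rw [hAA]; simp
  have h4 := congrFun (congrFun h3 i) i
  rw [Matrix.sub_apply, Matrix.smul_apply, Matrix.mul_apply, Matrix.conjTranspose_apply,
    RCLike.star_def, Complex.sub_conj] at h4
  have hsum : ∑ k, G i k * G.conjTranspose k i = ((∑ k, ‖G i k‖ ^ 2 : ℝ) : ℂ) := by
    push_cast
    exact Finset.sum_congr rfl fun k _ => by
      rw [Matrix.conjTranspose_apply, RCLike.star_def, Complex.mul_conj,
        Complex.normSq_eq_norm_sq]; push_cast; rfl
  rw [hsum, smul_eq_mul] at h4
  have h5 := congrArg Complex.im h4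
  simp only [Complex.mul_im, Complex.mul_re, Complex.ofReal_re, Complex.ofReal_im, Complex.I_re,
    Complex.I_im, Complex.re_ofNat, Complex.im_ofNat] at h5
  rw [eq_div_iff hz.ne']
  linarith

theorem resolventMatrix_diag_im_nonneg (hH : ∀ i j, H i j = H j i) (hz : 0 < z.im) (i : Fin N) :
    0 ≤ (resolventMatrix H z i i).im := by
  have := sum_norm_sq_resolventMatrix hH hz i
  rw [eq_div_iff hz.ne'] at this
  rw [← this]
  positivity

theorem norm_resolventMatrix_diag_le (hH : ∀ i j, H i j = H j i) (hz : 0 < z.im) (i : Fin N) :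
    ‖resolventMatrix H z i i‖ ≤ 1 / z.im := by
  have h := sum_norm_sq_resolventMatrix hH hz i
  have h1 : ‖resolventMatrix H z i i‖ ^ 2 ≤ ∑ k, ‖resolventMatrix H z i k‖ ^ 2 :=
    Finset.single_le_sum (f := fun k => ‖resolventMatrix H z i k‖ ^ 2)
      (fun k _ => by positivity) (Finset.mem_univ i)
  rw [h, le_div_iff₀ hz] at h1
  have h2 := (le_abs_self _).trans (Complex.abs_im_le_norm (resolventMatrix H z i i))
  rw [le_div_iff₀ hz]
  by_contra hcon
  push Not at hcon
  nlinarith [norm_nonneg (resolventMatrix H z i i)]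

theorem sum_norm_sq_resolventMatrix_le (hH : ∀ i j, H i j = H j i) (hz : 0 < z.im) (i : Fin N) :
    ∑ k, ‖resolventMatrix H z i k‖ ^ 2 ≤ 1 / z.im ^ 2 := by
  rw [sum_norm_sq_resolventMatrix hH hz i]
  have h1 := norm_resolventMatrix_diag_le hH hz i
  have h2 := (le_abs_self _).trans (Complex.abs_im_le_norm (resolventMatrix H z i i))
  rw [div_le_div_iff₀ hz (by positivity)]
  rw [le_div_iff₀ hz] at h1
  nlinarith

theorem norm_resolventMatrix_le (hH : ∀ i j, H i j = H j i) (hz : 0 < z.im) (i j : Fin N) :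
    ‖resolventMatrix H z i j‖ ≤ 1 / z.im := by
  have h := sum_norm_sq_resolventMatrix_le hH hz i
  have h1 : ‖resolventMatrix H z i j‖ ^ 2 ≤ ∑ k, ‖resolventMatrix H z i k‖ ^ 2 :=
    Finset.single_le_sum (f := fun k => ‖resolventMatrix H z i k‖ ^ 2)
      (fun k _ => by positivity) (Finset.mem_univ j)
  have h2 : ‖resolventMatrix H z i j‖ ^ 2 ≤ (1 / z.im) ^ 2 := by
    rw [div_pow, one_pow]; exact h1.trans h
  exact le_of_sq_le_sq h2 (by positivity)

/-- Resolvent identity G(z) - G(z') = (z - z') G(z) G(z'), with Cauchy-Schwarz for the product: by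
Ward each row has ℓ²-norm at most 1/Im z, respectively 1/Im z'. -/
theorem norm_resolventMatrix_sub_le (hH : ∀ i j, H i j = H j i) {z' : ℂ} (hz : 0 < z.im)
    (hz' : 0 < z'.im) (i j : Fin N) :
    ‖resolventMatrix H z i j - resolventMatrix H z' i j‖ ≤ ‖z - z'‖ / (z.im * z'.im) := by
  have h1 := resolventMatrix_mul_sub hH hz
  have h2 := sub_mul_resolventMatrix hH hz'
  have h3 : resolventMatrix H z - resolventMatrix H z' =
      (z - z') • (resolventMatrix H z * resolventMatrix H z') := by
    have : (z - z') • (1 : Matrix (Fin N) (Fin N) ℂ) =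
        (H.map (fun x : ℝ => (x : ℂ)) - z' • (1 : Matrix (Fin N) (Fin N) ℂ)) -
        (H.map (fun x : ℝ => (x : ℂ)) - z • (1 : Matrix (Fin N) (Fin N) ℂ)) := by
      rw [sub_smul]; abel
    calc _ = resolventMatrix H z * ((z - z') • (1 : Matrix (Fin N) (Fin N) ℂ)) *
        resolventMatrix H z' := by
          rw [this, mul_sub, sub_mul, h1, mul_assoc, h2, mul_one, one_mul]
      _ = _ := by simp
  have h4 := congrFun (congrFun h3 i) j
  rw [Matrix.sub_apply, Matrix.smul_apply, Matrix.mul_apply] at h4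
  rw [h4, norm_smul, div_eq_mul_one_div]
  refine mul_le_mul_of_nonneg_left ?_ (norm_nonneg _)
  refine (norm_sum_le _ _).trans ?_
  simp only [norm_mul]
  have hcs := Finset.sum_mul_sq_le_sq_mul_sq Finset.univ (fun k => ‖resolventMatrix H z i k‖)
    (fun k => ‖resolventMatrix H z' k j‖)
  have ha := sum_norm_sq_resolventMatrix_le hH hz i
  have hb := sum_norm_sq_resolventMatrix_le hH hz' j
  simp only [resolventMatrix_symm (z := z') hH j] at hb
  refine le_of_sq_le_sq (hcs.trans ?_) (by positivity)
  calc _ ≤ (1 / z.im ^ 2) * (1 / z'.im ^ 2) := by gcongr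
    _ = _ := by field_simp

/-- The matrix obtained from `H` by setting the `i`-th row and column to zero. -/
def Matrix.eraseRowCol (H : Matrix (Fin N) (Fin N) ℝ) (i : Fin N) : Matrix (Fin N) (Fin N) ℝ :=
  Matrix.of fun k l => if k = i ∨ l = i then 0 else H k l

theorem Matrix.eraseRowCol_symm (hH : ∀ i j, H i j = H j i) (i k l : Fin N) :
    H.eraseRowCol i k l = H.eraseRowCol i l k := by
  simp [Matrix.eraseRowCol, hH k l, or_comm]

/-- Zeroing the row and column, instead of deleting them, keeps the index set and makes the
resolvent block diagonal: column i of the erased matrix minus z is -z times a basis vector. -/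
theorem resolventMatrix_eraseRowCol_of_ne (hH : ∀ i j, H i j = H j i) (hz : 0 < z.im)
    {i k : Fin N} (hk : k ≠ i) : resolventMatrix (H.eraseRowCol i) z k i = 0 := by
  have h := congrFun (congrFun (resolventMatrix_mul_sub (Matrix.eraseRowCol_symm hH i) hz) k) i
  rw [Matrix.mul_apply, Matrix.one_apply_ne hk] at h
  have hz0 : z ≠ 0 := by rintro rfl; simp at hz
  have : ∀ l, resolventMatrix (H.eraseRowCol i) z k l *
      ((H.eraseRowCol i).map (fun x : ℝ => (x : ℂ)) - z • (1 : Matrix (Fin N) (Fin N) ℂ)) l i =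
      if l = i then -z * resolventMatrix (H.eraseRowCol i) z k i else 0 := by
    intro l
    by_cases hl : l = i
    · subst hl; simp [Matrix.eraseRowCol, mul_comm]
    · simp [Matrix.eraseRowCol, hl]
  simp only [this, Finset.sum_ite_eq', Finset.mem_univ, if_true] at h
  rcases mul_eq_zero.1 h with h | h
  · exact absurd (neg_eq_zero.1 h) hz0
  · exact h

/-- In the resolvent identity G' - G = G' D G the difference D lives in row and column i. Since
G'_ki = 0, only column i of D contributes. -/
theorem resolventMatrix_eq_add_eraseRowCol (hH : ∀ i j, H i j = H j i) (hz : 0 < z.im)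
    {i k : Fin N} (hk : k ≠ i) (j : Fin N) :
    resolventMatrix H z k j = resolventMatrix (H.eraseRowCol i) z k j -
      (∑ l, if l = i then 0 else resolventMatrix (H.eraseRowCol i) z k l * (H l i : ℂ)) *
        resolventMatrix H z i j := by
  set G := resolventMatrix H z with hG
  set G' := resolventMatrix (H.eraseRowCol i) z with hG'
  set D : Matrix (Fin N) (Fin N) ℂ := (H - H.eraseRowCol i).map (fun x : ℝ => (x : ℂ)) with hD
  have h1 := sub_mul_resolventMatrix hH hz
  have h2 := resolventMatrix_mul_sub (Matrix.eraseRowCol_symm hH i) hz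
  have h3 : G' - G = G' * D * G := by
    have : D = (H.map (fun x : ℝ => (x : ℂ)) - z • (1 : Matrix (Fin N) (Fin N) ℂ)) -
        ((H.eraseRowCol i).map (fun x : ℝ => (x : ℂ)) - z • (1 : Matrix (Fin N) (Fin N) ℂ)) := by
      ext a b; simp [hD]
    rw [this, mul_sub, sub_mul, mul_assoc, h1, h2, mul_one, one_mul]
  have h4 := congrFun (congrFun h3 k) j
  rw [Matrix.sub_apply, Matrix.mul_apply] at h4
  have hzero : G' k i = 0 := resolventMatrix_eraseRowCol_of_ne hH hz hk
  have h5 : ∀ n, (G' * D) k n * G n j =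
      if n = i then (∑ l, if l = i then 0 else G' k l * (H l i : ℂ)) * G i j else 0 := by
    intro n
    by_cases hn : n = i
    · subst hn
      rw [if_pos rfl, Matrix.mul_apply]
      congr 1
      refine Finset.sum_congr rfl fun l _ => ?_
      by_cases hl : l = n
      · rw [hl, if_pos rfl, hzero, zero_mul]
      · simp [hl, hD, Matrix.eraseRowCol]
    · rw [if_neg hn, Matrix.mul_apply, Finset.sum_eq_zero, zero_mul]
      intro l _
      by_cases hl : l = i
      · rw [hl, hzero, zero_mul]
      · simp [hl, hn, hD, Matrix.eraseRowCol]
  simp only [h5, Finset.sum_ite_eq', Finset.mem_univ, if_true] at h4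
  linear_combination -h4

theorem resolventMatrix_eq_neg_sum (hH : ∀ i j, H i j = H j i) (hz : 0 < z.im)
    {i k : Fin N} (hk : k ≠ i) :
    resolventMatrix H z k i =
      - (∑ l, if l = i then 0 else resolventMatrix (H.eraseRowCol i) z k l * (H l i : ℂ)) *
        resolventMatrix H z i i := by
  rw [resolventMatrix_eq_add_eraseRowCol hH hz hk, resolventMatrix_eraseRowCol_of_ne hH hz hk]
  ring

/-- The minor expansion G_kj = G^(i)_kj + G_ki G_ij / G_ii, cleared of its denominator. -/
theorem resolventMatrix_mul_diag (hH : ∀ i j, H i j = H j i) (hz : 0 < z.im)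
    {i k : Fin N} (hk : k ≠ i) (j : Fin N) :
    resolventMatrix H z k j * resolventMatrix H z i i =
      resolventMatrix (H.eraseRowCol i) z k j * resolventMatrix H z i i +
      resolventMatrix H z k i * resolventMatrix H z i j := by
  rw [resolventMatrix_eq_neg_sum hH hz hk, resolventMatrix_eq_add_eraseRowCol hH hz hk j]
  ring

/-- Schur's complement formula for the diagonal entries of the resolvent. -/
theorem schur_resolventMatrix_diag (hH : ∀ i j, H i j = H j i) (hz : 0 < z.im) (i : Fin N) :
    ((H i i : ℂ) - z - ∑ k, if k = i then 0 else (H i k : ℂ) *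
      ∑ l, if l = i then 0 else resolventMatrix (H.eraseRowCol i) z k l * (H l i : ℂ)) *
      resolventMatrix H z i i = 1 := by
  have h := congrFun (congrFun (sub_mul_resolventMatrix hH hz) i) i
  rw [Matrix.mul_apply, Matrix.one_apply_eq] at h
  have h5 : ∀ k, (H.map (fun x : ℝ => (x : ℂ)) - z • (1 : Matrix (Fin N) (Fin N) ℂ)) i k *
      resolventMatrix H z k i =
      (if k = i then ((H i i : ℂ) - z) * resolventMatrix H z i i else 0) -
      (if k = i then 0 else (H i k : ℂ) *
      ∑ l, if l = i then 0 else resolventMatrix (H.eraseRowCol i) z k l * (H l i : ℂ)) *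
      resolventMatrix H z i i := by
    intro k
    by_cases hk : k = i
    · subst hk; simp
    · rw [resolventMatrix_eq_neg_sum hH hz hk]
      simp [hk, Matrix.one_apply_ne (Ne.symm hk)]
      ring
  simp only [h5, Finset.sum_sub_distrib, Finset.sum_ite_eq', Finset.mem_univ, if_true,
    ← Finset.sum_mul] at h
  rw [← h]
  ring

theorem resolventMatrix_diag_ne_zero (hH : ∀ i j, H i j = H j i) (hz : 0 < z.im) (i : Fin N) :
    resolventMatrix H z i i ≠ 0 := by
  intro h
  have := schur_resolventMatrix_diag hH hz i
  rw [h, mul_zero] at this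
  exact zero_ne_one this

end Resolvent

/-! ### Deterministic consequences of the large deviation bounds. -/

section Deterministic

variable {N : ℕ}

/-- The bounds on the linear and quadratic forms in the `i`-th row of `H`, with coefficients from the
resolvent of the minor, that large deviation estimates provide. -/
structure RowFormBounds (H : Matrix (Fin N) (Fin N) ℝ) (z : ℂ) (c ℓ q : ℝ) : Prop where
  entry : ∀ i j, |H i j| ≤ c / q
  linear : ∀ i j, j ≠ i → ∀ b β : ℝ, 0 ≤ b → 0 ≤ β →
    (∀ k, k ≠ i → k ≠ j → ‖resolventMatrix (H.eraseRowCol i) z k j‖ ≤ b) →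
    ∑ k, ‖resolventMatrix (H.eraseRowCol i) z k j‖ ^ 2 ≤ N * β ^ 2 →
    ‖∑ k, if k = i ∨ k = j then 0 else
      (H i k : ℂ) * resolventMatrix (H.eraseRowCol i) z k j‖ ≤ c * ℓ * (b / q + β)
  diagonal : ∀ i, ∀ b : ℝ, 0 ≤ b →
    (∀ k, k ≠ i → ‖resolventMatrix (H.eraseRowCol i) z k k‖ ≤ b) →
    ‖∑ k, if k = i then 0 else
      ((H i k ^ 2 - 1 / N : ℝ) : ℂ) * resolventMatrix (H.eraseRowCol i) z k k‖ ≤ c * ℓ * b / q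
  offDiagonal : ∀ i, ∀ b β : ℝ, 0 ≤ b → 0 ≤ β →
    (∀ k l, k ≠ i → l ≠ i → k ≠ l → ‖resolventMatrix (H.eraseRowCol i) z k l‖ ≤ b) →
    (∀ k, k ≠ i → ∑ l, ‖resolventMatrix (H.eraseRowCol i) z k l‖ ^ 2 ≤ N * β ^ 2) →
    ‖∑ k, ∑ l, if k = i ∨ l = i ∨ k = l then 0 else
      (H i k : ℂ) * resolventMatrix (H.eraseRowCol i) z k l * (H i l : ℂ)‖ ≤
        c * ℓ ^ 2 * (b / q + β)

variable {H : Matrix (Fin N) (Fin N) ℝ} {z : ℂ} {c ℓ q t : ℝ}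

/-- Splits the Schur form into the fluctuation of the squares h_ik² about 1/N, the off-diagonal
part, and the conditional mean, which is a partial trace. -/
theorem sum_eraseRowCol_quadratic_form (hH : ∀ i j, H i j = H j i) (i : Fin N)
    (G : Matrix (Fin N) (Fin N) ℂ) :
    (∑ k, if k = i then 0 else (H i k : ℂ) * ∑ l, if l = i then 0 else G k l * (H l i : ℂ)) =
      (∑ k, if k = i then 0 else ((H i k ^ 2 - 1 / N : ℝ) : ℂ) * G k k) +
      (∑ k, ∑ l, if k = i ∨ l = i ∨ k = l then 0 else (H i k : ℂ) * G k l * (H i l : ℂ)) +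
      (1 / (N : ℂ)) * ∑ k, if k = i then 0 else G k k := by
  rw [Finset.mul_sum, ← Finset.sum_add_distrib, ← Finset.sum_add_distrib]
  refine Finset.sum_congr rfl fun k _ => ?_
  by_cases hk : k = i
  · simp [hk]
  · simp only [hk, if_false, false_or]
    have hdiag : ∀ l, (if l = i ∨ k = l then (0 : ℂ) else (H i k : ℂ) * G k l * (H i l : ℂ)) =
        (H i k : ℂ) * (if l = i then 0 else G k l * (H l i : ℂ)) -
        (if l = k then (H i k : ℂ) * G k k * (H i k : ℂ) else 0) := by
      intro l
      by_cases hl : l = i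
      · subst hl; simp [Ne.symm hk]
      · by_cases hlk : l = k
        · subst hlk; simp [hl, hH l i]; ring
        · simp [hl, hlk, Ne.symm hlk, hH l i]; ring
    simp only [hdiag, Finset.sum_sub_distrib, Finset.sum_ite_eq', Finset.mem_univ, if_true,
      ← Finset.mul_sum]
    push_cast
    ring

/-- Summing the minor expansion over k replaces the trace of the minor by m. The excluded index k =
i fits in because G_ii = G_ii² / G_ii. -/
theorem sum_diag_eraseRowCol (hH : ∀ i j, H i j = H j i) (hz : 0 < z.im) (i : Fin N) :
    (1 / (N : ℂ)) * (∑ k, if k = i then 0 else resolventMatrix (H.eraseRowCol i) z k k) =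
      empiricalStieltjes H z - (1 / (N : ℂ)) *
        ((∑ k, resolventMatrix H z i k ^ 2) / resolventMatrix H z i i) := by
  rw [empiricalStieltjes, Matrix.trace, ← mul_sub, Finset.sum_div, ← Finset.sum_sub_distrib]
  congr 1
  refine Finset.sum_congr rfl fun k _ => ?_
  have h0 := resolventMatrix_diag_ne_zero hH hz i
  by_cases hk : k = i
  · subst hk
    simp only [if_true, Matrix.diag_apply]
    field_simp
    ring
  · simp only [hk, if_false, Matrix.diag_apply]
    have := resolventMatrix_mul_diag hH hz hk k
    rw [resolventMatrix_symm hH k i] at this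
    field_simp
    linear_combination -this

/-- Schur's formula with every fluctuation collected in Y. Here t = (Nη)^(-1/2), and Ward's identity
for the minor turns the bound e² on imaginary parts into row sums of squares at most N(te)². -/
theorem RowFormBounds.exists_selfConsistent (hB : RowFormBounds H z c ℓ q)
    (hH : ∀ i j, H i j = H j i) (hz : 0 < z.im) (ht : t ^ 2 * (N * z.im) = 1) (ht0 : 0 ≤ t)
    (i : Fin N) {b b' e : ℝ} (hb : 0 ≤ b) (hb' : 0 ≤ b') (he : 0 ≤ e)
    (h1 : ∀ k, k ≠ i → ‖resolventMatrix (H.eraseRowCol i) z k k‖ ≤ b)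
    (h2 : ∀ k l, k ≠ i → l ≠ i → k ≠ l → ‖resolventMatrix (H.eraseRowCol i) z k l‖ ≤ b')
    (h3 : ∀ k, k ≠ i → (resolventMatrix (H.eraseRowCol i) z k k).im ≤ e ^ 2) :
    ∃ Y : ℂ, resolventMatrix H z i i * (-z - empiricalStieltjes H z + Y) = 1 ∧
      ‖Y‖ ≤ c / q + c * ℓ * b / q + c * ℓ ^ 2 * (b' / q + t * e) + t ^ 2 := by
  have hN : (0 : ℝ) < N := by exact_mod_cast Fin.pos i
  have hs := schur_resolventMatrix_diag hH hz i
  rw [sum_eraseRowCol_quadratic_form hH, sum_diag_eraseRowCol hH hz] at hs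
  have hd := hB.diagonal i b hb h1
  have ho := hB.offDiagonal i b' (t * e) hb' (by positivity) h2 (by
    intro k hk
    rw [sum_norm_sq_resolventMatrix (Matrix.eraseRowCol_symm hH i) hz, div_le_iff₀ hz]
    have := h3 k hk
    calc _ ≤ e ^ 2 := this
      _ = (t ^ 2 * (N * z.im)) * e ^ 2 := by rw [ht, one_mul]
      _ = _ := by ring)
  set S₁ := ∑ k, if k = i then 0 else
      ((H i k ^ 2 - 1 / N : ℝ) : ℂ) * resolventMatrix (H.eraseRowCol i) z k k
  set S₂ := ∑ k, ∑ l, if k = i ∨ l = i ∨ k = l then 0 else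
      (H i k : ℂ) * resolventMatrix (H.eraseRowCol i) z k l * (H i l : ℂ)
  set S₃ := (1 / (N : ℂ)) * ((∑ k, resolventMatrix H z i k ^ 2) / resolventMatrix H z i i) with hS₃
  -- The cost of replacing the trace of the minor by that of G. Ward bounds the sum by |G_ii|/η, so
  -- G_ii cancels and 1/(Nη) = t² is left.
  have hS₃n : ‖S₃‖ ≤ t ^ 2 := by
    have h0 : 0 < ‖resolventMatrix H z i i‖ :=
      norm_pos_iff.2 (resolventMatrix_diag_ne_zero hH hz i)
    rw [hS₃, norm_mul, norm_div, norm_div, norm_one, Complex.norm_natCast]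
    have hsum : ‖∑ k, resolventMatrix H z i k ^ 2‖ ≤ ‖resolventMatrix H z i i‖ / z.im := by
      refine (norm_sum_le _ _).trans ?_
      simp only [norm_pow]
      rw [sum_norm_sq_resolventMatrix hH hz]
      gcongr
      exact (le_abs_self _).trans (Complex.abs_im_le_norm _)
    have htt : t ^ 2 = 1 / (N * z.im) := by
      rw [eq_div_iff (by positivity), ht]
    calc 1 / (N : ℝ) * (‖∑ k, resolventMatrix H z i k ^ 2‖ / ‖resolventMatrix H z i i‖)
        ≤ 1 / (N : ℝ) * (‖resolventMatrix H z i i‖ / z.im / ‖resolventMatrix H z i i‖) := by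
          gcongr
      _ = t ^ 2 := by rw [htt]; field_simp
  refine ⟨(H i i : ℂ) - S₁ - S₂ + S₃, by rw [← hs]; ring, ?_⟩
  have he := hB.entry i i
  have hn : ‖(H i i : ℂ)‖ = |H i i| := by simp
  calc ‖(H i i : ℂ) - S₁ - S₂ + S₃‖ ≤ ‖(H i i : ℂ)‖ + ‖S₁‖ + ‖S₂‖ + ‖S₃‖ :=
        (norm_add_le _ _).trans (by gcongr; exact (norm_sub_le _ _).trans (by
          gcongr; exact norm_sub_le _ _))
    _ ≤ _ := by rw [hn]; gcongr

/-- G_ji is G_ii times a linear form in row i with coefficients from the minor. The term l = j is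
split off: its coefficient is a diagonal entry, of order one, and is paid for by the bound on h_ij
alone. -/
theorem RowFormBounds.norm_off_diagonal_le (hB : RowFormBounds H z c ℓ q)
    (hH : ∀ i j, H i j = H j i) (hz : 0 < z.im) (ht : t ^ 2 * (N * z.im) = 1) (ht0 : 0 ≤ t)
    {i j : Fin N} (hij : j ≠ i) {b b' e : ℝ} (hb' : 0 ≤ b') (he : 0 ≤ e) (hcq : 0 ≤ c / q)
    (h1 : ‖resolventMatrix (H.eraseRowCol i) z j j‖ ≤ b)
    (h2 : ∀ k l, k ≠ i → l ≠ i → k ≠ l → ‖resolventMatrix (H.eraseRowCol i) z k l‖ ≤ b')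
    (h3 : (resolventMatrix (H.eraseRowCol i) z j j).im ≤ e ^ 2) :
    ‖resolventMatrix H z j i‖ ≤
      (c / q * b + c * ℓ * (b' / q + t * e)) * ‖resolventMatrix H z i i‖ := by
  have hHi := Matrix.eraseRowCol_symm hH i
  rw [resolventMatrix_eq_neg_sum hH hz hij, norm_mul, norm_neg]
  gcongr
  have hsplit : (∑ l, if l = i then 0 else
      resolventMatrix (H.eraseRowCol i) z j l * (H l i : ℂ)) =
      (H i j : ℂ) * resolventMatrix (H.eraseRowCol i) z j j +
      ∑ k, if k = i ∨ k = j then 0 else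
        (H i k : ℂ) * resolventMatrix (H.eraseRowCol i) z k j := by
    have : ∀ l, (if l = i then (0 : ℂ) else
        resolventMatrix (H.eraseRowCol i) z j l * (H l i : ℂ)) =
        (if l = j then (H i j : ℂ) * resolventMatrix (H.eraseRowCol i) z j j else 0) +
        if l = i ∨ l = j then 0 else (H i l : ℂ) * resolventMatrix (H.eraseRowCol i) z l j := by
      intro l
      by_cases hl : l = i
      · subst hl; simp [Ne.symm hij]
      · by_cases hlj : l = j
        · subst hlj; simp [hl, hH l i, mul_comm]
        · simp [hl, hlj, hH l i, resolventMatrix_symm hHi j l, mul_comm]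
    simp only [this, Finset.sum_add_distrib, Finset.sum_ite_eq', Finset.mem_univ, if_true]
  rw [hsplit]
  refine (norm_add_le _ _).trans (add_le_add ?_ ?_)
  · rw [norm_mul]
    have hn : ‖(H i j : ℂ)‖ = |H i j| := by simp
    rw [hn]
    have := hB.entry i j
    gcongr
  · refine hB.linear i j hij b' (t * e) hb' (by positivity) (fun k hk hkj => h2 k j hk hij hkj) ?_
    simp only [resolventMatrix_symm hHi _ j]
    rw [sum_norm_sq_resolventMatrix hHi hz, div_le_iff₀ hz]
    calc _ ≤ e ^ 2 := h3
      _ = (t ^ 2 * (N * z.im)) * e ^ 2 := by rw [ht, one_mul]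
      _ = _ := by ring

/-- Bounds on the entries of `G` give bounds on the entries of the resolvent of a minor. -/
theorem norm_resolventMatrix_eraseRowCol_sub_le (hH : ∀ i j, H i j = H j i) (hz : 0 < z.im)
    {K Λ : ℝ} (hK : 0 ≤ K) {i k l : Fin N} (hk : k ≠ i)
    (hii : 1 ≤ K * ‖resolventMatrix H z i i‖) (hki : ‖resolventMatrix H z k i‖ ≤ Λ)
    (hil : ‖resolventMatrix H z i l‖ ≤ Λ) :
    ‖resolventMatrix (H.eraseRowCol i) z k l - resolventMatrix H z k l‖ ≤ K * Λ ^ 2 := by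
  have h := resolventMatrix_mul_diag hH hz hk l
  have h' : (resolventMatrix (H.eraseRowCol i) z k l - resolventMatrix H z k l) *
      resolventMatrix H z i i = -(resolventMatrix H z k i * resolventMatrix H z i l) := by
    linear_combination -h
  have hn := congrArg norm h'
  rw [norm_mul, norm_neg, norm_mul] at hn
  have hpos := norm_nonneg
    (resolventMatrix (H.eraseRowCol i) z k l - resolventMatrix H z k l)
  calc _ ≤ ‖resolventMatrix (H.eraseRowCol i) z k l - resolventMatrix H z k l‖ *
        (K * ‖resolventMatrix H z i i‖) := le_mul_of_one_le_right hpos hii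
    _ = K * (‖resolventMatrix H z k i‖ * ‖resolventMatrix H z i l‖) := by rw [← hn]; ring
    _ ≤ K * (Λ * Λ) := by gcongr; exact (norm_nonneg _).trans hki
    _ = _ := by ring

/-- The diagonal entries are close to each other, and `m` satisfies a perturbed quadratic
equation, when all self-consistent equations hold up to `υ`. -/
theorem selfConsistent_average (hN : 0 < N) {υ κ : ℝ}
    (hdiag : ∀ i, ‖resolventMatrix H z i i‖ ≤ κ)
    (hY : ∀ i, ∃ Y : ℂ, resolventMatrix H z i i * (-z - empiricalStieltjes H z + Y) = 1 ∧
      ‖Y‖ ≤ υ) :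
    (∀ i, ‖resolventMatrix H z i i - empiricalStieltjes H z‖ ≤ 2 * κ ^ 2 * υ) ∧
    ‖empiricalStieltjes H z ^ 2 + z * empiricalStieltjes H z + 1‖ ≤ κ * υ := by
  choose Y hY1 hY2 using hY
  have hN' : (N : ℂ) ≠ 0 := by exact_mod_cast hN.ne'
  have hNR : (N : ℝ) ≠ 0 := by exact_mod_cast hN.ne'
  set m := empiricalStieltjes H z with hm
  set g : Fin N → ℂ := fun i => resolventMatrix H z i i with hg
  have hmg : m = (1 / (N : ℂ)) * ∑ i, g i := rfl
  have hκ : 0 ≤ κ := (norm_nonneg _).trans (hdiag ⟨0, hN⟩)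
  constructor
  · intro i
    -- Cross-multiplying the equations for i and j eliminates z + m and gives g_i - g_j = g_i g_j
    -- (Y_j - Y_i); this is averaged over j.
    have h1 : g i - m = (1 / (N : ℂ)) * ∑ j, g i * g j * (Y j - Y i) := by
      have : ∀ j, g i * g j * (Y j - Y i) = g i - g j := by
        intro j
        linear_combination g i * hY1 j - g j * hY1 i
      simp only [this, Finset.sum_sub_distrib, Finset.sum_const, Finset.card_univ,
        Fintype.card_fin, nsmul_eq_mul]
      rw [hmg]
      field_simp
    change ‖g i - m‖ ≤ _
    rw [h1, norm_mul, norm_div, norm_one, Complex.norm_natCast]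
    have h2 : ‖∑ j, g i * g j * (Y j - Y i)‖ ≤ ∑ _j : Fin N, 2 * κ ^ 2 * υ := by
      refine norm_sum_le_of_le _ fun j _ => ?_
      rw [norm_mul, norm_mul]
      calc ‖g i‖ * ‖g j‖ * ‖Y j - Y i‖ ≤ κ * κ * (υ + υ) := by
            gcongr
            · exact hdiag i
            · exact hdiag j
            · exact (norm_sub_le _ _).trans (add_le_add (hY2 j) (hY2 i))
        _ = _ := by ring
    simp only [Finset.sum_const, Finset.card_univ, Fintype.card_fin, nsmul_eq_mul] at h2
    calc _ ≤ 1 / (N : ℝ) * (N * (2 * κ ^ 2 * υ)) := by gcongr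
      _ = _ := by field_simp
  -- Each equation reads g_j Y_j = 1 + (z + m) g_j; the average over j is the quadratic equation
  -- with its error.
  · have h1 : m ^ 2 + z * m + 1 = (1 / (N : ℂ)) * ∑ j, g j * Y j := by
      have : ∀ j, g j * Y j = 1 + (z + m) * g j := by
        intro j
        linear_combination hY1 j
      simp only [this, Finset.sum_add_distrib, Finset.sum_const, Finset.card_univ,
        Fintype.card_fin, nsmul_eq_mul, ← Finset.mul_sum]
      rw [mul_add, mul_left_comm _ (z + m), ← hmg]
      field_simp
      ring
    rw [h1, norm_mul, norm_div, norm_one, Complex.norm_natCast]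
    have h2 : ‖∑ j, g j * Y j‖ ≤ ∑ _j : Fin N, κ * υ := by
      refine norm_sum_le_of_le _ fun j _ => ?_
      rw [norm_mul]
      gcongr
      · exact hdiag j
      · exact hY2 j
    simp only [Finset.sum_const, Finset.card_univ, Fintype.card_fin, nsmul_eq_mul] at h2
    calc _ ≤ 1 / (N : ℝ) * (N * (κ * υ)) := by gcongr
      _ = _ := by field_simp

/-- The unknown Λ occurs on the right with coefficients 4cℓ/q ≤ 1/4 and 2cKℓt ≤ 1/4, so half of Λ
can be absorbed on the left. -/
theorem off_diagonal_bootstrap {c ℓ q t K d Λ : ℝ} (hK : 2 ≤ K) (hc : 1 ≤ c)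
    (hℓ : 8 * c * K ≤ ℓ) (hq : ℓ ^ 3 ≤ q) (ht0 : 0 ≤ t) (htℓ : ℓ ^ 4 * t ≤ 1) (hd : 0 ≤ d)
    (hΛ0 : 0 ≤ Λ)
    (hA : Λ ≤ 2 * (3 * c / q + c * ℓ * (2 * Λ / q + t * (d + K * Λ)))) :
    Λ ≤ 12 * c * (1 / q + ℓ * t * d) := by
  have hℓ16 : 16 ≤ ℓ := by nlinarith
  have hℓ0 : 0 < ℓ := by linarith
  have hq0 : 0 < q := lt_of_lt_of_le (by positivity) hq
  have hℓ3 : ℓ * ℓ ^ 2 ≤ q := by linarith [show ℓ * ℓ ^ 2 = ℓ ^ 3 by ring]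
  have hx1 : c * ℓ / q ≤ 1 / 16 := by
    rw [div_le_iff₀ hq0]
    have : 16 * c ≤ ℓ := by nlinarith
    have h1 : ℓ * ℓ ≤ ℓ ^ 3 := by nlinarith
    nlinarith
  have hx2 : c * K * ℓ * t ≤ 1 / 8 := by
    have h1 : c * K * ℓ * t ≤ (ℓ / 8) * ℓ * t := by
      gcongr
      linarith
    have h2 : ℓ ^ 2 * t ≤ ℓ ^ 4 * t := by
      gcongr
      · linarith
      · norm_num
    nlinarith
  have h1 : 2 * (3 * c / q + c * ℓ * (2 * Λ / q + t * (d + K * Λ))) =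
      6 * c * (1 / q) + 4 * (c * ℓ / q) * Λ + 2 * (c * ℓ * t * d) + 2 * (c * K * ℓ * t) * Λ := by
    ring
  rw [h1] at hA
  have h2 : (c * ℓ / q) * Λ ≤ 1 / 16 * Λ := by gcongr
  have h3 : (c * K * ℓ * t) * Λ ≤ 1 / 8 * Λ := by gcongr
  have h4 : 0 ≤ c * ℓ * t * d := by positivity
  have h5 : 12 * c * (1 / q + ℓ * t * d) = 12 * c * (1 / q) + 12 * (c * ℓ * t * d) := by ring
  linarith

theorem selfConsistent_error_bound {c ℓ q t K d Λ : ℝ} (hK : 2 ≤ K) (hc : 1 ≤ c)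
    (hℓ : 8 * c * K ≤ ℓ) (hq : ℓ ^ 3 ≤ q) (ht0 : 0 ≤ t) (htℓ : ℓ ^ 4 * t ≤ 1) (hd : 0 ≤ d)
    (hΛ0 : 0 ≤ Λ)
    (hB1 : Λ ≤ 12 * c * (1 / q + ℓ * t * d)) :
    c / q + c * ℓ * 3 / q + c * ℓ ^ 2 * (2 * Λ / q + t * (d + K * Λ)) + t ^ 2 ≤
      41 * c ^ 2 * K * (ℓ / q + ℓ ^ 2 * t * d) + t ^ 2 := by
  have hℓ16 : 16 ≤ ℓ := by nlinarith
  have hℓ0 : 0 < ℓ := by linarith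
  have hq0 : 0 < q := lt_of_lt_of_le (by positivity) hq
  have hℓ3 : ℓ * ℓ ^ 2 ≤ q := by linarith [show ℓ * ℓ ^ 2 = ℓ ^ 3 by ring]
  have hK0 : 0 ≤ K := by linarith
  have hy1 : ℓ ^ 2 / q ≤ 1 := by
    rw [div_le_one hq0]
    nlinarith
  have hy2 : ℓ ^ 2 * t ≤ 1 := by
    have h2 : ℓ ^ 2 * t ≤ ℓ ^ 4 * t := by
      gcongr
      · linarith
      · norm_num
    linarith
  have h1q : 1 / q ≤ ℓ / q := by gcongr; linarith
  have hℓt : ℓ * t * d ≤ ℓ ^ 2 * t * d := by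
    gcongr
    nlinarith
  set X := ℓ / q + ℓ ^ 2 * t * d with hX
  have hX1 : ℓ / q ≤ X := by
    have : 0 ≤ ℓ ^ 2 * t * d := by positivity
    linarith
  have hX2 : ℓ ^ 2 * t * d ≤ X := by
    have : 0 ≤ ℓ / q := by positivity
    linarith
  have hX0 : 0 ≤ X := le_trans (by positivity) hX1
  have hΛX : Λ ≤ 12 * c * X := by
    refine hB1.trans ?_
    gcongr 12 * c * ?_
    linarith
  calc c / q + c * ℓ * 3 / q + c * ℓ ^ 2 * (2 * Λ / q + t * (d + K * Λ)) + t ^ 2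
      = c * (1 / q) + 3 * c * (ℓ / q) + 2 * c * ((ℓ ^ 2 / q) * Λ) + c * (ℓ ^ 2 * t * d) +
        c * K * ((ℓ ^ 2 * t) * Λ) + t ^ 2 := by ring
    _ ≤ c * X + 3 * c * X + 2 * c * (1 * (12 * c * X)) + c * X + c * K * (1 * (12 * c * X)) +
        t ^ 2 := by
        gcongr
        exact h1q.trans hX1
    -- The five coefficients are 1 + 3 + 24 + 1 + 12 = 41, each power of c and K being raised to
    -- c²K.
    _ ≤ 41 * c ^ 2 * K * X + t ^ 2 := by
        have h1 : c ≤ c ^ 2 * K := by nlinarith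
        have h2 : c ^ 2 ≤ c ^ 2 * K := by nlinarith
        have h3 := mul_le_mul_of_nonneg_right h1 hX0
        have h4 := mul_le_mul_of_nonneg_right h2 hX0
        linarith

/-- The improvement of an a priori bound on the resolvent, in terms of a bound `d ^ 2` for the
imaginary parts of the diagonal entries. -/
theorem RowFormBounds.improve (hB : RowFormBounds H z c ℓ q)
    (hH : ∀ i j, H i j = H j i) (hz : 0 < z.im) (ht : t ^ 2 * (N * z.im) = 1) (ht0 : 0 ≤ t)
    {K d : ℝ} (hK : 2 ≤ K) (hc : 1 ≤ c) (hℓ : 8 * c * K ≤ ℓ) (hq : ℓ ^ 3 ≤ q) (htℓ : ℓ ^ 4 * t ≤ 1)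
    (hd : 0 ≤ d) (hlow : ∀ i, 1 ≤ K * ‖resolventMatrix H z i i‖)
    (hup : ∀ i, ‖resolventMatrix H z i i‖ ≤ 2)
    (hoff : ∀ i j, i ≠ j → K * ‖resolventMatrix H z i j‖ ≤ 1)
    (him : ∀ i, (resolventMatrix H z i i).im ≤ d ^ 2) :
    (∀ i j, i ≠ j → ‖resolventMatrix H z i j‖ ≤ 12 * c * (1 / q + ℓ * t * d)) ∧
    (∀ i, ∃ Y : ℂ, resolventMatrix H z i i * (-z - empiricalStieltjes H z + Y) = 1 ∧
      ‖Y‖ ≤ 41 * c ^ 2 * K * (ℓ / q + ℓ ^ 2 * t * d) + t ^ 2) := by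
  have hℓ16 : 16 ≤ ℓ := by nlinarith
  have hℓ0 : 0 < ℓ := by linarith
  have hq0 : 0 < q := lt_of_lt_of_le (by positivity) hq
  -- The largest off-diagonal entry, for which a self-bounding inequality is derived. The value 0 on
  -- the diagonal keeps Λ nonnegative even when there are no off-diagonal entries.
  set Λ : ℝ := ⨆ p : Fin N × Fin N, if p.1 ≠ p.2 then ‖resolventMatrix H z p.1 p.2‖ else 0 with hΛ
  have hΛ1 : ∀ i j, i ≠ j → ‖resolventMatrix H z i j‖ ≤ Λ := by
    intro i j hij
    have := le_ciSup (f := fun p : Fin N × Fin N =>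
      if p.1 ≠ p.2 then ‖resolventMatrix H z p.1 p.2‖ else 0) (Set.finite_range _).bddAbove (i, j)
    simp only [ne_eq, hij, not_false_eq_true, if_true] at this
    exact this
  have hΛ2 : ∀ a : ℝ, 0 ≤ a → (∀ i j, i ≠ j → ‖resolventMatrix H z i j‖ ≤ a) → Λ ≤ a := by
    intro a ha h
    refine Real.iSup_le (fun p => ?_) ha
    split_ifs with hp
    · exact h _ _ hp
    · exact ha
  have hΛ0 : 0 ≤ Λ := Real.iSup_nonneg fun p => by split_ifs <;> positivity
  have hKΛ : K * Λ ≤ 1 := by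
    have := hΛ2 (1 / K) (by positivity) fun i j hij => by
      rw [le_div_iff₀ (by linarith), mul_comm]; exact hoff i j hij
    rwa [le_div_iff₀ (by linarith), mul_comm] at this
  have hK0 : 0 ≤ K := by linarith
  have hm1 : ∀ i k, k ≠ i → ‖resolventMatrix (H.eraseRowCol i) z k k‖ ≤ 3 := by
    intro i k hk
    have h1 := norm_resolventMatrix_eraseRowCol_sub_le hH hz hK0 hk (hlow i) (hΛ1 k i hk)
      (hΛ1 i k hk.symm)
    have h2 := norm_sub_norm_le (resolventMatrix (H.eraseRowCol i) z k k) (resolventMatrix H z k k)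
    have h3 := hup k
    nlinarith
  have hm2 : ∀ i k l, k ≠ i → l ≠ i → k ≠ l →
      ‖resolventMatrix (H.eraseRowCol i) z k l‖ ≤ 2 * Λ := by
    intro i k l hk hl hkl
    have h1 := norm_resolventMatrix_eraseRowCol_sub_le hH hz hK0 hk (hlow i) (hΛ1 k i hk)
      (hΛ1 i l hl.symm)
    have h2 := norm_sub_norm_le (resolventMatrix (H.eraseRowCol i) z k l) (resolventMatrix H z k l)
    have h3 := hΛ1 k l hkl
    nlinarith
  -- Passing to a minor changes an entry by at most KΛ² ≤ (KΛ)², hence d² becomes at most (d + KΛ)².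
  have hm3 : ∀ i k, k ≠ i →
      (resolventMatrix (H.eraseRowCol i) z k k).im ≤ (d + K * Λ) ^ 2 := by
    intro i k hk
    have h1 := norm_resolventMatrix_eraseRowCol_sub_le hH hz hK0 hk (hlow i) (hΛ1 k i hk)
      (hΛ1 i k hk.symm)
    have h2 := ((le_abs_self _).trans (Complex.abs_im_le_norm _)).trans h1
    rw [Complex.sub_im] at h2
    have h3 := him k
    have h4 : 0 ≤ d * (K * Λ) := by positivity
    have h5 : K * Λ ^ 2 ≤ (K * Λ) ^ 2 := by
      rw [mul_pow]
      gcongr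
      nlinarith
    nlinarith
  have he0 : 0 ≤ d + K * Λ := by positivity
  have hcq : 0 ≤ c / q := by positivity
  have hA : Λ ≤ 2 * (3 * c / q + c * ℓ * (2 * Λ / q + t * (d + K * Λ))) := by
    refine hΛ2 _ (by positivity) fun i j hij => ?_
    have h := hB.norm_off_diagonal_le hH hz ht ht0 hij (by positivity) he0 hcq (hm1 j i hij)
      (hm2 j) (hm3 j i hij)
    refine h.trans ?_
    calc _ ≤ (c / q * 3 + c * ℓ * (2 * Λ / q + t * (d + K * Λ))) * 2 := by
          gcongr
          exact hup j
      _ = _ := by ring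
  have hB1 := off_diagonal_bootstrap hK hc hℓ hq ht0 htℓ hd hΛ0 hA
  refine ⟨fun i j hij => (hΛ1 i j hij).trans hB1, fun i => ?_⟩
  obtain ⟨Y, hY1, hY2⟩ := hB.exists_selfConsistent hH hz ht ht0 i (by norm_num) (by positivity) he0
    (hm1 i) (hm2 i) (hm3 i)
  exact ⟨Y, hY1, hY2.trans
    (selfConsistent_error_bound hK hc hℓ hq ht0 htℓ hd hΛ0 hB1)⟩

end Deterministic

/-! ### Stability of the quadratic equation. -/

section Stability

/-- Stability of the quadratic equation with roots `s`, `s'`. -/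
theorem exists_dist_root_mul_le {m s s' : ℂ} {r : ℝ} (h : ‖(m - s) * (m - s')‖ ≤ r)
    (hs : 0 < s.im) (hs' : s'.im < 0) (hm : 0 ≤ m.im) :
    ∃ x y : ℝ, 0 ≤ x ∧ (x = ‖m - s‖ ∨ x = ‖m - s'‖) ∧ x ≤ y ∧ m.im ≤ y ∧ x * y ≤ 3 * r := by
  rw [norm_mul] at h
  have htri : ‖s - s'‖ ≤ ‖m - s‖ + ‖m - s'‖ := by
    rw [show s - s' = (m - s') - (m - s) by ring]
    exact (norm_sub_le _ _).trans (by rw [add_comm])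
  have him : s.im - s'.im ≤ ‖s - s'‖ := by
    rw [← Complex.sub_im]
    exact (le_abs_self _).trans (Complex.abs_im_le_norm _)
  have h1 : m.im - s.im ≤ ‖m - s‖ := by
    rw [← Complex.sub_im]
    exact (le_abs_self _).trans (Complex.abs_im_le_norm _)
  have h2 : m.im - s'.im ≤ ‖m - s'‖ := by
    rw [← Complex.sub_im]
    exact (le_abs_self _).trans (Complex.abs_im_le_norm _)
  have ha := norm_nonneg (m - s)
  have hb := norm_nonneg (m - s')
  have hc := norm_nonneg (s - s')
  -- x is the distance to the nearer root and y = x + |s - s'|. The farther distance is at least x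
  -- and at least |s - s'|/2, so y is at most three times it. The roots lie on opposite sides of the
  -- real axis, so Im m ≤ y.
  rcases le_total ‖m - s‖ ‖m - s'‖ with hle | hle
  · refine ⟨‖m - s‖, ‖m - s‖ + ‖s - s'‖, ha, Or.inl rfl, by linarith, by linarith, ?_⟩
    nlinarith
  · refine ⟨‖m - s'‖, ‖m - s'‖ + ‖s - s'‖, hb, Or.inr rfl, by linarith, by linarith, ?_⟩
    nlinarith

/-- The error υ depends on d, which is controlled only through y and υ itself. With u = √y, a = ℓ/q,
b = ℓ²t, eliminating d leaves x u² ≲ a + b² + b u and x ≤ u². If a + b² dominates, x² ≲ a + b², the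
square root rate. If b u dominates, x u ≲ b and x³ ≤ (x u)² ≲ b², the cube root rate. -/
theorem selfImproving_bound {x y υ d ℓ q t τ C : ℝ} (hx : 0 ≤ x) (hd : 0 ≤ d) (hℓ : 1 ≤ ℓ)
    (hq : 0 < q) (ht : 0 ≤ t) (hτ : 0 ≤ τ) (hτ1 : τ ≤ 1) (hτt : τ ^ 3 = t ^ 2) (hC : 1 ≤ C)
    (hυ : υ = C * (ℓ / q + ℓ ^ 2 * t * d) + t ^ 2) (hdy : d ^ 2 ≤ y + 8 * υ) (hxy : x ≤ y)
    (hprod : x * y ≤ 6 * υ) :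
    x ≤ 132 * C ^ 2 * (ℓ / √q + ℓ ^ 2 * τ) := by
  set a := ℓ / q with ha
  set b := ℓ ^ 2 * t with hb
  set u := √y with hu
  have hy0 : 0 ≤ y := hx.trans hxy
  have hu2 : u ^ 2 = y := Real.sq_sqrt hy0
  have hu0 : 0 ≤ u := Real.sqrt_nonneg _
  have ha0 : 0 ≤ a := by positivity
  have hb0 : 0 ≤ b := by positivity
  have hυ0 : 0 ≤ υ := by rw [hυ]; positivity
  set w := √υ with hw
  have hw2 : w ^ 2 = υ := Real.sq_sqrt hυ0
  have hw0 : 0 ≤ w := Real.sqrt_nonneg _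
  have hdu : d ≤ u + 3 * w := by
    refine le_of_sq_le_sq ?_ (by positivity)
    nlinarith [mul_nonneg hu0 hw0]
  have htb : t ^ 2 ≤ b ^ 2 := by
    rw [hb, mul_pow]
    have : 1 ≤ (ℓ ^ 2) ^ 2 := by
      have : 1 ≤ ℓ ^ 2 := by nlinarith
      nlinarith
    nlinarith [sq_nonneg t]
  have hC2 : C ≤ C ^ 2 := by nlinarith
  -- Young's inequality bounds 3Cb√υ by υ/2 + (9/2)C²b²; absorbing υ/2 doubles the rest, and 9 + 2 =
  -- 11.
  have hυ1 : υ ≤ 11 * C ^ 2 * (a + b ^ 2) + 2 * C * (b * u) := by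
    have h1 : C * (b * d) ≤ C * (b * (u + 3 * w)) := by gcongr
    have h2 : 3 * (C * b) * w ≤ w ^ 2 / 2 + 9 / 2 * (C * b) ^ 2 := by
      nlinarith [sq_nonneg (w - 3 * (C * b))]
    have h3 : C * a ≤ C ^ 2 * a := by gcongr
    have h4 : b ^ 2 ≤ C ^ 2 * b ^ 2 := by
      have : 1 ≤ C ^ 2 := by linarith
      nlinarith [sq_nonneg b]
    have h5 : (C * b) ^ 2 = C ^ 2 * b ^ 2 := by ring
    have h6 : 0 ≤ C ^ 2 * a := by positivity
    have h7 : 0 ≤ C ^ 2 * b ^ 2 := by positivity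
    have h8 : C * (b * (u + 3 * w)) = C * (b * u) + 3 * (C * b) * w := by ring
    rw [h8] at h1
    rw [h5] at h2
    rw [hw2] at h2
    have h9 : υ = C * a + C * (b * d) + t ^ 2 := by rw [hυ]; ring
    have h10 : 11 * C ^ 2 * (a + b ^ 2) = 11 * (C ^ 2 * a) + 11 * (C ^ 2 * b ^ 2) := by ring
    rw [h10]
    linarith
  have hCb : C * (b * u) ≤ C ^ 2 * (b * u) := by gcongr
  have hmain : x * u ^ 2 ≤ 66 * C ^ 2 * (a + b ^ 2 + b * u) := by
    rw [hu2]
    have h7 : 0 ≤ C ^ 2 * (b * u) := by positivity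
    linarith
  have hxu : x ≤ u ^ 2 := by rw [hu2]; exact hxy
  obtain ⟨A, hA⟩ : ∃ A, A = 132 * C ^ 2 := ⟨_, rfl⟩
  rw [← hA]
  have hA1 : 1 ≤ A := by linarith
  have hA0 : 0 ≤ A := by linarith
  have hρ0 : 0 ≤ A * (ℓ / √q + ℓ ^ 2 * τ) := by positivity
  have hq1 : (ℓ / √q) ^ 2 = ℓ ^ 2 / q := by rw [div_pow, Real.sq_sqrt hq.le]
  rcases le_total (b * u) (a + b ^ 2) with hcase | hcase
  · refine le_of_sq_le_sq ?_ hρ0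
    have h1 : x ^ 2 ≤ A * (a + b ^ 2) := by
      calc x ^ 2 = x * x := by ring
        _ ≤ x * u ^ 2 := by gcongr
        _ ≤ 66 * C ^ 2 * (a + b ^ 2 + b * u) := hmain
        _ ≤ 66 * C ^ 2 * (a + b ^ 2 + (a + b ^ 2)) := by gcongr
        _ = A * (a + b ^ 2) := by rw [hA]; ring
    have h2 : a ≤ ℓ ^ 2 / q := by
      rw [ha]
      gcongr
      exact le_self_pow₀ hℓ two_ne_zero
    have h3 : b ^ 2 ≤ (ℓ ^ 2 * τ) ^ 2 := by
      rw [hb, mul_pow, mul_pow, ← hτt]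
      gcongr 1
      exact pow_le_pow_of_le_one hτ hτ1 (by norm_num)
    have h4 : A ≤ A ^ 2 := le_self_pow₀ hA1 two_ne_zero
    calc x ^ 2 ≤ A * (a + b ^ 2) := h1
      _ ≤ A ^ 2 * ((ℓ / √q) ^ 2 + (ℓ ^ 2 * τ) ^ 2) := by rw [hq1]; gcongr
      _ ≤ (A * (ℓ / √q + ℓ ^ 2 * τ)) ^ 2 := by
        rw [mul_pow A]
        gcongr
        have : 0 ≤ ℓ / √q * (ℓ ^ 2 * τ) := by positivity
        rw [add_sq]
        linarith
  · rcases eq_or_lt_of_le hu0 with hu00 | hu00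
    · have : x ≤ 0 := by rw [← hu00] at hxu; simpa using hxu
      linarith
    have h1 : x * u ≤ A * b := by
      have : (x * u) * u ≤ (A * b) * u := by
        calc x * u * u = x * u ^ 2 := by ring
          _ ≤ 66 * C ^ 2 * (a + b ^ 2 + b * u) := hmain
          _ ≤ 66 * C ^ 2 * (b * u + b * u) := by gcongr
          _ = A * b * u := by rw [hA]; ring
      exact le_of_mul_le_mul_right this hu00
    have h2 : x ^ 3 ≤ (A * b) ^ 2 := by
      calc x ^ 3 = x ^ 2 * x := by ring
        _ ≤ x ^ 2 * u ^ 2 := by gcongr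
        _ = (x * u) ^ 2 := by ring
        _ ≤ (A * b) ^ 2 := by gcongr
    have h3 : (A * b) ^ 2 ≤ (A * (ℓ ^ 2 * τ)) ^ 3 := by
      have h31 : A ^ 2 ≤ A ^ 3 := pow_le_pow_right₀ hA1 (by norm_num)
      have h32 : ℓ ^ 4 ≤ ℓ ^ 6 := pow_le_pow_right₀ hℓ (by norm_num)
      calc (A * b) ^ 2 = A ^ 2 * ℓ ^ 4 * t ^ 2 := by rw [hb]; ring
        _ ≤ A ^ 3 * ℓ ^ 6 * t ^ 2 := by gcongr
        _ = (A * (ℓ ^ 2 * τ)) ^ 3 := by rw [← hτt]; ring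
    have h4 : x ≤ A * (ℓ ^ 2 * τ) := by
      by_contra hcon
      push Not at hcon
      have : (A * (ℓ ^ 2 * τ)) ^ 3 < x ^ 3 := by
        gcongr
      linarith
    refine h4.trans ?_
    gcongr
    have : 0 ≤ ℓ / √q := by positivity
    linarith

end Stability

/-! ### The local law at one spectral parameter, given an a priori bound. -/

section LocalLaw

variable {N : ℕ} {H : Matrix (Fin N) (Fin N) ℝ} {z : ℂ} {c ℓ q : ℝ}

/-- The entries of the resolvent are within `1 / K` of those of `m_sc`. -/
def AprioriBound (H : Matrix (Fin N) (Fin N) ℝ) (K : ℝ) (z : ℂ) : Prop :=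
  (∀ i, K * ‖resolventMatrix H z i i - semicircleStieltjes z‖ ≤ 1) ∧
    ∀ i j, i ≠ j → K * ‖resolventMatrix H z i j‖ ≤ 1

/-- The error parameter for the entries of the resolvent. -/
noncomputable def entryError (N : ℕ) (ℓ q : ℝ) (z : ℂ) : ℝ := ℓ / q + ℓ ^ 2 * (1 / √(N * z.im))

/-- The error parameter for the normalized trace of the resolvent. -/
noncomputable def traceError (N : ℕ) (ℓ q : ℝ) (z : ℂ) : ℝ := ℓ / √q + ℓ ^ 2 * (1 / (N * z.im) ^ (1 / 3 : ℝ))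

theorem empiricalStieltjes_im_eq (H : Matrix (Fin N) (Fin N) ℝ) (z : ℂ) :
    (empiricalStieltjes H z).im = 1 / (N : ℝ) * ∑ i, (resolventMatrix H z i i).im := by
  have : (1 / (N : ℂ)) = ((1 / (N : ℝ) : ℝ) : ℂ) := by push_cast; rfl
  rw [empiricalStieltjes, this, Complex.im_ofReal_mul, Matrix.trace, Complex.im_sum]
  rfl

theorem empiricalStieltjes_im_nonneg (hH : ∀ i j, H i j = H j i) (hz : 0 < z.im) :
    0 ≤ (empiricalStieltjes H z).im := by
  rw [empiricalStieltjes_im_eq]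
  exact mul_nonneg (by positivity)
    (Finset.sum_nonneg fun i _ => resolventMatrix_diag_im_nonneg hH hz i)

theorem norm_empiricalStieltjes_sub_le (hN : 0 < N) {δ : ℝ} {w : ℂ}
    (h : ∀ i, ‖resolventMatrix H z i i - w‖ ≤ δ) : ‖empiricalStieltjes H z - w‖ ≤ δ := by
  have hN' : (N : ℂ) ≠ 0 := by exact_mod_cast hN.ne'
  have hNR : (0 : ℝ) < N := by exact_mod_cast hN
  have h1 : empiricalStieltjes H z - w = (1 / (N : ℂ)) * ∑ i, (resolventMatrix H z i i - w) := by
    rw [empiricalStieltjes, Matrix.trace]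
    simp only [Finset.sum_sub_distrib, Finset.sum_const, Finset.card_univ, Fintype.card_fin,
      nsmul_eq_mul, Matrix.diag_apply]
    field_simp
  rw [h1, norm_mul, norm_div, norm_one, Complex.norm_natCast]
  have h2 : ‖∑ i, (resolventMatrix H z i i - w)‖ ≤ ∑ _i : Fin N, δ :=
    norm_sum_le_of_le _ fun i _ => h i
  simp only [Finset.sum_const, Finset.card_univ, Fintype.card_fin, nsmul_eq_mul] at h2
  calc _ ≤ 1 / (N : ℝ) * (N * δ) := by gcongr
    _ = _ := by field_simp

theorem norm_empiricalStieltjes_sub_empiricalStieltjes_le (hN : 0 < N)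
    (hH : ∀ i j, H i j = H j i) {z' : ℂ} (hz : 0 < z.im) (hz' : 0 < z'.im) :
    ‖empiricalStieltjes H z - empiricalStieltjes H z'‖ ≤ ‖z - z'‖ / (z.im * z'.im) := by
  have hNR : (0 : ℝ) < N := by exact_mod_cast hN
  rw [empiricalStieltjes, empiricalStieltjes, ← mul_sub, Matrix.trace, Matrix.trace,
    ← Finset.sum_sub_distrib, norm_mul, norm_div, norm_one, Complex.norm_natCast]
  have h2 := norm_sum_le_of_le Finset.univ
    fun (i : Fin N) _ => norm_resolventMatrix_sub_le hH hz hz' i i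
  simp only [Finset.sum_const, Finset.card_univ, Fintype.card_fin, nsmul_eq_mul] at h2
  calc _ ≤ 1 / (N : ℝ) * (N * (‖z - z'‖ / (z.im * z'.im))) := by
        gcongr
        exact h2
    _ = _ := by field_simp

theorem rpow_third_pow_three {u : ℝ} (hu : 0 ≤ u) : (u ^ (1 / 3 : ℝ)) ^ 3 = u := by
  rw [← Real.rpow_natCast, ← Real.rpow_mul hu]
  norm_num

/-- The conclusion of the local law at a single spectral parameter, up to the choice of a root. -/
theorem RowFormBounds.local_law_of_apriori (hB : RowFormBounds H z c ℓ q) (hN : 0 < N)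
    (hH : ∀ i j, H i j = H j i) (hz : 0 < z.im) {K : ℝ} (hK : 2 ≤ K) (hc : 1 ≤ c)
    (hℓ : 8 * c * K ≤ ℓ) (hq : ℓ ^ 3 ≤ q) (hNη : ℓ ^ 8 ≤ N * z.im)
    (hs : 2 ≤ K * ‖semicircleStieltjes z‖) (hap : AprioriBound H K z) :
    (∀ i j, i ≠ j → ‖resolventMatrix H z i j‖ ≤
      24 * c * (1 / q + ℓ ^ 2 * (1 / √(N * z.im)))) ∧
    (∀ i, ‖resolventMatrix H z i i - empiricalStieltjes H z‖ ≤
      1000 * c ^ 2 * K * entryError N ℓ q z) ∧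
    (‖empiricalStieltjes H z - semicircleStieltjes z‖ ≤
        132 * (41 * c ^ 2 * K) ^ 2 * traceError N ℓ q z ∨
      ‖empiricalStieltjes H z - (-z - semicircleStieltjes z)‖ ≤
        132 * (41 * c ^ 2 * K) ^ 2 * traceError N ℓ q z) := by
  have hℓ16 : 16 ≤ ℓ := by nlinarith
  have hℓ1 : 1 ≤ ℓ := by linarith
  have hq0 : 0 < q := lt_of_lt_of_le (by positivity) hq
  have hu1 : 1 ≤ N * z.im := le_trans (one_le_pow₀ hℓ1) hNη
  have hu0 : 0 < N * z.im := by linarith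
  rw [entryError, traceError]
  set u := N * z.im with hu
  set t := 1 / √u with ht
  set τ := 1 / u ^ (1 / 3 : ℝ) with hτ
  have htu : t ^ 2 = 1 / u := by rw [ht, div_pow, Real.sq_sqrt hu0.le, one_pow]
  have ht1 : t ^ 2 * u = 1 := by rw [htu]; field_simp
  have ht0 : 0 ≤ t := by positivity
  have htℓ : ℓ ^ 4 * t ≤ 1 := by
    refine le_of_sq_le_sq ?_ zero_le_one
    rw [mul_pow, htu, one_pow, mul_one_div, div_le_one hu0]
    calc (ℓ ^ 4) ^ 2 = ℓ ^ 8 := by ring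
      _ ≤ u := hNη
  have hτ0 : 0 ≤ τ := by positivity
  have hτ1 : τ ≤ 1 := by
    rw [hτ, div_le_one (by positivity)]
    exact Real.one_le_rpow hu1 (by norm_num)
  have hτt : τ ^ 3 = t ^ 2 := by
    rw [htu, hτ, div_pow, rpow_third_pow_three hu0.le, one_pow]
  have hs1 := norm_semicircleStieltjes_lt_one hz
  have hK0 : 0 < K := by linarith
  have hlow : ∀ i, 1 ≤ K * ‖resolventMatrix H z i i‖ := by
    intro i
    have h1 := hap.1 i
    have h2 := norm_sub_norm_le (semicircleStieltjes z) (resolventMatrix H z i i)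
    rw [norm_sub_rev] at h2
    nlinarith
  have hup : ∀ i, ‖resolventMatrix H z i i‖ ≤ 2 := by
    intro i
    have h1 := hap.1 i
    have h2 := norm_sub_norm_le (resolventMatrix H z i i) (semicircleStieltjes z)
    have h3 := norm_nonneg (resolventMatrix H z i i - semicircleStieltjes z)
    nlinarith
  have himup : ∀ i, (resolventMatrix H z i i).im ≤ 2 :=
    fun i => ((le_abs_self _).trans (Complex.abs_im_le_norm _)).trans (hup i)
  have hCK : 1 ≤ c ^ 2 * K := by nlinarith
  have hϕ0 : 0 ≤ ℓ / q := by positivity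
  have hψ0 : 0 ≤ ℓ ^ 2 * t := by positivity
  -- For individual entries the crude choice d = 2 suffices, as Im G_ii ≤ 2 ≤ 2².
  have himp := hB.improve hH hz ht1 ht0 hK hc hℓ hq htℓ zero_le_two hlow hup hap.2
    (fun i => (himup i).trans (by norm_num))
  refine ⟨fun i j hij => (himp.1 i j hij).trans ?_, fun i => ?_, ?_⟩
  · have h1 : ℓ * t ≤ ℓ ^ 2 * t := by gcongr; nlinarith
    have h2 : 0 ≤ 1 / q := by positivity
    calc 12 * c * (1 / q + ℓ * t * 2) ≤ 12 * c * (2 * (1 / q + ℓ ^ 2 * t)) := by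
          gcongr
          linarith
      _ = _ := by ring
  · refine ((selfConsistent_average hN hup himp.2).1 i).trans ?_
    have h1 : t ^ 2 ≤ ℓ ^ 2 * t := by
      have h2 : t ≤ ℓ ^ 2 := by
        have : t ≤ ℓ ^ 4 * t := by nlinarith [one_le_pow₀ hℓ1 (n := 4)]
        nlinarith
      nlinarith
    have h3 : t ^ 2 ≤ c ^ 2 * K * (ℓ ^ 2 * t) := by nlinarith
    have h4 : 0 ≤ c ^ 2 * K * (ℓ / q) := by positivity
    have h5 : 0 ≤ c ^ 2 * K * (ℓ ^ 2 * t) := by positivity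
    linarith
  -- For the trace the sharp d² = max Im G_ii is kept. It exceeds Im m by at most 8υ, which closes
  -- the circle needed by `selfImproving_bound`.
  · set D : ℝ := ⨆ i, (resolventMatrix H z i i).im with hD
    have hD1 : ∀ i, (resolventMatrix H z i i).im ≤ D := fun i =>
      le_ciSup (f := fun i => (resolventMatrix H z i i).im) (Set.finite_range _).bddAbove i
    have hD0 : 0 ≤ D := Real.iSup_nonneg fun i => resolventMatrix_diag_im_nonneg hH hz i
    have hd2 : √D ^ 2 = D := Real.sq_sqrt hD0
    have himp2 := hB.improve hH hz ht1 ht0 hK hc hℓ hq htℓ (Real.sqrt_nonneg D) hlow hup hap.2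
      (fun i => by rw [hd2]; exact hD1 i)
    set υ := 41 * c ^ 2 * K * (ℓ / q + ℓ ^ 2 * t * √D) + t ^ 2 with hυ
    obtain ⟨hav, hR⟩ := selfConsistent_average hN hup himp2.2
    have hυ0 : 0 ≤ υ := by positivity
    have him := empiricalStieltjes_im_nonneg hH hz
    have hDm : D ≤ (empiricalStieltjes H z).im + 8 * υ := by
      refine Real.iSup_le (fun i => ?_) (by positivity)
      have h1 := ((le_abs_self _).trans (Complex.abs_im_le_norm _)).trans (hav i)
      rw [Complex.sub_im] at h1
      linarith
    have hfac : (empiricalStieltjes H z - semicircleStieltjes z) *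
        (empiricalStieltjes H z - (-z - semicircleStieltjes z)) =
        empiricalStieltjes H z ^ 2 + z * empiricalStieltjes H z + 1 := by
      linear_combination semicircleStieltjes_mul_add hz
    rw [← hfac] at hR
    obtain ⟨x, y, hx0, hx, hxy, hmy, hprod⟩ := exists_dist_root_mul_le hR
      (semicircleStieltjes_im hz).1 (semicircleStieltjes_im hz).2 him
    have hfin := selfImproving_bound hx0 (Real.sqrt_nonneg D) hℓ1 hq0 ht0 hτ0 hτ1 hτt
      (C := 41 * c ^ 2 * K) (by linarith) hυ (by rw [hd2]; linarith) hxy (by linarith)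
    rcases hx with hx | hx
    · left; rw [← hx]; exact hfin
    · right; rw [← hx]; exact hfin

/-- At `Im z = 3` the a priori bound follows from the trivial bound on the resolvent. -/
theorem RowFormBounds.apriori_at_three (hB : RowFormBounds H z c ℓ q) (hN : 0 < N)
    (hH : ∀ i j, H i j = H j i) (hz3 : z.im = 3) {K : ℝ} (hK : 2 ≤ K) (hc : 1 ≤ c)
    (hℓ : 15 * c * K ≤ ℓ) (hq : ℓ ^ 3 ≤ q) (hNη : ℓ ^ 8 ≤ N * z.im) :
    AprioriBound H K z ∧ 2 ≤ ‖empiricalStieltjes H z - (-z - semicircleStieltjes z)‖ := by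
  have hz : 0 < z.im := by rw [hz3]; norm_num
  have hcK : 2 ≤ c * K := by nlinarith
  have hℓ16 : 16 ≤ ℓ := by nlinarith
  have hℓ1 : 1 ≤ ℓ := by linarith
  have hℓ0 : 0 < ℓ := by linarith
  have hq0 : 0 < q := lt_of_lt_of_le (by positivity) hq
  have hu1 : 1 ≤ N * z.im := le_trans (one_le_pow₀ hℓ1) hNη
  have hu0 : 0 < N * z.im := by linarith
  set t := 1 / √(N * z.im) with ht
  have htu : t ^ 2 = 1 / (N * z.im) := by rw [ht, div_pow, Real.sq_sqrt hu0.le, one_pow]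
  have ht1 : t ^ 2 * (N * z.im) = 1 := by rw [htu]; field_simp
  have ht0 : 0 ≤ t := by positivity
  have htℓ : ℓ ^ 4 * t ≤ 1 := by
    refine le_of_sq_le_sq ?_ zero_le_one
    rw [mul_pow, htu, one_pow, mul_one_div, div_le_one hu0]
    calc (ℓ ^ 4) ^ 2 = ℓ ^ 8 := by ring
      _ ≤ _ := hNη
  have hK0 : 0 < K := by linarith
  have hmin : ∀ i k l, ‖resolventMatrix (H.eraseRowCol i) z k l‖ ≤ 1 := fun i k l =>
    (norm_resolventMatrix_le (Matrix.eraseRowCol_symm hH i) hz k l).trans (by rw [hz3]; norm_num)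
  have hG3 : ∀ k l, ‖resolventMatrix H z k l‖ ≤ 1 / 3 := fun k l =>
    (norm_resolventMatrix_le hH hz k l).trans (by rw [hz3])
  have hmim : ∀ i k, (resolventMatrix (H.eraseRowCol i) z k k).im ≤ 1 ^ 2 := fun i k =>
    ((le_abs_self _).trans (Complex.abs_im_le_norm _)).trans ((hmin i k k).trans (by norm_num))
  have hqi : ℓ ^ 2 / q ≤ 1 / ℓ := by
    rw [div_le_div_iff₀ hq0 hℓ0]
    linarith [show ℓ ^ 2 * ℓ = ℓ ^ 3 by ring]
  have hqi0 : 1 / q ≤ 1 / ℓ := by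
    refine le_trans ?_ hqi
    gcongr
    nlinarith
  have hqi1 : ℓ / q ≤ 1 / ℓ := by
    refine le_trans ?_ hqi
    gcongr
    nlinarith
  have hti2 : ℓ ^ 2 * t ≤ 1 / ℓ := by
    rw [le_div_iff₀ hℓ0]
    have h1 : ℓ ^ 2 * t * ℓ = ℓ ^ 3 * t := by ring
    have h2 : ℓ ^ 3 * t ≤ ℓ ^ 4 * t := by gcongr; norm_num
    linarith
  have hti1 : ℓ * t ≤ 1 / ℓ := le_trans (by gcongr; nlinarith) hti2
  have htt : t ^ 2 ≤ 1 / ℓ := by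
    refine le_trans ?_ hti2
    have h2 : t ≤ ℓ ^ 2 := by
      have h3 : t ≤ ℓ ^ 4 * t := by nlinarith [one_le_pow₀ hℓ1 (n := 4)]
      nlinarith
    nlinarith
  have hcq : 0 ≤ c / q := by positivity
  -- At η = 3 all entries of minors have modulus at most 1, so b = b' = e = 1 is admissible and each
  -- of the five error terms is at most c/ℓ.
  set υ := 5 * c * (1 / ℓ) with hυ
  have hYs : ∀ i, ∃ Y : ℂ, resolventMatrix H z i i * (-z - empiricalStieltjes H z + Y) = 1 ∧
      ‖Y‖ ≤ υ := by
    intro i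
    obtain ⟨Y, hY1, hY2⟩ := hB.exists_selfConsistent hH hz ht1 ht0 i zero_le_one zero_le_one
      zero_le_one (fun k _ => hmin i k k) (fun k l _ _ _ => hmin i k l) (fun k _ => hmim i k)
    refine ⟨Y, hY1, hY2.trans ?_⟩
    calc c / q + c * ℓ * 1 / q + c * ℓ ^ 2 * (1 / q + t * 1) + t ^ 2
        = c * (1 / q) + c * (ℓ / q) + c * (ℓ ^ 2 / q) + c * (ℓ ^ 2 * t) + t ^ 2 := by ring
      _ ≤ c * (1 / ℓ) + c * (1 / ℓ) + c * (1 / ℓ) + c * (1 / ℓ) + c * (1 / ℓ) := by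
          gcongr
          refine htt.trans ?_
          have : 0 ≤ 1 / ℓ := by positivity
          nlinarith
      _ = υ := by rw [hυ]; ring
  obtain ⟨hav, hR⟩ := selfConsistent_average hN (κ := 1 / 3) (fun i => hG3 i i) hYs
  have hm3 : ‖empiricalStieltjes H z‖ ≤ 1 / 3 := by
    have := norm_empiricalStieltjes_sub_le (H := H) (z := z) (w := 0) (δ := 1 / 3) hN
      (fun i => by rw [sub_zero]; exact hG3 i i)
    simpa using this
  have hυ0 : 0 ≤ υ := by positivity
  set s := semicircleStieltjes z with hs
  have hprod := semicircleStieltjes_mul_add hz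
  rw [← hs] at hprod
  have hs' : 3 ≤ ‖-z - s‖ := by
    refine le_trans ?_ (Complex.abs_im_le_norm _)
    have := (semicircleStieltjes_im hz).1
    rw [abs_of_neg (semicircleStieltjes_im hz).2, Complex.sub_im, Complex.neg_im, hz3]
    linarith
  have hdist : 2 ≤ ‖empiricalStieltjes H z - (-z - s)‖ := by
    have := norm_sub_norm_le (-z - s) (empiricalStieltjes H z)
    rw [norm_sub_rev (-z - s) (empiricalStieltjes H z)] at this
    linarith
  refine ⟨⟨fun i => ?_, fun i j hij => ?_⟩, hdist⟩
  · have hfac : (empiricalStieltjes H z - s) * (empiricalStieltjes H z - (-z - s)) =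
        empiricalStieltjes H z ^ 2 + z * empiricalStieltjes H z + 1 := by
      linear_combination hprod
    rw [← hfac, norm_mul] at hR
    -- The other root has modulus at least 3 and |m| ≤ 1/3, so m is far from it; the bound on the
    -- product of distances then falls entirely on the distance to s.
    have h1 : ‖empiricalStieltjes H z - s‖ ≤ υ := by
      nlinarith [norm_nonneg (empiricalStieltjes H z - s)]
    have h2 : ‖resolventMatrix H z i i - s‖ ≤ 3 * υ := by
      rw [show resolventMatrix H z i i - s = (resolventMatrix H z i i - empiricalStieltjes H z) +
        (empiricalStieltjes H z - s) by ring]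
      refine (norm_add_le _ _).trans ?_
      have := hav i
      linarith
    calc K * ‖resolventMatrix H z i i - s‖ ≤ K * (3 * υ) := by gcongr
      _ = 15 * c * K / ℓ := by rw [hυ]; ring
      _ ≤ 1 := by rw [div_le_one hℓ0]; exact hℓ
  · have h := hB.norm_off_diagonal_le hH hz ht1 ht0 hij zero_le_one zero_le_one hcq
      (hmin j i i) (fun k l _ _ _ => hmin j k l) (hmim j i)
    have h2 : ‖resolventMatrix H z i j‖ ≤ 3 * c * (1 / ℓ) := by
      refine h.trans ?_
      calc (c / q * 1 + c * ℓ * (1 / q + t * 1)) * ‖resolventMatrix H z j j‖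
          ≤ (c / q * 1 + c * ℓ * (1 / q + t * 1)) * 1 := by
            gcongr
            exact (hG3 j j).trans (by norm_num)
        _ = c * (1 / q) + c * (ℓ / q) + c * (ℓ * t) := by ring
        _ ≤ c * (1 / ℓ) + c * (1 / ℓ) + c * (1 / ℓ) := by gcongr
        _ = _ := by ring
    calc K * ‖resolventMatrix H z i j‖ ≤ K * (3 * c * (1 / ℓ)) := by gcongr
      _ = 3 * c * K / ℓ := by ring
      _ ≤ 1 := by rw [div_le_one hℓ0]; linarith

end LocalLaw

/-! ### Continuity in the spectral parameter and descent along a grid. -/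

section Grid

variable {N : ℕ} {H : Matrix (Fin N) (Fin N) ℝ} {z w : ℂ} {c ℓ q K : ℝ}

/-- The constant in front of the error parameters. -/
def lawConst (c K : ℝ) : ℝ := 132 * (41 * c ^ 2 * K) ^ 2

/-- The conclusion of the local law at a spectral parameter, together with the fact that the
trace is close to the right root as soon as the two roots are well separated. -/
structure StrongBound (H : Matrix (Fin N) (Fin N) ℝ) (c ℓ q K : ℝ) (z : ℂ) : Prop where
  off : ∀ i j, i ≠ j → ‖resolventMatrix H z i j‖ ≤ 24 * c * (1 / q + ℓ ^ 2 * (1 / √(N * z.im)))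
  diag : ∀ i, ‖resolventMatrix H z i i - empiricalStieltjes H z‖ ≤
    1000 * c ^ 2 * K * entryError N ℓ q z
  trace : ‖empiricalStieltjes H z - semicircleStieltjes z‖ ≤
    6 * (lawConst c K * traceError N ℓ q z)
  trace_of_separated : 5 * (lawConst c K * traceError N ℓ q z) < ‖2 * semicircleStieltjes z + z‖ →
    ‖empiricalStieltjes H z - semicircleStieltjes z‖ ≤ lawConst c K * traceError N ℓ q z

theorem traceError_nonneg (hℓ : 0 ≤ ℓ) (hz : 0 < z.im) : 0 ≤ traceError N ℓ q z := by
  unfold traceError; positivity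

theorem entryError_nonneg (hℓ : 0 ≤ ℓ) (hq : 0 ≤ q) : 0 ≤ entryError N ℓ q z := by
  unfold entryError; positivity

/-- Let ρ be the trace error with its constant; m is within ρ of one of the roots. If the roots are
within 5ρ of each other, m is within 6ρ of s in any case. Otherwise `hsel` excludes the wrong root:
being within ρ of it and 3ρ of s would put the roots within 4ρ. -/
theorem StrongBound.of_apriori (hB : RowFormBounds H z c ℓ q) (hN : 0 < N)
    (hH : ∀ i j, H i j = H j i) (hz : 0 < z.im) (hK : 2 ≤ K) (hc : 1 ≤ c)
    (hℓ : 8 * c * K ≤ ℓ) (hq : ℓ ^ 3 ≤ q) (hNη : ℓ ^ 8 ≤ N * z.im)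
    (hs : 2 ≤ K * ‖semicircleStieltjes z‖) (hap : AprioriBound H K z)
    (hsel : 5 * (lawConst c K * traceError N ℓ q z) < ‖2 * semicircleStieltjes z + z‖ →
      ‖empiricalStieltjes H z - semicircleStieltjes z‖ ≤
        3 * (lawConst c K * traceError N ℓ q z) ∨
      lawConst c K * traceError N ℓ q z <
        ‖empiricalStieltjes H z - (-z - semicircleStieltjes z)‖) :
    StrongBound H c ℓ q K z := by
  obtain ⟨h1, h2, h3⟩ := hB.local_law_of_apriori hN hH hz hK hc hℓ hq hNη hs hap
  have hℓ0 : 0 ≤ ℓ := le_trans (by positivity) hℓ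
  change ‖_‖ ≤ lawConst c K * _ ∨ ‖_‖ ≤ lawConst c K * _ at h3
  have hρ0 : 0 ≤ lawConst c K * traceError N ℓ q z :=
    mul_nonneg (by unfold lawConst; positivity) (traceError_nonneg hℓ0 hz)
  set ρ := lawConst c K * traceError N ℓ q z
  set m := empiricalStieltjes H z
  set s := semicircleStieltjes z
  have htri : ‖2 * s + z‖ ≤ ‖m - s‖ + ‖m - (-z - s)‖ := by
    rw [show 2 * s + z = (m - (-z - s)) - (m - s) by ring]
    exact (norm_sub_le _ _).trans (by rw [add_comm])
  have htri' : ‖m - s‖ ≤ ‖m - (-z - s)‖ + ‖2 * s + z‖ := by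
    rw [show m - s = (m - (-z - s)) - (2 * s + z) by ring]
    exact norm_sub_le _ _
  have hsep : 5 * ρ < ‖2 * s + z‖ → ‖m - s‖ ≤ ρ := by
    intro h
    rcases h3 with h3 | h3
    · exact h3
    · rcases hsel h with h4 | h4 <;> linarith
  refine ⟨h1, h2, ?_, hsep⟩
  rcases le_or_gt ‖2 * s + z‖ (5 * ρ) with h | h
  · rcases h3 with h3 | h3 <;> linarith
  · have := hsep h
    linarith

/-- Makes the errors small enough to renew the a priori bound. The trace error dictates the
exponents: (ℓx)² ≤ ℓ³ ≤ q and (ℓ²x)³ ≤ ℓ⁸ ≤ Nη when x² ≤ ℓ. -/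
theorem errors_le_of_large {x : ℝ} (hx : 1 ≤ x) (hxℓ : x ^ 2 ≤ ℓ) (hq : ℓ ^ 3 ≤ q)
    (hNη : ℓ ^ 8 ≤ N * z.im) :
    1 / q + ℓ ^ 2 * (1 / √(N * z.im)) ≤ 2 / x ∧ entryError N ℓ q z ≤ 2 / x ∧
      traceError N ℓ q z ≤ 2 / x := by
  have hx0 : 0 < x := by linarith
  have hxx : x ≤ x ^ 2 := le_self_pow₀ hx two_ne_zero
  have hℓ1 : 1 ≤ ℓ := by linarith
  have hℓ0 : 0 < ℓ := by linarith
  have hq0 : 0 < q := lt_of_lt_of_le (by positivity) hq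
  have hu1 : 1 ≤ N * z.im := le_trans (one_le_pow₀ hℓ1) hNη
  rw [entryError, traceError]
  set u := N * z.im
  have hu0 : 0 < u := by linarith
  have h1 : ℓ / q ≤ 1 / x := by
    rw [div_le_div_iff₀ hq0 hx0, one_mul]
    refine le_trans ?_ hq
    calc ℓ * x ≤ ℓ * ℓ := by gcongr; linarith
      _ = ℓ ^ 2 := by ring
      _ ≤ ℓ ^ 3 := pow_le_pow_right₀ hℓ1 (by norm_num)
  have h2 : 1 / q ≤ 1 / x := le_trans (by gcongr) h1
  have h3 : ℓ ^ 2 * (1 / √u) ≤ 1 / x := by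
    rw [mul_one_div, div_le_div_iff₀ (by positivity) hx0, one_mul]
    refine Real.le_sqrt_of_sq_le ?_
    refine le_trans ?_ hNη
    calc (ℓ ^ 2 * x) ^ 2 = ℓ ^ 4 * x ^ 2 := by ring
      _ ≤ ℓ ^ 4 * ℓ := by gcongr
      _ = ℓ ^ 5 := by ring
      _ ≤ ℓ ^ 8 := pow_le_pow_right₀ hℓ1 (by norm_num)
  have h4 : ℓ / √q ≤ 1 / x := by
    rw [div_le_div_iff₀ (by positivity) hx0, one_mul]
    refine Real.le_sqrt_of_sq_le (le_trans ?_ hq)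
    calc (ℓ * x) ^ 2 = ℓ ^ 2 * x ^ 2 := by ring
      _ ≤ ℓ ^ 2 * ℓ := by gcongr
      _ = ℓ ^ 3 := by ring
  have h5 : ℓ ^ 2 * (1 / u ^ (1 / 3 : ℝ)) ≤ 1 / x := by
    rw [mul_one_div, div_le_div_iff₀ (by positivity) hx0, one_mul]
    refine le_of_pow_le_pow_left₀ three_ne_zero (by positivity) ?_
    rw [rpow_third_pow_three hu0.le]
    refine le_trans ?_ hNη
    calc (ℓ ^ 2 * x) ^ 3 = ℓ ^ 6 * x ^ 3 := by ring
      _ ≤ ℓ ^ 6 * x ^ 4 := by gcongr; norm_num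
      _ = ℓ ^ 6 * (x ^ 2) ^ 2 := by ring
      _ ≤ ℓ ^ 6 * ℓ ^ 2 := by gcongr
      _ = ℓ ^ 8 := by ring
  have h6 : 2 / x = 1 / x + 1 / x := by ring
  rw [h6]
  exact ⟨add_le_add h2 h3, add_le_add h1 h3, add_le_add h4 h5⟩

theorem one_div_sqrt_antitone (hN : 0 < N) (hw : 0 < w.im) (hwz : w.im ≤ z.im) :
    1 / √(N * z.im) ≤ 1 / √(N * w.im) := by
  have : (0 : ℝ) < N := by exact_mod_cast hN
  gcongr

theorem entryError_antitone (hN : 0 < N) (hw : 0 < w.im) (hwz : w.im ≤ z.im) :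
    entryError N ℓ q z ≤ entryError N ℓ q w := by
  unfold entryError
  have := one_div_sqrt_antitone hN hw hwz
  gcongr

theorem traceError_antitone (hN : 0 < N) (hw : 0 < w.im) (hwz : w.im ≤ z.im) :
    traceError N ℓ q z ≤ traceError N ℓ q w := by
  have : (0 : ℝ) < N := by exact_mod_cast hN
  unfold traceError
  gcongr

theorem norm_add_ofReal_le (hre : w.re = z.re) (hw : 0 < w.im) (hwz : w.im ≤ z.im) (a : ℝ) :
    ‖w + a‖ ≤ ‖z + a‖ := by
  refine le_of_sq_le_sq ?_ (norm_nonneg _)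
  rw [← Complex.normSq_eq_norm_sq, ← Complex.normSq_eq_norm_sq, Complex.normSq_apply,
    Complex.normSq_apply]
  simp only [Complex.add_re, Complex.add_im, Complex.ofReal_re, Complex.ofReal_im, hre]
  nlinarith

/-- The distance of the two roots increases with `Im z`. -/
theorem root_separation_mono (hre : w.re = z.re) (hw : 0 < w.im) (hwz : w.im ≤ z.im) :
    ‖2 * semicircleStieltjes w + w‖ ≤ ‖2 * semicircleStieltjes z + z‖ := by
  -- The difference of the roots squares to the discriminant v² - 4 = (v + 2)(v - 2), and both
  -- factors grow in modulus with Im v.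
  have key : ∀ v : ℂ, 0 < v.im →
      ‖2 * semicircleStieltjes v + v‖ ^ 2 = ‖v + (2 : ℝ)‖ * ‖v + (-2 : ℝ)‖ := by
    intro v hv
    rw [← norm_pow, ← norm_mul]
    congr 1
    push_cast
    linear_combination 4 * semicircleStieltjes_sq_add hv
  refine le_of_sq_le_sq ?_ (norm_nonneg _)
  rw [key w hw, key z (hw.trans_le hwz)]
  gcongr <;> exact norm_add_ofReal_le hre hw hwz _

theorem lawConst_ge (hc : 1 ≤ c) (hK : 2 ≤ K) : 1 ≤ lawConst c K ∧
    1000 * c ^ 2 * K + 2 ≤ lawConst c K ∧ 24 * c + 1 ≤ lawConst c K := by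
  have h1 : 2 ≤ c ^ 2 * K := by nlinarith
  have h2 : c ≤ c ^ 2 * K := by nlinarith
  have h3 : c ^ 2 * K ≤ (c ^ 2 * K) ^ 2 := le_self_pow₀ (by linarith) two_ne_zero
  have h4 : lawConst c K = 221892 * (c ^ 2 * K) ^ 2 := by unfold lawConst; ring
  rw [h4]
  refine ⟨?_, ?_, ?_⟩ <;> linarith

/-- With x = 28AK each error unit is at most A · 2/x = 1/(14K). A diagonal entry uses 1 + 6 = 7
units, half of the allowance 1/K; the passage from z to w costs 2δ, at most the other half. -/
theorem StrongBound.apriori_below (hS : StrongBound H c ℓ q K z) (hH : ∀ i j, H i j = H j i)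
    (hw : 0 < w.im) (hz : 0 < z.im) (hK : 2 ≤ K) (hc : 1 ≤ c)
    (hxℓ : (28 * lawConst c K * K) ^ 2 ≤ ℓ) (hq : ℓ ^ 3 ≤ q) (hNz : ℓ ^ 8 ≤ N * z.im)
    {δ : ℝ} (hδ : ‖z - w‖ / (z.im * w.im) ≤ δ) (hδ' : ‖z - w‖ / z.im ≤ δ) (hKδ : 4 * K * δ ≤ 1) :
    AprioriBound H K w := by
  obtain ⟨hA1, hA2, hA3⟩ := lawConst_ge hc hK
  have hx : 1 ≤ 28 * lawConst c K * K := by nlinarith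
  obtain ⟨he1, he2, he3⟩ := errors_le_of_large (z := z) (N := N) hx hxℓ hq hNz
  set A := lawConst c K
  have hK0 : 0 < K := by linarith
  have hA0 : 0 < A := by linarith
  have hy : K * (A * (2 / (28 * A * K))) = 1 / 14 := by field_simp; norm_num
  set y := 2 / (28 * A * K) with hydef
  have hy0 : 0 ≤ y := by positivity
  constructor
  · intro i
    have h1 := (norm_resolventMatrix_sub_le hH hz hw i i).trans hδ
    have h2 := (norm_semicircleStieltjes_sub_le hz hw).trans hδ'
    have h3 : ‖resolventMatrix H z i i - empiricalStieltjes H z‖ ≤ A * y :=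
      (hS.diag i).trans (mul_le_mul (by linarith) he2
        (entryError_nonneg (le_trans (by positivity) hxℓ)
          (le_trans (pow_nonneg (le_trans (by positivity) hxℓ) 3) hq)) hA0.le)
    have h4 : ‖empiricalStieltjes H z - semicircleStieltjes z‖ ≤ 6 * (A * y) :=
      hS.trace.trans (by gcongr)
    have h5 : ‖resolventMatrix H w i i - semicircleStieltjes w‖ ≤ δ + A * y + 6 * (A * y) + δ := by
      rw [show resolventMatrix H w i i - semicircleStieltjes w =
        -(resolventMatrix H z i i - resolventMatrix H w i i) +
        (resolventMatrix H z i i - empiricalStieltjes H z) +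
        (empiricalStieltjes H z - semicircleStieltjes z) +
        (semicircleStieltjes z - semicircleStieltjes w) by ring]
      refine (norm_add_le _ _).trans (add_le_add ((norm_add_le _ _).trans
        (add_le_add ((norm_add_le _ _).trans (add_le_add ?_ h3)) h4)) h2)
      rwa [norm_neg]
    calc K * ‖resolventMatrix H w i i - semicircleStieltjes w‖
        ≤ K * (δ + A * y + 6 * (A * y) + δ) := by gcongr
      _ = 7 * (K * (A * y)) + 2 * K * δ := by ring
      _ ≤ 1 := by rw [hy]; linarith
  · intro i j hij
    have h1 := (norm_resolventMatrix_sub_le hH hz hw i j).trans hδ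
    have h3 : ‖resolventMatrix H z i j‖ ≤ A * y :=
      (hS.off i j hij).trans (mul_le_mul (by linarith) he1
        (add_nonneg (by
          have : 0 ≤ q := le_trans (pow_nonneg (le_trans (by positivity) hxℓ) 3) hq
          positivity) (by positivity)) hA0.le)
    have h5 : ‖resolventMatrix H w i j‖ ≤ δ + A * y := by
      rw [show resolventMatrix H w i j = -(resolventMatrix H z i j - resolventMatrix H w i j) +
        resolventMatrix H z i j by ring]
      refine (norm_add_le _ _).trans (add_le_add ?_ h3)
      rwa [norm_neg]
    calc K * ‖resolventMatrix H w i j‖ ≤ K * (δ + A * y) := by gcongr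
      _ = K * (A * y) + K * δ := by ring
      _ ≤ 1 := by rw [hy]; linarith

/-- If the roots are separated at w, they are also separated at the higher point z, where the
distance is larger and the error smaller. So m(z) is within ρ(w) of s(z), and moving m and s down to
w costs 2δ ≤ 2ρ(w): the 3ρ allowed by `StrongBound.of_apriori`. If they are not separated, nothing
has to be selected. -/
theorem StrongBound.step (hS : StrongBound H c ℓ q K z) (hB : RowFormBounds H w c ℓ q)
    (hN : 0 < N) (hH : ∀ i j, H i j = H j i)
    (hre : w.re = z.re) (hw : 0 < w.im) (hwz : w.im ≤ z.im) (hK : 2 ≤ K) (hc : 1 ≤ c)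
    (hℓ : 8 * c * K ≤ ℓ) (hxℓ : (28 * lawConst c K * K) ^ 2 ≤ ℓ) (hq : ℓ ^ 3 ≤ q)
    (hNw : ℓ ^ 8 ≤ N * w.im) (hs : 2 ≤ K * ‖semicircleStieltjes w‖)
    {δ : ℝ} (hδ : ‖z - w‖ / (z.im * w.im) ≤ δ) (hδ' : ‖z - w‖ / z.im ≤ δ) (hKδ : 4 * K * δ ≤ 1)
    (hδρ : δ ≤ traceError N ℓ q w) :
    StrongBound H c ℓ q K w := by
  have hz : 0 < z.im := hw.trans_le hwz
  have hNz : ℓ ^ 8 ≤ N * z.im := hNw.trans (by gcongr)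
  refine StrongBound.of_apriori hB hN hH hw hK hc hℓ hq hNw hs
    (hS.apriori_below hH hw hz hK hc hxℓ hq hNz hδ hδ' hKδ) fun hsep => Or.inl ?_
  obtain ⟨hA1, -, -⟩ := lawConst_ge hc hK
  have hρ := traceError_antitone (ℓ := ℓ) (q := q) hN hw hwz
  have hρA : lawConst c K * traceError N ℓ q z ≤ lawConst c K * traceError N ℓ q w := by gcongr
  have h1 := hS.trace_of_separated (lt_of_le_of_lt (by linarith)
    (hsep.trans_le (root_separation_mono hre hw hwz)))
  have h2 := (norm_semicircleStieltjes_sub_le hz hw).trans hδ'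
  have h3 := (norm_empiricalStieltjes_sub_empiricalStieltjes_le hN hH hz hw).trans hδ
  have hℓ0 : 0 ≤ ℓ := le_trans (by positivity) hxℓ
  have h4 : δ ≤ lawConst c K * traceError N ℓ q w := by
    have := traceError_nonneg (N := N) (q := q) hℓ0 hw
    nlinarith
  rw [show empiricalStieltjes H w - semicircleStieltjes w =
    -(empiricalStieltjes H z - empiricalStieltjes H w) +
    (empiricalStieltjes H z - semicircleStieltjes z) +
    (semicircleStieltjes z - semicircleStieltjes w) by ring]
  refine (norm_add_le _ _).trans ((add_le_add ((norm_add_le _ _).trans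
    (add_le_add (le_of_eq (norm_neg _)) le_rfl)) le_rfl).trans ?_)
  linarith

/-- A grid point in the strip `0 < Im z ≤ 3`. -/
def gridPoint (h : ℝ) (a : ℤ) (k : ℕ) : ℂ := ⟨a * h, 3 - k * h⟩

theorem exists_int_mul_near {h : ℝ} (hh : 0 < h) (E : ℝ) :
    ∃ a : ℤ, |(a : ℝ) * h| ≤ |E| ∧ |(a : ℝ) * h - E| ≤ h := by
  rcases le_total 0 E with hE | hE
  · refine ⟨⌊E / h⌋, ?_, ?_⟩
    · have h1 : (⌊E / h⌋ : ℝ) * h ≤ E := by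
        rw [← le_div_iff₀ hh]; exact Int.floor_le _
      have h2 : (0 : ℝ) ≤ ⌊E / h⌋ := by exact_mod_cast Int.floor_nonneg.2 (by positivity)
      rw [abs_of_nonneg (by positivity), abs_of_nonneg hE]
      exact h1
    · have h1 : (⌊E / h⌋ : ℝ) * h ≤ E := by
        rw [← le_div_iff₀ hh]; exact Int.floor_le _
      have h2 : E ≤ ((⌊E / h⌋ : ℝ) + 1) * h := by
        rw [← div_le_iff₀ hh]; exact (Int.lt_floor_add_one _).le
      rw [abs_le]
      constructor <;> linarith
  · refine ⟨⌈E / h⌉, ?_, ?_⟩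
    · have h1 : E ≤ (⌈E / h⌉ : ℝ) * h := by
        rw [← div_le_iff₀ hh]; exact Int.le_ceil _
      have h2 : (⌈E / h⌉ : ℝ) ≤ 0 := by
        exact_mod_cast Int.ceil_nonpos.2 (div_nonpos_of_nonpos_of_nonneg hE hh.le)
      rw [abs_of_nonpos (mul_nonpos_of_nonpos_of_nonneg h2 hh.le), abs_of_nonpos hE]
      linarith
    · have h1 : E ≤ (⌈E / h⌉ : ℝ) * h := by
        rw [← div_le_iff₀ hh]; exact Int.le_ceil _
      have h2 : ((⌈E / h⌉ : ℝ) - 1) * h ≤ E := by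
        rw [← le_div_iff₀ hh]
        linarith [Int.ceil_lt_add_one (E / h)]
      rw [abs_le]
      constructor <;> linarith

theorem exists_nat_mul_near {h x : ℝ} (hh : 0 < h) (hx : 0 ≤ x) :
    ∃ k : ℕ, (k : ℝ) * h ≤ x ∧ x - k * h ≤ h := by
  refine ⟨⌊x / h⌋₊, ?_, ?_⟩
  · rw [← le_div_iff₀ hh]; exact Nat.floor_le (by positivity)
  · have : x ≤ ((⌊x / h⌋₊ : ℝ) + 1) * h := by
      rw [← div_le_iff₀ hh]; exact (Nat.lt_floor_add_one _).le
    linarith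

/-- Source of the value K = 2(S + 4): in the strip |z| + 1 ≤ S + 4. -/
theorem le_norm_semicircleStieltjes_of_strip {S : ℝ} (hz : 0 < z.im) (hre : |z.re| ≤ S)
    (him : z.im ≤ 3) : 2 ≤ 2 * (S + 4) * ‖semicircleStieltjes z‖ := by
  have h1 := inv_le_norm_semicircleStieltjes hz
  have h2 : ‖z‖ ≤ S + 3 := by
    refine (Complex.norm_le_abs_re_add_abs_im z).trans ?_
    rw [abs_of_pos hz]
    linarith
  nlinarith [norm_nonneg (semicircleStieltjes z)]

/-- The discretisation error 2/N² is harmless: Nη ≤ 3N ≤ N²/2, so it lies below the error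
parameters. -/
theorem errors_ge_of_large (hℓ : 1 ≤ ℓ) (hq : 0 < q) (hN : (6 : ℝ) ≤ N) (hη : z.im ≤ 3)
    (hNη : 1 ≤ N * z.im) :
    2 / (N : ℝ) ^ 2 ≤ ℓ ^ 2 * (1 / √(N * z.im)) ∧ 2 / (N : ℝ) ^ 2 ≤ traceError N ℓ q z := by
  rw [traceError]
  set u := N * z.im with hu
  have hu0 : 0 < u := by linarith
  have h0 : 2 / (N : ℝ) ^ 2 ≤ 1 / u := by
    rw [div_le_div_iff₀ (by positivity) hu0, one_mul, hu]
    nlinarith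
  have hℓ2 : 1 ≤ ℓ ^ 2 := one_le_pow₀ hℓ
  have h1 : √u ≤ u := by
    rw [Real.sqrt_le_left hu0.le]
    exact le_self_pow₀ hNη two_ne_zero
  have h2 : u ^ (1 / 3 : ℝ) ≤ u := by
    calc u ^ (1 / 3 : ℝ) ≤ u ^ (1 : ℝ) := Real.rpow_le_rpow_of_exponent_le hNη (by norm_num)
      _ = u := Real.rpow_one u
  have hs : 0 < √u := Real.sqrt_pos.2 hu0
  have ht : 0 < u ^ (1 / 3 : ℝ) := Real.rpow_pos_of_pos hu0 _
  have h3 : 1 / u ≤ 1 / √u := one_div_le_one_div_of_le hs h1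
  have h4 : 1 / u ≤ 1 / u ^ (1 / 3 : ℝ) := one_div_le_one_div_of_le ht h2
  have h5 : 0 < 1 / u := by positivity
  refine ⟨by nlinarith, ?_⟩
  have : 0 ≤ ℓ / √q := by positivity
  nlinarith

variable {S h : ℝ}

/-- Induction down a vertical line, from the trivial regime Im z = 3 to the lowest height where Nη ≥
ℓ⁸. -/
theorem strongBound_gridPoint (hS : 3 ≤ S) (hN : (6 : ℝ) ≤ N) (hNS : 16 * (S + 4) ≤ N)
    (hH : ∀ i j, H i j = H j i) (hc : 1 ≤ c)
    (hxℓ : (28 * lawConst c (2 * (S + 4)) * (2 * (S + 4))) ^ 2 ≤ ℓ) (hq : ℓ ^ 3 ≤ q)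
    (hh : h = 1 / (N : ℝ) ^ 4)
    (hB : ∀ (a : ℤ) (k : ℕ), |(a : ℝ) * h| ≤ S → 0 < 3 - k * h →
      RowFormBounds H (gridPoint h a k) c ℓ q)
    (a : ℤ) (ha : |(a : ℝ) * h| ≤ S) (k : ℕ) (hk : ℓ ^ 8 ≤ N * (3 - k * h)) :
    StrongBound H c ℓ q (2 * (S + 4)) (gridPoint h a k) := by
  set K := 2 * (S + 4) with hKdef
  have hK : 2 ≤ K := by linarith
  obtain ⟨hA1, hA2, hA3⟩ := lawConst_ge hc hK
  have hx1 : 28 * lawConst c K * K ≤ (28 * lawConst c K * K) ^ 2 :=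
    le_self_pow₀ (by nlinarith) two_ne_zero
  have hcA : c * K ≤ lawConst c K * K := by gcongr; linarith
  have hcK : 2 ≤ c * K := by nlinarith
  have hℓ15 : 15 * c * K ≤ ℓ := by linarith
  have hℓ8 : 8 * c * K ≤ ℓ := by linarith
  have hℓ1 : 1 ≤ ℓ := by linarith
  have hq0 : 0 < q := lt_of_lt_of_le (by positivity) hq
  have hN0 : (0 : ℝ) < N := by linarith
  have hNn : 0 < N := by exact_mod_cast hN0
  have hh0 : 0 < h := by rw [hh]; positivity
  induction k with
  | zero =>
    have him : (gridPoint h a 0).im = 3 := by simp [gridPoint]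
    have hz : 0 < (gridPoint h a 0).im := by rw [him]; norm_num
    have hNη : ℓ ^ 8 ≤ N * (gridPoint h a 0).im := by rw [him]; simpa using hk
    have hB0 := hB a 0 ha (by simp)
    obtain ⟨hap, h2⟩ := hB0.apriori_at_three hNn hH him hK hc hℓ15 hq hNη
    -- At the top m is at distance at least 2 from the wrong root, which exceeds the error; this is
    -- the second alternative of `hsel`.
    refine StrongBound.of_apriori hB0 hNn hH hz hK hc hℓ8 hq hNη
      (le_norm_semicircleStieltjes_of_strip hz ha him.le) hap fun _ => Or.inr (lt_of_lt_of_le ?_ h2)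
    have h3 := (errors_le_of_large (z := gridPoint h a 0) (N := N)
      (by nlinarith : 1 ≤ 28 * lawConst c K * K) hxℓ hq hNη).2.2
    calc lawConst c K * traceError N ℓ q (gridPoint h a 0)
        ≤ lawConst c K * (2 / (28 * lawConst c K * K)) := by gcongr
      _ = 1 / (14 * K) := by field_simp; norm_num
      _ < 2 := by rw [div_lt_iff₀ (by positivity)]; linarith
  | succ k ih =>
    have hℓ8' : 1 ≤ ℓ ^ 8 := one_le_pow₀ hℓ1
    push_cast at hk
    have hk' : ℓ ^ 8 ≤ N * (3 - k * h) := hk.trans (by gcongr; linarith)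
    have hS' := ih hk'
    have himw : (gridPoint h a (k + 1)).im = 3 - ((k : ℝ) + 1) * h := by simp [gridPoint]
    have himz : (gridPoint h a k).im = 3 - k * h := by simp [gridPoint]
    -- Since ℓ⁸ ≥ 1, all heights in play are at least 1/N; a step of length N⁻⁴ therefore changes G
    -- by at most N⁻².
    have hw1 : 1 / (N : ℝ) ≤ 3 - ((k : ℝ) + 1) * h := by
      rw [div_le_iff₀ hN0]; linarith
    have hz1 : 1 / (N : ℝ) ≤ 3 - (k : ℝ) * h := by
      linarith
    have hN1 : 0 < 1 / (N : ℝ) := by positivity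
    have hnorm : ‖gridPoint h a k - gridPoint h a (k + 1)‖ = h := by
      have : gridPoint h a k - gridPoint h a (k + 1) = (h : ℂ) * Complex.I := by
        apply Complex.ext <;> simp [gridPoint]
        ring
      rw [this, norm_mul, Complex.norm_I, mul_one, Complex.norm_real, Real.norm_eq_abs,
        abs_of_pos hh0]
    have hNinv : (N : ℝ) * (1 / N) = 1 := by field_simp
    refine hS'.step (δ := 2 / (N : ℝ) ^ 2) (hB a (k + 1) ha (by push_cast; linarith)) hNn hH rfl
      (by rw [himw]; linarith) (by rw [himw, himz]; linarith) hK hc hℓ8 hxℓ hq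
      (by rw [himw]; exact hk)
      (le_norm_semicircleStieltjes_of_strip (by rw [himw]; linarith) ha (by
        rw [himw]
        have : 0 ≤ ((k : ℝ) + 1) * h := by positivity
        linarith)) ?_ ?_ ?_ ?_
    · rw [hnorm, himw, himz]
      calc h / ((3 - k * h) * (3 - (k + 1) * h)) ≤ h / (1 / N * (1 / N)) := by
            gcongr
            linarith
        _ = 1 / (N : ℝ) ^ 2 := by rw [hh]; field_simp
        _ ≤ 2 / (N : ℝ) ^ 2 := by gcongr; norm_num
    · rw [hnorm, himz]
      calc h / (3 - k * h) ≤ h / (1 / N) := by gcongr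
        _ = 1 / (N : ℝ) ^ 3 := by rw [hh]; field_simp
        _ ≤ 2 / (N : ℝ) ^ 2 := by
          gcongr
          · norm_num
          · linarith
          · norm_num
    · rw [mul_div_assoc', div_le_one (by positivity)]
      nlinarith
    · refine (errors_ge_of_large hℓ1 hq0 hN ?_ ?_).2
      · rw [himw]
        have : 0 ≤ ((k : ℝ) + 1) * h := by positivity
        linarith
      · rw [himw]; linarith

/-- If the row form bounds hold on a fine grid, then the local law holds in the whole domain. -/
theorem local_law_of_grid (hS : 3 ≤ S) (hN : (6 : ℝ) ≤ N) (hNS : 16 * (S + 4) ≤ N)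
    (hH : ∀ i j, H i j = H j i) (hc : 1 ≤ c)
    (hxℓ : (28 * lawConst c (2 * (S + 4)) * (2 * (S + 4))) ^ 2 ≤ ℓ) (hq : ℓ ^ 3 ≤ q)
    (hh : h = 1 / (N : ℝ) ^ 4)
    (hB : ∀ (a : ℤ) (k : ℕ), |(a : ℝ) * h| ≤ S → 0 < 3 - k * h →
      RowFormBounds H (gridPoint h a k) c ℓ q)
    (hre : |z.re| ≤ S) (hNη : ℓ ^ 8 ≤ N * z.im) (him : z.im ≤ 3) :
    (∀ i j, i ≠ j → ‖resolventMatrix H z i j‖ ≤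
      8 * lawConst c (2 * (S + 4)) * (1 / q + ℓ ^ 2 * (1 / √(N * z.im)))) ∧
    (∀ i, ‖resolventMatrix H z i i - empiricalStieltjes H z‖ ≤
      8 * lawConst c (2 * (S + 4)) * entryError N ℓ q z) ∧
    ‖empiricalStieltjes H z - semicircleStieltjes z‖ ≤
      8 * lawConst c (2 * (S + 4)) * traceError N ℓ q z := by
  have hN0 : (0 : ℝ) < N := by linarith
  have hNn : 0 < N := by exact_mod_cast hN0
  have hh0 : 0 < h := by rw [hh]; positivity
  obtain ⟨a, ha1, ha2⟩ := exists_int_mul_near hh0 z.re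
  -- Rounding k down puts the grid point above z, where the errors are no larger; the real part is
  -- rounded towards zero to stay within S.
  obtain ⟨k, hk1, hk2⟩ := exists_nat_mul_near hh0 (x := 3 - z.im) (by linarith)
  have hstrong := strongBound_gridPoint hS hN hNS hH hc hxℓ hq hh hB a (ha1.trans hre) k
    (hNη.trans (by gcongr; linarith))
  have hK : 2 ≤ 2 * (S + 4) := by linarith
  obtain ⟨hA1, hA2, hA3⟩ := lawConst_ge hc hK
  have hx1 : (1 : ℝ) ≤ (28 * lawConst c (2 * (S + 4)) * (2 * (S + 4))) ^ 2 :=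
    one_le_pow₀ (by nlinarith)
  have hℓ1 : 1 ≤ ℓ := hx1.trans hxℓ
  have hℓ0 : 0 ≤ ℓ := by linarith
  have hq0 : 0 < q := lt_of_lt_of_le (by positivity) hq
  set A := lawConst c (2 * (S + 4))
  set w := gridPoint h a k with hw
  have hwim : w.im = 3 - k * h := by simp [hw, gridPoint]
  have hwre : w.re = a * h := by simp [hw, gridPoint]
  have hNη1 : 1 ≤ N * z.im := (one_le_pow₀ hℓ1).trans hNη
  have hz1 : 1 / (N : ℝ) ≤ z.im := by rw [div_le_iff₀ hN0]; linarith
  have hN1 : 0 < 1 / (N : ℝ) := by positivity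
  have hz0 : 0 < z.im := by linarith
  have hzw : z.im ≤ w.im := by rw [hwim]; linarith
  have hw0 : 0 < w.im := by linarith
  have hnorm : ‖w - z‖ ≤ 2 * h := by
    refine (Complex.norm_le_abs_re_add_abs_im _).trans ?_
    rw [Complex.sub_re, Complex.sub_im, hwre, hwim, abs_of_nonneg (by linarith : 0 ≤ 3 - k * h - z.im)]
    linarith
  have hδ : ‖w - z‖ / (w.im * z.im) ≤ 2 / (N : ℝ) ^ 2 := by
    calc ‖w - z‖ / (w.im * z.im) ≤ 2 * h / (1 / N * (1 / N)) := by
          gcongr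
          linarith
      _ = 2 / (N : ℝ) ^ 2 := by rw [hh]; field_simp
  have hδ' : ‖w - z‖ / w.im ≤ 2 / (N : ℝ) ^ 2 := by
    calc ‖w - z‖ / w.im ≤ 2 * h / (1 / N) := by
          gcongr
          linarith
      _ = 2 / (N : ℝ) ^ 3 := by rw [hh]; field_simp
      _ ≤ 2 / (N : ℝ) ^ 2 := by
        gcongr
        · linarith
        · norm_num
  obtain ⟨hg1, hg2⟩ := errors_ge_of_large hℓ1 hq0 hN him hNη1
  set δ := 2 / (N : ℝ) ^ 2
  refine ⟨fun i j hij => ?_, fun i => ?_, ?_⟩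
  · have h1 := (norm_resolventMatrix_sub_le hH hw0 hz0 i j).trans hδ
    have h2 := hstrong.off i j hij
    have h3 : 1 / q + ℓ ^ 2 * (1 / √(N * w.im)) ≤ 1 / q + ℓ ^ 2 * (1 / √(N * z.im)) := by
      have := one_div_sqrt_antitone hNn hz0 hzw
      gcongr
    have h4 : 0 ≤ 1 / q := by positivity
    have h5 : ‖resolventMatrix H z i j‖ ≤ ‖resolventMatrix H w i j‖ + δ := by
      have := norm_sub_norm_le (resolventMatrix H z i j) (resolventMatrix H w i j)
      rw [norm_sub_rev] at this
      linarith
    set X := 1 / q + ℓ ^ 2 * (1 / √(N * z.im))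
    have hX : δ ≤ X := by linarith
    have hδ0 : 0 ≤ δ := by positivity
    calc ‖resolventMatrix H z i j‖ ≤ 24 * c * X + X := by
          have : 24 * c * (1 / q + ℓ ^ 2 * (1 / √(N * w.im))) ≤ 24 * c * X := by gcongr
          linarith
      _ = (24 * c + 1) * X := by ring
      _ ≤ 8 * A * X := by gcongr <;> linarith
  · have h1 := (norm_resolventMatrix_sub_le hH hw0 hz0 i i).trans hδ
    have h2 := hstrong.diag i
    have h3 := entryError_antitone (ℓ := ℓ) (q := q) hNn hz0 hzw
    have h4 := (norm_empiricalStieltjes_sub_empiricalStieltjes_le hNn hH hw0 hz0).trans hδ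
    have hX : δ ≤ entryError N ℓ q z := by
      have : 0 ≤ ℓ / q := by positivity
      unfold entryError
      linarith
    have hδ0 : 0 ≤ δ := by positivity
    have h5 : ‖resolventMatrix H z i i - empiricalStieltjes H z‖ ≤
        δ + ‖resolventMatrix H w i i - empiricalStieltjes H w‖ + δ := by
      rw [show resolventMatrix H z i i - empiricalStieltjes H z =
        -(resolventMatrix H w i i - resolventMatrix H z i i) +
        (resolventMatrix H w i i - empiricalStieltjes H w) +
        (empiricalStieltjes H w - empiricalStieltjes H z) by ring]
      refine (norm_add_le _ _).trans (add_le_add ((norm_add_le _ _).trans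
        (add_le_add ?_ le_rfl)) h4)
      rwa [norm_neg]
    set X := entryError N ℓ q z
    calc ‖resolventMatrix H z i i - empiricalStieltjes H z‖
        ≤ X + 1000 * c ^ 2 * (2 * (S + 4)) * X + X := by
          have : 1000 * c ^ 2 * (2 * (S + 4)) * entryError N ℓ q w ≤
            1000 * c ^ 2 * (2 * (S + 4)) * X := by gcongr
          linarith
      _ = (1000 * c ^ 2 * (2 * (S + 4)) + 2) * X := by ring
      _ ≤ 8 * A * X := by gcongr <;> linarith
  · have h2 := hstrong.trace
    have h3 := traceError_antitone (ℓ := ℓ) (q := q) hNn hz0 hzw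
    have h4 := (norm_empiricalStieltjes_sub_empiricalStieltjes_le hNn hH hw0 hz0).trans hδ
    have h1 := (norm_semicircleStieltjes_sub_le hw0 hz0).trans hδ'
    have hδ0 : 0 ≤ δ := by positivity
    have h5 : ‖empiricalStieltjes H z - semicircleStieltjes z‖ ≤
        δ + ‖empiricalStieltjes H w - semicircleStieltjes w‖ + δ := by
      rw [show empiricalStieltjes H z - semicircleStieltjes z =
        -(empiricalStieltjes H w - empiricalStieltjes H z) +
        (empiricalStieltjes H w - semicircleStieltjes w) +
        (semicircleStieltjes w - semicircleStieltjes z) by ring]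
      refine (norm_add_le _ _).trans (add_le_add ((norm_add_le _ _).trans
        (add_le_add ?_ le_rfl)) h1)
      rwa [norm_neg]
    set X := traceError N ℓ q z
    have h6 : A * traceError N ℓ q w ≤ A * X := by gcongr
    have h7 : X ≤ A * X := by nlinarith
    linarith

end Grid

/-! ### Moment bounds for linear and quadratic forms. -/

section Moments

open scoped ENNReal

variable {Ω : Type*} [MeasurableSpace Ω] {μ : Measure Ω}

theorem memLp_iff_integrable_abs_pow {f : Ω → ℝ} (hf : Measurable f) {p : ℕ} (hp : p ≠ 0) :
    MemLp f p μ ↔ Integrable (fun ω => |f ω| ^ p) μ := by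
  rw [← integrable_norm_rpow_iff hf.aestronglyMeasurable (by exact_mod_cast hp)
    (ENNReal.natCast_ne_top p)]
  simp

variable [IsProbabilityMeasure μ]

theorem MeasureTheory.MemLp.integrable_pow_of_le {f : Ω → ℝ} (hf : Measurable f) {p j : ℕ}
    (h : MemLp f p μ) (hj : j ≤ p) : Integrable (fun ω => f ω ^ j) μ := by
  have h1 : MemLp f j μ := h.mono_exponent (by exact_mod_cast hj)
  have h2 := h1.integrable_norm_pow'
  refine h2.mono (hf.pow_const j).aestronglyMeasurable (Filter.Eventually.of_forall fun ω => ?_)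
  simp

theorem pow_sub_mul_pow_le {a b : ℝ} (ha : 0 ≤ a) (hb : 0 ≤ b) {j p : ℕ} (hj : j ≤ p) :
    a ^ (p - j) * b ^ j ≤ a ^ p + b ^ p := by
  rcases le_total a b with h | h
  · calc a ^ (p - j) * b ^ j ≤ b ^ (p - j) * b ^ j := by gcongr
      _ = b ^ p := by rw [← pow_add, Nat.sub_add_cancel hj]
      _ ≤ a ^ p + b ^ p := by have := pow_nonneg ha p; linarith
  · calc a ^ (p - j) * b ^ j ≤ a ^ (p - j) * a ^ j := by gcongr
      _ = a ^ p := by rw [← pow_add, Nat.sub_add_cancel hj]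
      _ ≤ a ^ p + b ^ p := by have := pow_nonneg hb p; linarith

theorem integrable_pow_mul_pow {S c : Ω → ℝ} (hS : Measurable S) (hc : Measurable c) {p j : ℕ}
    (hSp : MemLp S p μ) (hcp : MemLp c p μ) (hp : p ≠ 0) (hj : j ≤ p) :
    Integrable (fun ω => S ω ^ (p - j) * c ω ^ j) μ := by
  have h1 := (memLp_iff_integrable_abs_pow hS hp).1 hSp
  have h2 := (memLp_iff_integrable_abs_pow hc hp).1 hcp
  refine (h1.add h2).mono ((hS.pow_const _).mul (hc.pow_const _)).aestronglyMeasurable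
    (Filter.Eventually.of_forall fun ω => ?_)
  simp only [Pi.add_apply, norm_mul, norm_pow, Real.norm_eq_abs]
  exact (pow_sub_mul_pow_le (abs_nonneg _) (abs_nonneg _) hj).trans (le_abs_self _)

/-- A substitute for Hölder at the price of a factor 2: scale S by x and use u^(p-j) v^j ≤ u^p + v^p
pointwise. -/
theorem abs_integral_pow_mul_pow_le {S c : Ω → ℝ} (hS : Measurable S) (hc : Measurable c)
    {p j : ℕ} (hSp : MemLp S p μ) (hcp : MemLp c p μ) (hp : p ≠ 0) (hpe : Even p) (hj : j ≤ p)
    {x : ℝ} (hx : 0 < x) (hSx : ∫ ω, S ω ^ p ∂μ ≤ x ^ p) (hc1 : ∫ ω, c ω ^ p ∂μ ≤ 1) :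
    |∫ ω, S ω ^ (p - j) * c ω ^ j ∂μ| ≤ 2 * x ^ (p - j) := by
  have h1 := hSp.integrable_pow_of_le hS le_rfl
  have h2 := hcp.integrable_pow_of_le hc le_rfl
  have hb : ∀ ω, |S ω ^ (p - j) * c ω ^ j| ≤ x ^ (p - j) * (S ω ^ p / x ^ p + c ω ^ p) := by
    intro ω
    have := pow_sub_mul_pow_le (a := |S ω| / x) (b := |c ω|) (by positivity) (by positivity) hj
    rw [div_pow, div_pow, hpe.pow_abs, hpe.pow_abs] at this
    rw [abs_mul, abs_pow, abs_pow]
    calc |S ω| ^ (p - j) * |c ω| ^ j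
        = x ^ (p - j) * (|S ω| ^ (p - j) / x ^ (p - j) * |c ω| ^ j) := by field_simp
      _ ≤ _ := by gcongr
  have h3 : Integrable (fun ω => S ω ^ p / x ^ p) μ := h1.div_const _
  calc |∫ ω, S ω ^ (p - j) * c ω ^ j ∂μ| ≤ ∫ ω, |S ω ^ (p - j) * c ω ^ j| ∂μ :=
        abs_integral_le_integral_abs
    _ ≤ ∫ ω, x ^ (p - j) * (S ω ^ p / x ^ p + c ω ^ p) ∂μ :=
        integral_mono (integrable_pow_mul_pow hS hc hSp hcp hp hj).abs
          ((h3.add h2).const_mul _) hb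
    _ = x ^ (p - j) * ((∫ ω, S ω ^ p ∂μ) / x ^ p + ∫ ω, c ω ^ p ∂μ) := by
        rw [integral_const_mul, integral_add h3 h2, integral_div]
    _ ≤ x ^ (p - j) * (1 + 1) := by
        gcongr
        rw [div_le_one (by positivity)]
        exact hSx
    _ = _ := by ring

theorem sum_inv_factorial_le (p : ℕ) :
    ∑ j ∈ Finset.range (p + 1), (if 2 ≤ j then 1 / (j.factorial : ℝ) else 0) ≤ 1 := by
  have h := Real.sum_le_exp_of_nonneg zero_le_one (p + 1)
  have he := Real.exp_one_lt_d9
  rcases Nat.eq_zero_or_pos p with rfl | hp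
  · simp
  have h2 : ∑ j ∈ Finset.range (p + 1), ((1 : ℝ) ^ j / (j.factorial : ℝ) -
      (if 2 ≤ j then 1 / (j.factorial : ℝ) else 0)) = 2 := by
    have : ∀ j ∈ Finset.range (p + 1), ((1 : ℝ) ^ j / (j.factorial : ℝ) -
        (if 2 ≤ j then 1 / (j.factorial : ℝ) else 0)) = if j < 2 then 1 else 0 := by
      intro j _
      by_cases hj : 2 ≤ j
      · simp [hj, not_lt.2 hj]
      · interval_cases j <;> simp
    rw [Finset.sum_congr rfl this, ← Finset.sum_filter]
    have : (Finset.range (p + 1)).filter (· < 2) = {0, 1} := by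
      ext j
      simp only [Finset.mem_filter, Finset.mem_range, Finset.mem_insert, Finset.mem_singleton]
      omega
    rw [this]
    norm_num
  rw [Finset.sum_sub_distrib] at h2
  linarith

/-- One step of a martingale-type moment bound. -/
theorem moment_step {S c a : Ω → ℝ} (hS : Measurable S) (hc : Measurable c) (ha : Measurable a)
    {p : ℕ} (hp : 2 ≤ p) (hpe : Even p) (hSp : MemLp S p μ) (hcp : MemLp c p μ)
    (hap : MemLp a p μ) (hind : IndepFun (fun ω => (S ω, c ω)) a μ) (ha0 : ∫ ω, a ω ∂μ = 0)
    {M X g w : ℝ} (hX : 0 < X) (hXM : X ^ p ≤ M) (hSM : ∫ ω, S ω ^ p ∂μ ≤ M)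
    (hc1 : ∫ ω, c ω ^ p ∂μ ≤ 1) (hw : 0 ≤ w)
    (hmom : ∀ j, 2 ≤ j → j ≤ p → (p * |g|) ^ j * ∫ ω, |a ω| ^ j ∂μ ≤ w * X ^ j) :
    MemLp (fun ω => S ω + g * c ω * a ω) p μ ∧
      ∫ ω, (S ω + g * c ω * a ω) ^ p ∂μ ≤ (1 + 2 * w) * M := by
  have hp0 : p ≠ 0 := by omega
  have hM : 0 < M := lt_of_lt_of_le (by positivity) hXM
  -- x = M^(1/p) bounds the L^p norm of S; as X ≤ x, the moment hypothesis at scale X may be used at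
  -- scale x.
  obtain ⟨x, hx0, hxM⟩ : ∃ x : ℝ, 0 < x ∧ x ^ p = M :=
    ⟨M ^ ((p : ℝ)⁻¹), Real.rpow_pos_of_pos hM _, Real.rpow_inv_natCast_pow hM.le hp0⟩
  have hXx : X ≤ x := le_of_pow_le_pow_left₀ hp0 hx0.le (by rw [hxM]; exact hXM)
  have hIa : ∀ j ≤ p, Integrable (fun ω => a ω ^ j) μ := fun j hj => hap.integrable_pow_of_le ha hj
  have hISc : ∀ j ≤ p, Integrable (fun ω => S ω ^ (p - j) * c ω ^ j) μ := fun j hj =>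
    integrable_pow_mul_pow hS hc hSp hcp hp0 hj
  have hindj : ∀ j, IndepFun (fun ω => S ω ^ (p - j) * c ω ^ j) (fun ω => a ω ^ j) μ := by
    intro j
    exact hind.comp (φ := fun y : ℝ × ℝ => y.1 ^ (p - j) * y.2 ^ j) (ψ := fun y : ℝ => y ^ j)
      (by fun_prop) (by fun_prop)
  have hmem : MemLp (fun ω => c ω * a ω) p μ := by
    have hmca : Measurable fun ω => c ω * a ω := hc.mul ha
    rw [memLp_iff_integrable_abs_pow hmca hp0]
    have hca : IndepFun (fun ω => |c ω| ^ p) (fun ω => |a ω| ^ p) μ :=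
      hind.comp (φ := fun y : ℝ × ℝ => |y.2| ^ p) (ψ := fun y : ℝ => |y| ^ p)
        (by fun_prop) (by fun_prop)
    have := hca.integrable_mul ((memLp_iff_integrable_abs_pow hc hp0).1 hcp)
      ((memLp_iff_integrable_abs_pow ha hp0).1 hap)
    refine this.congr (Filter.Eventually.of_forall fun ω => ?_)
    simp [abs_mul, mul_pow]
  refine ⟨hSp.add ((hmem.const_mul g).ae_eq (Filter.Eventually.of_forall fun ω => by
    simp [mul_assoc])), ?_⟩
  have hexp : ∀ ω, (S ω + g * c ω * a ω) ^ p = ∑ j ∈ Finset.range (p + 1),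
      (p.choose j * g ^ j) * ((S ω ^ (p - j) * c ω ^ j) * a ω ^ j) := by
    intro ω
    rw [add_comm, add_pow]
    refine Finset.sum_congr rfl fun j _ => ?_
    ring
  have hterm : ∀ j ∈ Finset.range (p + 1),
      Integrable (fun ω => (p.choose j * g ^ j) * ((S ω ^ (p - j) * c ω ^ j) * a ω ^ j)) μ := by
    intro j hj
    have hj' : j ≤ p := by simpa [Nat.lt_succ_iff] using hj
    exact ((hindj j).integrable_mul (hISc j hj') (hIa j hj')).const_mul _
  simp_rw [hexp]
  rw [integral_finsetSum _ hterm]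
  -- In the binomial expansion j = 0 gives M and j = 1 vanishes, because a is centred and
  -- independent of (S, c). For j ≥ 2 the binomial coefficient is at most p^j / j!, and ∑_{j≥2} 1/j!
  -- ≤ 1 leaves the increment 2wM.
  have hval : ∀ j ∈ Finset.range (p + 1),
      ∫ ω, (p.choose j * g ^ j) * ((S ω ^ (p - j) * c ω ^ j) * a ω ^ j) ∂μ ≤
        (if j = 0 then M else 0) + 2 * w * M * (if 2 ≤ j then 1 / (j.factorial : ℝ) else 0) := by
    intro j hj
    have hj' : j ≤ p := by simpa [Nat.lt_succ_iff] using hj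
    rw [integral_const_mul, (hindj j).integral_fun_mul_eq_mul_integral
      (hISc j hj').aestronglyMeasurable (hIa j hj').aestronglyMeasurable]
    rcases Nat.lt_or_ge j 2 with hj2 | hj2
    · interval_cases j
      · simpa using hSM
      · simp [ha0]
    · rw [if_neg (by omega), if_pos hj2, zero_add]
      have hA := abs_integral_pow_mul_pow_le hS hc hSp hcp hp0 hpe hj' hx0 (by rw [hxM]; exact hSM)
        hc1
      have hB : |∫ ω, a ω ^ j ∂μ| ≤ ∫ ω, |a ω| ^ j ∂μ := by
        refine abs_integral_le_integral_abs.trans (le_of_eq ?_)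
        simp only [abs_pow]
      have hchoose := Nat.choose_le_pow_div (α := ℝ) j p
      have hf : (0 : ℝ) < j.factorial := by exact_mod_cast Nat.factorial_pos j
      have hI0 : 0 ≤ ∫ ω, |a ω| ^ j ∂μ := integral_nonneg fun ω => by positivity
      refine (le_abs_self _).trans ?_
      rw [abs_mul, abs_mul, abs_mul, abs_pow, Nat.abs_cast]
      calc (p.choose j : ℝ) * |g| ^ j *
            (|∫ ω, S ω ^ (p - j) * c ω ^ j ∂μ| * |∫ ω, a ω ^ j ∂μ|)
          ≤ ((p : ℝ) ^ j / j.factorial) * |g| ^ j * (2 * x ^ (p - j) * ∫ ω, |a ω| ^ j ∂μ) := by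
            gcongr
        _ = 2 * x ^ (p - j) / j.factorial * ((p * |g|) ^ j * ∫ ω, |a ω| ^ j ∂μ) := by
            rw [mul_pow]; ring
        _ ≤ 2 * x ^ (p - j) / j.factorial * (w * x ^ j) := by
            have h1 := hmom j hj2 hj'
            have h2 : w * X ^ j ≤ w * x ^ j := by gcongr
            exact mul_le_mul_of_nonneg_left (h1.trans h2) (by positivity)
        _ = 2 * w * M * (1 / j.factorial) := by
            rw [← hxM, ← Nat.sub_add_cancel hj', pow_add]
            simp only [Nat.sub_add_cancel hj']
            ring
  refine (Finset.sum_le_sum hval).trans ?_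
  rw [Finset.sum_add_distrib, ← Finset.mul_sum]
  have h1 : ∑ j ∈ Finset.range (p + 1), (if j = 0 then M else 0) = M := by simp
  rw [h1]
  have h2 := sum_inv_factorial_le p
  have h3 : 0 ≤ 2 * w * M := by positivity
  nlinarith

variable {ι : Type*} [DecidableEq ι] {a : ι → Ω → ℝ}

theorem ProbabilityTheory.iIndepFun.indepFun_comp_of_notMem (hind : iIndepFun a μ)
    (hmeas : ∀ i, Measurable (a i)) {T : Finset ι} {i : ι} (hi : i ∉ T) {β : Type*}
    [MeasurableSpace β] {φ : (T → ℝ) → β} (hφ : Measurable φ) :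
    IndepFun (fun ω => φ fun k => a k ω) (a i) μ := by
  have h := hind.indepFun_finset T {i} (by simpa using hi) hmeas
  have hψ : Measurable fun y : ({i} : Finset ι) → ℝ => y ⟨i, Finset.mem_singleton_self i⟩ :=
    measurable_pi_apply _
  exact h.comp hφ hψ

/-- Moment bound for linear forms in independent variables. -/
theorem moment_linear_form (hind : iIndepFun a μ) (hmeas : ∀ i, Measurable (a i))
    (hzero : ∀ i, ∫ ω, a i ω ∂μ = 0) {p : ℕ} (hp : 2 ≤ p) (hpe : Even p)
    (hLp : ∀ i, MemLp (a i) p μ) {C n q : ℝ} (hC : 0 < C) (hn : 0 < n) (hq : 0 < q)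
    (hmom : ∀ i j, 2 ≤ j → j ≤ p → ∫ ω, |a i ω| ^ j ∂μ ≤ C ^ j / (n * q ^ (j - 2)))
    (A : ι → ℝ) {b σ : ℝ} (hσ : 0 < σ) (hb : ∀ i, |A i| ≤ b) (hb0 : 0 ≤ b) (T : Finset ι)
    (hA : ∑ i ∈ T, A i ^ 2 ≤ n * σ ^ 2) :
    MemLp (fun ω => ∑ i ∈ T, A i * a i ω) p μ ∧
      ∫ ω, (∑ i ∈ T, A i * a i ω) ^ p ∂μ ≤ Real.exp 2 * (p * C * (b / q + σ)) ^ p := by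
  have hp0 : p ≠ 0 := by omega
  set X := p * C * (b / q + σ) with hX
  have hX0 : 0 < X := by positivity
  -- Adding variable i multiplies the bound by 1 + 2w_i ≤ exp(2w_i) with w_i = A_i²/(nσ²). These
  -- weights sum to at most 1, whence the factor e².
  have main : ∀ T' : Finset ι, MemLp (fun ω => ∑ i ∈ T', A i * a i ω) p μ ∧
      ∫ ω, (∑ i ∈ T', A i * a i ω) ^ p ∂μ ≤
        Real.exp (2 * ∑ i ∈ T', A i ^ 2 / (n * σ ^ 2)) * X ^ p := by
    intro T'
    induction T' using Finset.induction_on with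
    | empty =>
      refine ⟨by simp, ?_⟩
      simp [hp0]
      positivity
    | insert i T' hi ih =>
      have hmeasS : Measurable fun ω => ∑ k ∈ T', A k * a k ω :=
        Finset.measurable_sum _ fun k _ => (hmeas k).const_mul _
      have hindS : IndepFun (fun ω => (∑ k ∈ T', A k * a k ω, (1 : ℝ))) (a i) μ := by
        have hφ : Measurable fun y : T' → ℝ => (∑ k : T', A k * y k, (1 : ℝ)) := by fun_prop
        have h2 := hind.indepFun_comp_of_notMem hmeas hi hφ
        convert h2 using 1
        funext ω
        rw [Finset.sum_coe_sort T' (fun k => A k * a k ω)]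
      have hW : 0 ≤ ∑ i ∈ T', A i ^ 2 / (n * σ ^ 2) :=
        Finset.sum_nonneg fun k _ => by positivity
      have hstep := moment_step (g := A i) (w := A i ^ 2 / (n * σ ^ 2))
        (M := Real.exp (2 * ∑ i ∈ T', A i ^ 2 / (n * σ ^ 2)) * X ^ p)
        hmeasS measurable_const (hmeas i) hp hpe ih.1 (memLp_const (1 : ℝ)) (hLp i)
        hindS (hzero i) hX0 (le_mul_of_one_le_left (by positivity) (Real.one_le_exp (by linarith)))
        ih.2 (by simp) (by positivity) (by
          intro j hj2 hjp
          have h1 : |A i| ^ j ≤ A i ^ 2 * b ^ (j - 2) := by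
            calc |A i| ^ j = |A i| ^ 2 * |A i| ^ (j - 2) := by
                  rw [← pow_add, Nat.add_sub_cancel' hj2]
              _ = A i ^ 2 * |A i| ^ (j - 2) := by rw [sq_abs]
              _ ≤ _ := by gcongr; exact hb i
          have h2 : σ ^ 2 * (b / q) ^ (j - 2) ≤ (b / q + σ) ^ j := by
            calc σ ^ 2 * (b / q) ^ (j - 2) ≤ (b / q + σ) ^ 2 * (b / q + σ) ^ (j - 2) := by
                  have : 0 ≤ b / q := by positivity
                  gcongr <;> linarith
              _ = _ := by rw [← pow_add, Nat.add_sub_cancel' hj2]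
          calc (p * |A i|) ^ j * ∫ ω, |a i ω| ^ j ∂μ
              ≤ (p * |A i|) ^ j * (C ^ j / (n * q ^ (j - 2))) := by
                gcongr
                exact hmom i j hj2 hjp
            _ = (p * C) ^ j * (|A i| ^ j / (n * q ^ (j - 2))) := by
                rw [mul_pow, mul_pow]; ring
            _ ≤ (p * C) ^ j * (A i ^ 2 * b ^ (j - 2) / (n * q ^ (j - 2))) := by gcongr
            _ = A i ^ 2 / (n * σ ^ 2) * ((p * C) ^ j * (σ ^ 2 * (b / q) ^ (j - 2))) := by
                rw [div_pow]
                field_simp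
            _ ≤ A i ^ 2 / (n * σ ^ 2) * ((p * C) ^ j * (b / q + σ) ^ j) := by gcongr
            _ = A i ^ 2 / (n * σ ^ 2) * X ^ j := by rw [hX, mul_pow (p * C)])
      have hfun : ∀ ω, ∑ k ∈ insert i T', A k * a k ω =
          ∑ k ∈ T', A k * a k ω + A i * 1 * a i ω := by
        intro ω
        rw [Finset.sum_insert hi]
        ring
      simp only [hfun]
      refine ⟨hstep.1, hstep.2.trans ?_⟩
      rw [Finset.sum_insert hi, mul_add, Real.exp_add, ← mul_assoc]
      gcongr
      have := Real.add_one_le_exp (2 * (A i ^ 2 / (n * σ ^ 2)))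
      linarith
  refine ⟨(main T).1, (main T).2.trans ?_⟩
  gcongr
  rw [← Finset.sum_div]
  have : (∑ i ∈ T, A i ^ 2) / (n * σ ^ 2) ≤ 1 := (div_le_one (by positivity)).2 hA
  linarith

/-- Moment bound for off-diagonal quadratic forms in independent variables. -/
theorem moment_quadratic_form (hind : iIndepFun a μ) (hmeas : ∀ i, Measurable (a i))
    (hzero : ∀ i, ∫ ω, a i ω ∂μ = 0) {p : ℕ} (hp : 2 ≤ p) (hpe : Even p)
    (hLp : ∀ i, MemLp (a i) p μ) {C n q : ℝ} (hC : 0 < C) (hn : 0 < n) (hq : 1 ≤ q)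
    (hmom : ∀ i j, 2 ≤ j → j ≤ p → ∫ ω, |a i ω| ^ j ∂μ ≤ C ^ j / (n * q ^ (j - 2)))
    (B : ι → ι → ℝ) {b β : ℝ} (hβ : 0 < β) (hb : ∀ i k, |B i k| ≤ b) (hb0 : 0 ≤ b)
    (T : Finset ι) (hT : (T.card : ℝ) ≤ n)
    (hrow : ∀ i, ∑ k ∈ T, B i k ^ 2 ≤ n * β ^ 2) (hcol : ∀ i, ∑ k ∈ T, B k i ^ 2 ≤ n * β ^ 2) :
    MemLp (fun ω => ∑ k ∈ T, ∑ l ∈ T, if k = l then 0 else B k l * a k ω * a l ω) p μ ∧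
      ∫ ω, (∑ k ∈ T, ∑ l ∈ T, if k = l then 0 else B k l * a k ω * a l ω) ^ p ∂μ ≤
        Real.exp 2 * (2 * Real.exp 2 * (p * C) ^ 2 * (b / q + β)) ^ p := by
  have hp0 : p ≠ 0 := by omega
  have hq0 : 0 < q := by linarith
  -- The newly added a_i is multiplied by the linear form ∑ (B_ik + B_ki) a_k in the earlier
  -- variables, whose L^p norm is at most γ by `moment_linear_form`. Dividing by γ normalises it for
  -- `moment_step`; each variable then has weight 1/n, and there are at most n of them.
  obtain ⟨γ, hγ⟩ : ∃ γ, γ = Real.exp 2 * (p * C * (2 * b / q + 2 * β)) := ⟨_, rfl⟩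
  have hγ0 : 0 < γ := by rw [hγ]; positivity
  obtain ⟨X, hX⟩ : ∃ X, X = p * C * γ := ⟨_, rfl⟩
  have hX0 : 0 < X := by rw [hX]; positivity
  have hXeq : X = 2 * Real.exp 2 * (p * C) ^ 2 * (b / q + β) := by rw [hX, hγ]; ring
  rw [← hXeq]
  have main : ∀ T' ⊆ T,
      MemLp (fun ω => ∑ k ∈ T', ∑ l ∈ T', if k = l then 0 else B k l * a k ω * a l ω) p μ ∧
      ∫ ω, (∑ k ∈ T', ∑ l ∈ T', if k = l then 0 else B k l * a k ω * a l ω) ^ p ∂μ ≤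
        Real.exp (2 * (T'.card / n)) * X ^ p := by
    intro T'
    induction T' using Finset.induction_on with
    | empty =>
      intro _
      refine ⟨by simp, ?_⟩
      simp [hp0]
      positivity
    | insert i T' hi ih =>
      intro hsub
      have hsub' : T' ⊆ T := (Finset.subset_insert i T').trans hsub
      obtain ⟨ih1, ih2⟩ := ih hsub'
      have hmeasS : Measurable fun ω =>
          ∑ k ∈ T', ∑ l ∈ T', if k = l then 0 else B k l * a k ω * a l ω := by
        refine Finset.measurable_sum _ fun k _ => Finset.measurable_sum _ fun l _ => ?_
        split_ifs
        · exact measurable_const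
        · exact ((hmeas k).const_mul _).mul (hmeas l)
      have hmeasc : Measurable fun ω => γ⁻¹ * ∑ k ∈ T', (B i k + B k i) * a k ω :=
        (Finset.measurable_sum _ fun k _ => (hmeas k).const_mul _).const_mul _
      have hlin := moment_linear_form hind hmeas hzero hp hpe hLp hC hn hq0 hmom
        (fun k => B i k + B k i) (b := 2 * b) (σ := 2 * β) (by positivity)
        (fun k => (abs_add_le _ _).trans (by linarith [hb i k, hb k i])) (by positivity) T' (by
          have h1 : ∀ k ∈ T', (B i k + B k i) ^ 2 ≤ 2 * B i k ^ 2 + 2 * B k i ^ 2 := fun k _ => by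
            nlinarith [sq_nonneg (B i k - B k i)]
          refine (Finset.sum_le_sum h1).trans ?_
          rw [Finset.sum_add_distrib, ← Finset.mul_sum, ← Finset.mul_sum]
          have h2 : ∑ k ∈ T', B i k ^ 2 ≤ ∑ k ∈ T, B i k ^ 2 :=
            Finset.sum_le_sum_of_subset_of_nonneg hsub' fun k _ _ => sq_nonneg _
          have h3 : ∑ k ∈ T', B k i ^ 2 ≤ ∑ k ∈ T, B k i ^ 2 :=
            Finset.sum_le_sum_of_subset_of_nonneg hsub' fun k _ _ => sq_nonneg _
          have h4 := hrow i
          have h5 := hcol i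
          nlinarith)
      have hindS : IndepFun (fun ω =>
          (∑ k ∈ T', ∑ l ∈ T', (if k = l then 0 else B k l * a k ω * a l ω),
            γ⁻¹ * ∑ k ∈ T', (B i k + B k i) * a k ω)) (a i) μ := by
        have hφ : Measurable fun y : T' → ℝ =>
            (∑ k : T', ∑ l : T', (if (k : ι) = l then 0 else B k l * y k * y l),
              γ⁻¹ * ∑ k : T', (B i k + B k i) * y k) := by
          refine Measurable.prodMk ?_ (by fun_prop)
          refine Finset.measurable_sum _ fun k _ => Finset.measurable_sum _ fun l _ => ?_
          split_ifs <;> fun_prop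
        have h2 := hind.indepFun_comp_of_notMem hmeas hi hφ
        convert h2 using 1
        funext ω
        rw [Finset.sum_coe_sort T' (fun k => (B i k + B k i) * a k ω),
          Finset.sum_coe_sort T' (fun k => ∑ l : T', if k = (l : ι) then 0 else
            B k l * a k ω * a l ω)]
        congr 1
        refine Finset.sum_congr rfl fun k _ => ?_
        rw [Finset.sum_coe_sort T' (fun l => if k = l then 0 else B k l * a k ω * a l ω)]
      have hc1 : ∫ ω, (γ⁻¹ * ∑ k ∈ T', (B i k + B k i) * a k ω) ^ p ∂μ ≤ 1 := by
        simp only [mul_pow]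
        rw [integral_const_mul, inv_pow, inv_mul_le_iff₀ (by positivity), mul_one]
        refine hlin.2.trans ?_
        rw [hγ, mul_pow (Real.exp 2)]
        gcongr
        exact le_self_pow₀ (Real.one_le_exp (by norm_num)) hp0
      have hstep := moment_step (g := γ) (w := 1 / n)
        (M := Real.exp (2 * (T'.card / n)) * X ^ p)
        hmeasS hmeasc (hmeas i) hp hpe ih1 (hlin.1.const_mul _) (hLp i) hindS (hzero i) hX0
        (le_mul_of_one_le_left (by positivity) (Real.one_le_exp (by positivity)))
        ih2 hc1 (by positivity) (by
          intro j hj2 hjp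
          rw [abs_of_pos hγ0]
          calc (p * γ) ^ j * ∫ ω, |a i ω| ^ j ∂μ
              ≤ (p * γ) ^ j * (C ^ j / (n * q ^ (j - 2))) := by
                gcongr
                exact hmom i j hj2 hjp
            _ ≤ (p * γ) ^ j * (C ^ j / (n * 1)) := by
                gcongr
                exact one_le_pow₀ hq
            _ = 1 / n * X ^ j := by rw [hX]; ring)
      have hfun : ∀ ω, (∑ k ∈ insert i T', ∑ l ∈ insert i T',
            if k = l then 0 else B k l * a k ω * a l ω) =
          (∑ k ∈ T', ∑ l ∈ T', if k = l then 0 else B k l * a k ω * a l ω) +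
            γ * (γ⁻¹ * ∑ k ∈ T', (B i k + B k i) * a k ω) * a i ω := by
        intro ω
        rw [Finset.sum_insert hi, Finset.sum_insert hi, if_pos rfl, zero_add,
          mul_inv_cancel_left₀ hγ0.ne', Finset.sum_mul]
        have h1 : ∀ k ∈ T', (∑ l ∈ insert i T', if k = l then 0 else B k l * a k ω * a l ω) =
            B k i * a k ω * a i ω + ∑ l ∈ T', if k = l then 0 else B k l * a k ω * a l ω := by
          intro k hk
          rw [Finset.sum_insert hi, if_neg (ne_of_mem_of_not_mem hk hi)]
        have h2 : ∀ l ∈ T', (if i = l then 0 else B i l * a i ω * a l ω) =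
            B i l * a i ω * a l ω := fun l hl => if_neg (ne_of_mem_of_not_mem hl hi).symm
        rw [Finset.sum_congr rfl h1, Finset.sum_congr rfl h2, Finset.sum_add_distrib,
          ← add_assoc, ← Finset.sum_add_distrib, add_comm]
        congr 1
        refine Finset.sum_congr rfl fun k _ => ?_
        ring
      simp only [hfun]
      refine ⟨hstep.1, hstep.2.trans ?_⟩
      rw [Finset.card_insert_of_notMem hi, ← mul_assoc]
      gcongr
      push_cast
      rw [show 2 * (((T'.card : ℝ) + 1) / n) = 2 * (1 / n) + 2 * (T'.card / n) by ring,
        Real.exp_add]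
      gcongr
      have := Real.add_one_le_exp (2 * (1 / n))
      linarith
  refine ⟨(main T subset_rfl).1, (main T subset_rfl).2.trans ?_⟩
  gcongr
  have : (T.card : ℝ) / n ≤ 1 := (div_le_one hn).2 hT
  linarith

end Moments

/-! ### From moments to tail bounds. -/

section Tails

open scoped ENNReal

variable {Ω : Type*} [MeasurableSpace Ω] {μ : Measure Ω} [IsProbabilityMeasure μ]

theorem measure_lt_abs_le_of_moment {f : Ω → ℝ} (hf : Measurable f) {p : ℕ} (hp : p ≠ 0)
    (hpe : Even p) (hLp : MemLp f p μ) {X Y M : ℝ} (hX : 0 < X)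
    (hM : ∫ ω, f ω ^ p ∂μ ≤ M) (hY : M / X ^ p ≤ Y) :
    μ {ω | X < |f ω|} ≤ ENNReal.ofReal Y := by
  have hint := hLp.integrable_pow_of_le hf le_rfl
  have h1 := mul_meas_ge_le_integral_of_nonneg (μ := μ) (f := fun ω => f ω ^ p)
    (Filter.Eventually.of_forall fun ω => hpe.pow_nonneg _) hint (X ^ p)
  have h2 : {ω | X < |f ω|} ⊆ {ω | X ^ p ≤ f ω ^ p} := by
    intro ω hω
    simp only [Set.mem_ofPred_eq] at hω ⊢
    rw [← hpe.pow_abs (f ω)]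
    gcongr
  refine (measure_mono h2).trans ?_
  rw [← ofReal_measureReal]
  refine ENNReal.ofReal_le_ofReal (le_trans ?_ hY)
  rw [le_div_iff₀ (by positivity), mul_comm]
  exact h1.trans hM

/-- Markov's inequality for the p-th power: the extra factor e in the level gains e^(-p), so the
order of the moment is the exponent of the probability. -/
theorem measure_exp_mul_lt_abs_le {f : Ω → ℝ} (hf : Measurable f) {p : ℕ} (hp : p ≠ 0)
    (hpe : Even p) (hLp : MemLp f p μ) {X : ℝ} (hX : 0 < X)
    (hM : ∫ ω, f ω ^ p ∂μ ≤ Real.exp 2 * X ^ p) :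
    μ {ω | Real.exp 1 * X < |f ω|} ≤ ENNReal.ofReal (Real.exp (2 - p)) := by
  refine measure_lt_abs_le_of_moment hf hp hpe hLp (by positivity) hM (le_of_eq ?_)
  rw [mul_pow, ← Real.exp_nat_mul, mul_one, Real.exp_sub]
  field_simp

theorem measure_lt_norm_le_of_re_im {F : Ω → ℂ} {X ε : ℝ} (hε : 0 ≤ ε)
    (hre : μ {ω | X < |(F ω).re|} ≤ ENNReal.ofReal ε)
    (him : μ {ω | X < |(F ω).im|} ≤ ENNReal.ofReal ε) :
    μ {ω | 2 * X < ‖F ω‖} ≤ ENNReal.ofReal (2 * ε) := by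
  have hsub : {ω | 2 * X < ‖F ω‖} ⊆ {ω | X < |(F ω).re|} ∪ {ω | X < |(F ω).im|} := by
    intro ω hω
    simp only [Set.mem_ofPred_eq, Set.mem_union] at hω ⊢
    by_contra hcon
    push Not at hcon
    have := Complex.norm_le_abs_re_add_abs_im (F ω)
    linarith
  refine (measure_mono hsub).trans ((measure_union_le _ _).trans ?_)
  rw [two_mul, ENNReal.ofReal_add hε hε]
  exact add_le_add hre him

variable {ι : Type*} [Fintype ι] [DecidableEq ι] {a : ι → Ω → ℝ}

/-- Large deviation bound for linear forms with complex coefficients. -/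
theorem measure_linear_form_le (hind : iIndepFun a μ) (hmeas : ∀ i, Measurable (a i))
    (hzero : ∀ i, ∫ ω, a i ω ∂μ = 0) {p : ℕ} (hp : 2 ≤ p) (hpe : Even p)
    (hLp : ∀ i, MemLp (a i) p μ) {C n q : ℝ} (hC : 0 < C) (hn : 0 < n) (hq : 0 < q)
    (hmom : ∀ i j, 2 ≤ j → j ≤ p → ∫ ω, |a i ω| ^ j ∂μ ≤ C ^ j / (n * q ^ (j - 2)))
    (A : ι → ℂ) {b σ : ℝ} (hσ : 0 ≤ σ) (hb : ∀ i, ‖A i‖ ≤ b) (hb0 : 0 ≤ b)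
    (hA : ∑ i, ‖A i‖ ^ 2 ≤ n * σ ^ 2) :
    μ {ω | 2 * (Real.exp 1 * (p * C * (b / q + σ))) < ‖∑ i, (a i ω : ℂ) * A i‖} ≤
      ENNReal.ofReal (2 * Real.exp (2 - p)) := by
  -- The moment bound needs σ > 0; for σ = 0 all coefficients vanish and the event is empty.
  rcases eq_or_lt_of_le hσ with hσ0 | hσ0
  · have hA0 : ∀ i, A i = 0 := by
      intro i
      rw [← hσ0] at hA
      have h1 : ‖A i‖ ^ 2 ≤ ∑ i, ‖A i‖ ^ 2 :=
        Finset.single_le_sum (f := fun i => ‖A i‖ ^ 2) (fun _ _ => by positivity)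
          (Finset.mem_univ i)
      have h2 : ‖A i‖ ^ 2 ≤ 0 := h1.trans (hA.trans (by simp))
      simpa using le_antisymm h2 (by positivity)
    have : {ω | 2 * (Real.exp 1 * (p * C * (b / q + σ))) < ‖∑ i, (a i ω : ℂ) * A i‖} = ∅ := by
      ext ω
      simp only [hA0, mul_zero, Finset.sum_const_zero, norm_zero, Set.mem_ofPred_eq,
        Set.mem_empty_iff_false, iff_false, not_lt]
      positivity
    rw [this]
    simp
  have hp0 : p ≠ 0 := by omega
  have hX : 0 < p * C * (b / q + σ) := by positivity
  have key : ∀ A' : ι → ℝ, (∀ i, |A' i| ≤ ‖A i‖) →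
      μ {ω | Real.exp 1 * (p * C * (b / q + σ)) < |∑ i, A' i * a i ω|} ≤
        ENNReal.ofReal (Real.exp (2 - p)) := by
    intro A' hA'
    have h := moment_linear_form hind hmeas hzero hp hpe hLp hC hn hq hmom A' hσ0
      (fun i => (hA' i).trans (hb i)) hb0 Finset.univ
      ((Finset.sum_le_sum fun i _ => by
        rw [← sq_abs]
        gcongr
        exact hA' i).trans hA)
    exact measure_exp_mul_lt_abs_le (Finset.measurable_sum _ fun i _ => (hmeas i).const_mul _)
      hp0 hpe h.1 hX h.2
  refine measure_lt_norm_le_of_re_im (by positivity) ?_ ?_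
  · have h := key (fun i => (A i).re) fun i => Complex.abs_re_le_norm _
    simpa [Complex.re_sum, mul_comm] using h
  · have h := key (fun i => (A i).im) fun i => Complex.abs_im_le_norm _
    simpa [Complex.im_sum, mul_comm] using h

/-- Large deviation bound for off-diagonal quadratic forms with complex coefficients. -/
theorem measure_quadratic_form_le (hind : iIndepFun a μ) (hmeas : ∀ i, Measurable (a i))
    (hzero : ∀ i, ∫ ω, a i ω ∂μ = 0) {p : ℕ} (hp : 2 ≤ p) (hpe : Even p)
    (hLp : ∀ i, MemLp (a i) p μ) {C n q : ℝ} (hC : 0 < C) (hn : 0 < n) (hq : 1 ≤ q)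
    (hmom : ∀ i j, 2 ≤ j → j ≤ p → ∫ ω, |a i ω| ^ j ∂μ ≤ C ^ j / (n * q ^ (j - 2)))
    (hcard : (Fintype.card ι : ℝ) ≤ n)
    (B : ι → ι → ℂ) {b β : ℝ} (hβ : 0 ≤ β) (hb : ∀ i k, ‖B i k‖ ≤ b) (hb0 : 0 ≤ b)
    (hdiag : ∀ i, B i i = 0)
    (hrow : ∀ i, ∑ k, ‖B i k‖ ^ 2 ≤ n * β ^ 2) (hcol : ∀ i, ∑ k, ‖B k i‖ ^ 2 ≤ n * β ^ 2) :
    μ {ω | 2 * (Real.exp 1 * (2 * Real.exp 2 * (p * C) ^ 2 * (b / q + β))) <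
        ‖∑ k, ∑ l, (a k ω : ℂ) * B k l * (a l ω : ℂ)‖} ≤
      ENNReal.ofReal (2 * Real.exp (2 - p)) := by
  rcases eq_or_lt_of_le hβ with hβ0 | hβ0
  · have hB0 : ∀ i k, B i k = 0 := by
      intro i k
      have hrow := hrow i
      rw [← hβ0] at hrow
      have h1 : ‖B i k‖ ^ 2 ≤ ∑ k, ‖B i k‖ ^ 2 :=
        Finset.single_le_sum (f := fun k => ‖B i k‖ ^ 2) (fun _ _ => by positivity)
          (Finset.mem_univ k)
      have h2 : ‖B i k‖ ^ 2 ≤ 0 := h1.trans (hrow.trans (by simp))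
      simpa using le_antisymm h2 (by positivity)
    have : {ω | 2 * (Real.exp 1 * (2 * Real.exp 2 * (p * C) ^ 2 * (b / q + β))) <
        ‖∑ k, ∑ l, (a k ω : ℂ) * B k l * (a l ω : ℂ)‖} = ∅ := by
      ext ω
      simp only [hB0, mul_zero, zero_mul, Finset.sum_const_zero, norm_zero, Set.mem_ofPred_eq,
        Set.mem_empty_iff_false, iff_false, not_lt]
      positivity
    rw [this]
    simp
  have hp0 : p ≠ 0 := by omega
  have hX : 0 < 2 * Real.exp 2 * (p * C) ^ 2 * (b / q + β) := by positivity
  have key : ∀ B' : ι → ι → ℝ, (∀ i k, |B' i k| ≤ ‖B i k‖) →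
      μ {ω | Real.exp 1 * (2 * Real.exp 2 * (p * C) ^ 2 * (b / q + β)) <
        |∑ k, ∑ l, B' k l * a k ω * a l ω|} ≤ ENNReal.ofReal (Real.exp (2 - p)) := by
    intro B' hB'
    have hB'0 : ∀ i, B' i i = 0 := fun i => by simpa [hdiag] using hB' i i
    have h := moment_quadratic_form hind hmeas hzero hp hpe hLp hC hn hq hmom B' hβ0
      (fun i k => (hB' i k).trans (hb i k)) hb0 Finset.univ (by simpa using hcard)
      (fun i => (Finset.sum_le_sum fun k _ => by
        rw [← sq_abs]
        gcongr
        exact hB' i k).trans (hrow i))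
      (fun i => (Finset.sum_le_sum fun k _ => by
        rw [← sq_abs]
        gcongr
        exact hB' k i).trans (hcol i))
    have hfun : ∀ ω, (∑ k, ∑ l, if k = l then 0 else B' k l * a k ω * a l ω) =
        ∑ k, ∑ l, B' k l * a k ω * a l ω := by
      intro ω
      refine Finset.sum_congr rfl fun k _ => Finset.sum_congr rfl fun l _ => ?_
      split_ifs with hkl
      · rw [← hkl, hB'0]; ring
      · rfl
    simp only [hfun] at h
    exact measure_exp_mul_lt_abs_le (Finset.measurable_sum _ fun k _ =>
      Finset.measurable_sum _ fun l _ => ((hmeas k).const_mul _).mul (hmeas l)) hp0 hpe h.1 hX h.2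
  refine measure_lt_norm_le_of_re_im (by positivity) ?_ ?_
  · have h := key (fun i k => (B i k).re) fun i k => Complex.abs_re_le_norm _
    refine (le_of_eq ?_).trans h
    congr 1
    ext ω
    rw [Set.mem_ofPred_eq, Set.mem_ofPred_eq, Complex.re_sum]
    simp only [Complex.re_sum, Complex.re_mul_ofReal, Complex.re_ofReal_mul]
    simp only [mul_comm (B _ _).re]
  · have h := key (fun i k => (B i k).im) fun i k => Complex.abs_im_le_norm _
    refine (le_of_eq ?_).trans h
    congr 1
    ext ω
    rw [Set.mem_ofPred_eq, Set.mem_ofPred_eq, Complex.im_sum]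
    simp only [Complex.im_sum, Complex.im_mul_ofReal, Complex.im_ofReal_mul]
    simp only [mul_comm (B _ _).im]

/-- Moments of the centred and rescaled square of a random variable. -/
theorem moment_centred_square {h : Ω → ℝ} (hmeas : Measurable h) {p : ℕ} (hp : 2 ≤ p)
    (hLp : MemLp h (2 * p : ℕ) μ) {C D n q : ℝ} (hC : 0 < C) (hD : 1 ≤ D) (hn : 0 < n)
    (hq : 0 < q) (hqn : q ^ 2 ≤ D * n) (hvar : ∫ ω, h ω ^ 2 ∂μ = 1 / n)
    (hmom : ∀ j, 2 ≤ j → j ≤ 2 * p → ∫ ω, |h ω| ^ j ∂μ ≤ C ^ j / (n * q ^ (j - 2))) :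
    ∫ ω, q * (h ω ^ 2 - 1 / n) ∂μ = 0 ∧ MemLp (fun ω => q * (h ω ^ 2 - 1 / n)) p μ ∧
      ∀ j, 2 ≤ j → j ≤ p → ∫ ω, |q * (h ω ^ 2 - 1 / n)| ^ j ∂μ ≤
        (2 * C ^ 2 + 2 * D) ^ j / (n * q ^ (j - 2)) := by
  have hint : ∀ j ≤ p, Integrable (fun ω => (h ω ^ 2) ^ j) μ := by
    intro j hj
    simp only [← pow_mul]
    exact hLp.integrable_pow_of_le hmeas (by omega)
  have hbound : ∀ (j : ℕ) (ω : Ω), |q * (h ω ^ 2 - 1 / n)| ^ j ≤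
      (2 * q) ^ j * ((h ω ^ 2) ^ j + (1 / n) ^ j) := by
    intro j ω
    rw [abs_mul, abs_of_pos hq, mul_pow, mul_pow]
    have h1 : |h ω ^ 2 - 1 / n| ≤ h ω ^ 2 + 1 / n := by
      refine (abs_sub _ _).trans (le_of_eq ?_)
      rw [abs_of_nonneg (sq_nonneg _), abs_of_pos (by positivity)]
    have h2 : |h ω ^ 2 - 1 / n| ^ j ≤ 2 ^ j * ((h ω ^ 2) ^ j + (1 / n) ^ j) := by
      calc |h ω ^ 2 - 1 / n| ^ j ≤ (h ω ^ 2 + 1 / n) ^ j := by gcongr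
        _ ≤ 2 ^ (j - 1) * ((h ω ^ 2) ^ j + (1 / n) ^ j) :=
            add_pow_le (sq_nonneg _) (by positivity) j
        _ ≤ 2 ^ j * ((h ω ^ 2) ^ j + (1 / n) ^ j) := by
            gcongr
            · norm_num
            · omega
    calc q ^ j * |h ω ^ 2 - 1 / n| ^ j ≤ q ^ j * (2 ^ j * ((h ω ^ 2) ^ j + (1 / n) ^ j)) := by
          gcongr
      _ = _ := by ring
  have hmeasb : Measurable fun ω => q * (h ω ^ 2 - 1 / n) := by fun_prop
  have hintb : ∀ j ≤ p, Integrable (fun ω => |q * (h ω ^ 2 - 1 / n)| ^ j) μ := by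
    intro j hj
    refine (((hint j hj).add (integrable_const ((1 / n) ^ j))).const_mul ((2 * q) ^ j)).mono
      (by fun_prop) (Filter.Eventually.of_forall fun ω => ?_)
    rw [Real.norm_eq_abs, abs_of_nonneg (by positivity)]
    exact (hbound j ω).trans (le_abs_self _)
  refine ⟨?_, (memLp_iff_integrable_abs_pow hmeasb (by omega)).2 (hintb p le_rfl), ?_⟩
  · have h2 : Integrable (fun ω => h ω ^ 2) μ := by simpa using hint 1 (by omega)
    rw [integral_const_mul, integral_sub h2 (integrable_const _), hvar]
    simp
  · intro j hj2 hjp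
    have h1 : ∫ ω, |q * (h ω ^ 2 - 1 / n)| ^ j ∂μ ≤
        (2 * q) ^ j * (∫ ω, (h ω ^ 2) ^ j ∂μ + (1 / n) ^ j) := by
      refine (integral_mono (hintb j hjp)
        (((hint j hjp).add (integrable_const ((1 / n) ^ j))).const_mul ((2 * q) ^ j))
        (hbound j)).trans (le_of_eq ?_)
      rw [integral_const_mul]
      congr 1
      have := integral_add (hint j hjp) (integrable_const (μ := μ) ((1 / n) ^ j))
      simpa using this
    have h2 : ∫ ω, (h ω ^ 2) ^ j ∂μ ≤ C ^ (2 * j) / (n * q ^ (2 * j - 2)) := by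
      have := hmom (2 * j) (by omega) (by omega)
      refine le_trans (le_of_eq ?_) this
      refine integral_congr_ae (Filter.Eventually.of_forall fun ω => ?_)
      simp only [pow_mul, sq_abs]
    have hqj : q ^ j * q ^ (j - 2) = (q ^ 2) ^ (j - 1) := by
      rw [← pow_add, ← pow_mul]
      congr 1
      omega
    have hqj2 : q ^ (2 * j - 2) = (q ^ 2) ^ (j - 1) := by
      rw [← pow_mul]
      congr 1
      omega
    -- The subtracted mean 1/n fits the same moment pattern only because q² ≤ Dn.
    have h3 : q ^ j * (1 / n) ^ j ≤ D ^ j / (n * q ^ (j - 2)) := by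
      rw [le_div_iff₀ (by positivity)]
      calc q ^ j * (1 / n) ^ j * (n * q ^ (j - 2))
          = (q ^ j * q ^ (j - 2)) * ((1 / n) ^ j * n) := by ring
        _ = (q ^ 2) ^ (j - 1) * (1 / n) ^ (j - 1) := by
            rw [hqj]
            congr 1
            obtain ⟨m, rfl⟩ : ∃ m, j = m + 1 := ⟨j - 1, by omega⟩
            rw [Nat.add_sub_cancel, pow_succ]
            field_simp
        _ ≤ (D * n) ^ (j - 1) * (1 / n) ^ (j - 1) := by gcongr
        _ = D ^ (j - 1) := by
            rw [← mul_pow]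
            congr 1
            field_simp
        _ ≤ D ^ j := pow_le_pow_right₀ hD (by omega)
    have h4 : q ^ j * (C ^ (2 * j) / (n * q ^ (2 * j - 2))) = (C ^ 2) ^ j / (n * q ^ (j - 2)) := by
      rw [hqj2, ← hqj, pow_mul]
      field_simp
    calc _ ≤ (2 * q) ^ j * (∫ ω, (h ω ^ 2) ^ j ∂μ + (1 / n) ^ j) := h1
      _ ≤ (2 * q) ^ j * (C ^ (2 * j) / (n * q ^ (2 * j - 2)) + (1 / n) ^ j) := by gcongr
      _ = 2 ^ j * (q ^ j * (C ^ (2 * j) / (n * q ^ (2 * j - 2))) + q ^ j * (1 / n) ^ j) := by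
          rw [mul_pow]; ring
      _ ≤ 2 ^ j * ((C ^ 2) ^ j / (n * q ^ (j - 2)) + D ^ j / (n * q ^ (j - 2))) := by
          rw [h4]; gcongr
      _ = ((2 * C ^ 2) ^ j + (2 * D) ^ j) / (n * q ^ (j - 2)) := by
          rw [mul_pow, mul_pow]; ring
      _ ≤ _ := by
          gcongr
          exact pow_add_pow_le (by positivity) (by positivity) (by omega)

/-- A bound that holds conditionally on an independent variable holds unconditionally. -/
theorem measure_le_of_indepFun {α β : Type*} [MeasurableSpace α] [MeasurableSpace β]
    {X : Ω → α} {Y : Ω → β} (hX : Measurable X) (hY : Measurable Y) (hXY : IndepFun X Y μ)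
    {D : Set (α × β)} (hD : MeasurableSet D) {ε : ℝ≥0∞}
    (h : ∀ y, μ {ω | (X ω, y) ∈ D} ≤ ε) : μ {ω | (X ω, Y ω) ∈ D} ≤ ε := by
  have h1 := (indepFun_iff_map_prod_eq_prod_map_map hX.aemeasurable hY.aemeasurable).1 hXY
  have : IsProbabilityMeasure (μ.map X) := Measure.isProbabilityMeasure_map hX.aemeasurable
  have : IsProbabilityMeasure (μ.map Y) := Measure.isProbabilityMeasure_map hY.aemeasurable
  calc μ {ω | (X ω, Y ω) ∈ D} = μ.map (fun ω => (X ω, Y ω)) D :=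
        (Measure.map_apply (hX.prodMk hY) hD).symm
    _ = ((μ.map X).prod (μ.map Y)) D := by rw [h1]
    _ = ∫⁻ y, μ.map X ((fun x => (x, y)) ⁻¹' D) ∂(μ.map Y) := Measure.prod_apply_symm hD
    _ ≤ ∫⁻ _, ε ∂(μ.map Y) := by
        refine lintegral_mono fun y => ?_
        rw [Measure.map_apply hX (measurable_prodMk_right hD)]
        exact h y
    _ = ε := by simp

end Tails

/-! ### Random coefficients independent of the variables. -/

section RandomCoefficients

variable {Ω : Type*} [MeasurableSpace Ω] {μ : Measure Ω} [IsProbabilityMeasure μ]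

variable {ι : Type*} [Fintype ι] [DecidableEq ι] {a : ι → Ω → ℝ}

/-- Large deviation bound for linear forms whose coefficients are random and independent of the
variables. -/
theorem measure_random_linear_form_le (hind : iIndepFun a μ) (hmeas : ∀ i, Measurable (a i))
    (hzero : ∀ i, ∫ ω, a i ω ∂μ = 0) {p : ℕ} (hp : 2 ≤ p) (hpe : Even p)
    (hLp : ∀ i, MemLp (a i) p μ) {C n q : ℝ} (hC : 0 < C) (hn : 0 < n) (hq : 0 < q)
    (hmom : ∀ i j, 2 ≤ j → j ≤ p → ∫ ω, |a i ω| ^ j ∂μ ≤ C ^ j / (n * q ^ (j - 2)))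
    {W : Ω → ι → ℂ} (hW : Measurable W) (haW : IndepFun (fun ω i => a i ω) W μ) :
    μ {ω | ∃ b σ : ℝ, 0 ≤ b ∧ 0 ≤ σ ∧ (∀ i, ‖W ω i‖ ≤ b) ∧ ∑ i, ‖W ω i‖ ^ 2 ≤ n * σ ^ 2 ∧
      2 * (Real.exp 1 * (p * C * (b / q + σ))) < ‖∑ i, (a i ω : ℂ) * W ω i‖} ≤
      ENNReal.ofReal (2 * Real.exp (2 - p)) := by
  -- The thresholds b and σ, quantified inside the event, are replaced by their least admissible
  -- values, the sup norm and the normalised ℓ²-norm of the coefficients. This gives a single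
  -- measurable set to which conditioning applies.
  let D : Set ((ι → ℝ) × (ι → ℂ)) := {x |
    2 * (Real.exp 1 * (p * C * (‖x.2‖ / q + √((∑ i, ‖x.2 i‖ ^ 2) / n)))) <
      ‖∑ i, (x.1 i : ℂ) * x.2 i‖}
  have hD : MeasurableSet D := measurableSet_lt (by fun_prop) (by fun_prop)
  have hX : Measurable fun ω i => a i ω := measurable_pi_lambda _ hmeas
  refine le_trans (measure_mono ?_) (measure_le_of_indepFun hX hW haW hD fun y => ?_)
  · rintro ω ⟨b, σ, hb, hσ, hWb, hWσ, hlt⟩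
    refine lt_of_le_of_lt ?_ hlt
    have h1 : ‖W ω‖ ≤ b := (pi_norm_le_iff_of_nonneg hb).2 hWb
    have h2 : √((∑ i, ‖W ω i‖ ^ 2) / n) ≤ σ := by
      refine Real.sqrt_le_iff.2 ⟨hσ, ?_⟩
      rw [div_le_iff₀ hn]
      linarith
    dsimp only
    gcongr
  · exact measure_linear_form_le hind hmeas hzero hp hpe hLp hC hn hq hmom y
      (σ := √((∑ i, ‖y i‖ ^ 2) / n)) (Real.sqrt_nonneg _) (norm_le_pi_norm y) (norm_nonneg y)
      (le_of_eq (by rw [Real.sq_sqrt (by positivity)]; field_simp))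

/-- Large deviation bound for off-diagonal quadratic forms whose coefficients are random and
independent of the variables. -/
theorem measure_random_quadratic_form_le (hind : iIndepFun a μ) (hmeas : ∀ i, Measurable (a i))
    (hzero : ∀ i, ∫ ω, a i ω ∂μ = 0) {p : ℕ} (hp : 2 ≤ p) (hpe : Even p)
    (hLp : ∀ i, MemLp (a i) p μ) {C n q : ℝ} (hC : 0 < C) (hn : 0 < n) (hq : 1 ≤ q)
    (hmom : ∀ i j, 2 ≤ j → j ≤ p → ∫ ω, |a i ω| ^ j ∂μ ≤ C ^ j / (n * q ^ (j - 2)))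
    (hcard : (Fintype.card ι : ℝ) ≤ n)
    {W : Ω → ι → ι → ℂ} (hW : Measurable W) (haW : IndepFun (fun ω i => a i ω) W μ) :
    μ {ω | ∃ b β : ℝ, 0 ≤ b ∧ 0 ≤ β ∧ (∀ i k, ‖W ω i k‖ ≤ b) ∧ (∀ i, W ω i i = 0) ∧
      (∀ i, ∑ k, ‖W ω i k‖ ^ 2 ≤ n * β ^ 2) ∧ (∀ i, ∑ k, ‖W ω k i‖ ^ 2 ≤ n * β ^ 2) ∧
      2 * (Real.exp 1 * (2 * Real.exp 2 * (p * C) ^ 2 * (b / q + β))) <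
        ‖∑ k, ∑ l, (a k ω : ℂ) * W ω k l * (a l ω : ℂ)‖} ≤
      ENNReal.ofReal (2 * Real.exp (2 - p)) := by
  have hq0 : 0 < q := by linarith
  let row : (ι → ι → ℂ) → ι → ℝ := fun w i => √((∑ k, ‖w i k‖ ^ 2) / n)
  let col : (ι → ι → ℂ) → ι → ℝ := fun w i => √((∑ k, ‖w k i‖ ^ 2) / n)
  let D : Set ((ι → ℝ) × (ι → ι → ℂ)) := {x | (∀ i, x.2 i i = 0) ∧
    2 * (Real.exp 1 * (2 * Real.exp 2 * (p * C) ^ 2 * (‖x.2‖ / q + max ‖row x.2‖ ‖col x.2‖))) <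
      ‖∑ k, ∑ l, (x.1 k : ℂ) * x.2 k l * (x.1 l : ℂ)‖}
  have hrow : Measurable row := measurable_pi_lambda _ fun i => by fun_prop
  have hcol : Measurable col := measurable_pi_lambda _ fun i => by fun_prop
  have hD0 : MeasurableSet {x : (ι → ℝ) × (ι → ι → ℂ) | ∀ i, x.2 i i = 0} := by
    have : {x : (ι → ℝ) × (ι → ι → ℂ) | ∀ i, x.2 i i = 0} = ⋂ i, {x | x.2 i i = 0} := by
      ext; simp
    rw [this]
    exact MeasurableSet.iInter fun i => measurableSet_eq_fun (by fun_prop) measurable_const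
  have hD1 : MeasurableSet {x : (ι → ℝ) × (ι → ι → ℂ) |
      2 * (Real.exp 1 * (2 * Real.exp 2 * (p * C) ^ 2 * (‖x.2‖ / q + max ‖row x.2‖ ‖col x.2‖))) <
        ‖∑ k, ∑ l, (x.1 k : ℂ) * x.2 k l * (x.1 l : ℂ)‖} :=
    measurableSet_lt (by fun_prop) (by fun_prop)
  have hD : MeasurableSet D := hD0.inter hD1
  have hX : Measurable fun ω i => a i ω := measurable_pi_lambda _ hmeas
  refine le_trans (measure_mono ?_) (measure_le_of_indepFun hX hW haW hD fun y => ?_)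
  · rintro ω ⟨b, β, hb, hβ, hWb, hdiag, hWr, hWc, hlt⟩
    refine ⟨hdiag, lt_of_le_of_lt ?_ hlt⟩
    have h1 : ‖W ω‖ ≤ b := (pi_norm_le_iff_of_nonneg hb).2 fun i =>
      (pi_norm_le_iff_of_nonneg hb).2 (hWb i)
    have h2 : max ‖row (W ω)‖ ‖col (W ω)‖ ≤ β := by
      refine max_le ((pi_norm_le_iff_of_nonneg hβ).2 fun i => ?_)
        ((pi_norm_le_iff_of_nonneg hβ).2 fun i => ?_) <;>
      · rw [Real.norm_eq_abs, abs_of_nonneg (Real.sqrt_nonneg _)]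
        refine Real.sqrt_le_iff.2 ⟨hβ, ?_⟩
        rw [div_le_iff₀ hn]
        linarith [hWr i, hWc i]
    dsimp only
    gcongr
  · by_cases hy : ∀ i, y i i = 0
    · have hle : ∀ (v : ι → ℝ) (s : ι → ℝ) (β : ℝ), (∀ i, 0 ≤ s i) →
          (∀ i, v i = √(s i / n)) → ‖v‖ ≤ β → ∀ i, s i ≤ n * β ^ 2 := by
        intro v s β hs hv hvβ i
        have h1 : √(s i / n) ≤ β := by
          rw [← hv]
          exact (le_abs_self _).trans ((norm_le_pi_norm v i).trans hvβ)
        have h2 := (Real.sqrt_le_iff.1 h1).2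
        rw [div_le_iff₀ hn] at h2
        linarith
      have h := measure_quadratic_form_le hind hmeas hzero hp hpe hLp hC hn hq hmom hcard y
        (b := ‖y‖) (β := max ‖row y‖ ‖col y‖) (le_max_of_le_left (norm_nonneg _))
        (fun i k => (norm_le_pi_norm (y i) k).trans (norm_le_pi_norm y i)) (norm_nonneg y) hy
        (hle (row y) (fun i => ∑ k, ‖y i k‖ ^ 2) _ (fun i => by positivity) (fun i => rfl)
          (le_max_left _ _))
        (hle (col y) (fun i => ∑ k, ‖y k i‖ ^ 2) _ (fun i => by positivity) (fun i => rfl)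
          (le_max_right _ _))
      exact (measure_mono fun ω hω => hω.2).trans h
    · have : {ω | ((fun i => a i ω), y) ∈ D} = ∅ := by
        ext ω
        simp only [Set.mem_empty_iff_false, iff_false]
        exact fun hω => hy hω.1
      rw [this]
      simp

end RandomCoefficients

/-! ### Measurability of minors and independence from the erased row. -/

section Minor

variable {N : ℕ}

/-- Cramer's rule: the determinant and adjugate depend continuously on the entries, and inversion of
scalars is measurable, so singular matrices need no separate treatment. -/
theorem measurable_resolventMatrix_apply (z : ℂ) (k l : Fin N) :
    Measurable fun m : Fin N → Fin N → ℝ => resolventMatrix (Matrix.of m) z k l := by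
  simp only [resolventMatrix, Matrix.inv_def, Ring.inverse_eq_inv', Matrix.smul_apply, smul_eq_mul]
  have hA : Continuous fun m : Fin N → Fin N → ℝ =>
      ((Matrix.of m).map (fun x : ℝ => (x : ℂ)) - z • (1 : Matrix (Fin N) (Fin N) ℂ)) := by
    refine continuous_matrix fun i j => ?_
    simp only [Matrix.sub_apply, Matrix.map_apply, Matrix.of_apply]
    fun_prop
  exact hA.matrix_det.measurable.inv.mul (hA.matrix_adjugate.matrix_elem k l).measurable

/-- The pair `{k, l}`, in increasing order. -/
def sortedPair (k l : Fin N) : {p : Fin N × Fin N // p.1 ≤ p.2} :=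
  if h : k ≤ l then ⟨(k, l), h⟩ else ⟨(l, k), le_of_not_ge h⟩

theorem sortedPair_injective (i : Fin N) : Function.Injective (sortedPair i) := by
  intro k l h
  unfold sortedPair at h
  split_ifs at h <;> simp only [Subtype.mk.injEq, Prod.mk.injEq] at h <;> grind

theorem sortedPair_mem (k l : Fin N) : (sortedPair k l).1 = (k, l) ∨ (sortedPair k l).1 = (l, k) := by
  unfold sortedPair
  split_ifs <;> simp

theorem apply_sortedPair {α : Type*} {M : Fin N → Fin N → α} (hM : ∀ i j, M i j = M j i)
    (k l : Fin N) : M (sortedPair k l).1.1 (sortedPair k l).1.2 = M k l := by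
  rcases sortedPair_mem k l with h | h <;> rw [h]
  exact hM l k

variable {Ω : Type*} [MeasurableSpace Ω] {μ : Measure Ω}
  {H : Ω → Matrix (Fin N) (Fin N) ℝ}

theorem iIndepFun_row (hsymm : ∀ ω i j, H ω i j = H ω j i)
    (hind : iIndepFun (fun (p : {p : Fin N × Fin N // p.1 ≤ p.2}) ω => H ω p.1.1 p.1.2) μ)
    (i : Fin N) : iIndepFun (fun k ω => H ω i k) μ := by
  have h := hind.precomp (sortedPair_injective i)
  have he : (fun k ω => H ω i k) = fun k ω => H ω (sortedPair i k).1.1 (sortedPair i k).1.2 := by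
    ext k ω
    exact (apply_sortedPair (hsymm ω) i k).symm
  rw [he]
  exact h

/-- A row of `H` is independent of the resolvent of the minor obtained by erasing that row. -/
theorem indepFun_row_resolventMatrix (hmeas : ∀ i j, Measurable fun ω => H ω i j)
    (hsymm : ∀ ω i j, H ω i j = H ω j i)
    (hind : iIndepFun (fun (p : {p : Fin N × Fin N // p.1 ≤ p.2}) ω => H ω p.1.1 p.1.2) μ)
    (i : Fin N) (z : ℂ) :
    IndepFun (fun ω k => H ω i k)
      (fun ω k l => resolventMatrix ((H ω).eraseRowCol i) z k l) μ := by
  classical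
  -- The unordered pairs that meet i carry row i; the minor depends only on the complementary pairs.
  let s : Finset {p : Fin N × Fin N // p.1 ≤ p.2} :=
    Finset.univ.filter fun p => p.1.1 = i ∨ p.1.2 = i
  have hs : ∀ k, sortedPair i k ∈ s := by
    intro k
    simp only [s, Finset.mem_filter, Finset.mem_univ, true_and]
    rcases sortedPair_mem i k with h | h <;> simp [h]
  have hsc : ∀ k l, ¬(k = i ∨ l = i) → sortedPair k l ∈ sᶜ := by
    intro k l hkl
    simp only [s, Finset.mem_compl, Finset.mem_filter, Finset.mem_univ, true_and]
    rcases sortedPair_mem k l with h | h <;> rw [h] <;> tauto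
  have h := hind.indepFun_finset s sᶜ disjoint_compl_right fun p => hmeas _ _
  let φ : (s → ℝ) → Fin N → ℝ := fun y k => y ⟨sortedPair i k, hs k⟩
  let M : (↥sᶜ → ℝ) → Fin N → Fin N → ℝ := fun y k l =>
    if hkl : k = i ∨ l = i then 0 else y ⟨sortedPair k l, hsc k l hkl⟩
  have hφ : Measurable φ := measurable_pi_lambda _ fun k => measurable_pi_apply _
  have hM : Measurable M := by
    refine measurable_pi_lambda _ fun k => measurable_pi_lambda _ fun l => ?_
    by_cases hkl : k = i ∨ l = i
    · simp only [M, hkl, dite_true]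
      exact measurable_const
    · simp only [M, hkl, dite_false]
      exact measurable_pi_apply _
  have hR : Measurable fun y k l => resolventMatrix (Matrix.of (M y)) z k l :=
    measurable_pi_lambda _ fun k => measurable_pi_lambda _ fun l =>
      (measurable_resolventMatrix_apply z k l).comp hM
  convert h.comp hφ hR using 1
  · ext ω k
    exact (apply_sortedPair (hsymm ω) i k).symm
  · ext ω k l
    simp only [Function.comp]
    congr 2
    ext k l
    by_cases hkl : k = i ∨ l = i
    · simp [M, Matrix.eraseRowCol, hkl]
    · simp only [M, Matrix.eraseRowCol, Matrix.of_apply, hkl, dite_false, if_false]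
      exact (apply_sortedPair (hsymm ω) k l).symm

theorem measurable_resolventMatrix_eraseRowCol (hmeas : ∀ i j, Measurable fun ω => H ω i j)
    (i : Fin N) (z : ℂ) :
    Measurable fun ω k l => resolventMatrix ((H ω).eraseRowCol i) z k l := by
  refine measurable_pi_lambda _ fun k => measurable_pi_lambda _ fun l => ?_
  refine (measurable_resolventMatrix_apply z k l).comp
    (measurable_pi_lambda _ fun k => measurable_pi_lambda _ fun l => ?_)
  by_cases hkl : k = i ∨ l = i
  · simp [hkl]
  · simpa [hkl] using hmeas k l

end Minor

/-! ### Probability of the row bounds at a fixed spectral parameter. -/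

section RowFormProbability

variable {Ω : Type*} [MeasurableSpace Ω] {μ : Measure Ω} [IsProbabilityMeasure μ] {N : ℕ}
  {H : Ω → Matrix (Fin N) (Fin N) ℝ}

/-- The large deviation bounds `RowFormBounds` hold with high probability at a fixed spectral
parameter. -/
theorem measure_not_rowFormBounds_le (hmeas : ∀ i j, Measurable fun ω => H ω i j)
    (hsymm : ∀ ω i j, H ω i j = H ω j i)
    (hind : iIndepFun (fun (p : {p : Fin N × Fin N // p.1 ≤ p.2}) ω => H ω p.1.1 p.1.2) μ)
    (hmean : ∀ i j, ∫ ω, H ω i j ∂μ = 0) (hvar : ∀ i j, ∫ ω, H ω i j ^ 2 ∂μ = 1 / (N : ℝ))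
    {p : ℕ} (hp : 2 ≤ p) (hpe : Even p) (hLp : ∀ i j, MemLp (fun ω => H ω i j) (2 * p : ℕ) μ)
    {C D q ℓ : ℝ} (hC : 1 ≤ C) (hD : 1 ≤ D) (hN : 0 < N) (hq : 1 ≤ q) (hqN : q ^ 2 ≤ D * N)
    (hmom : ∀ i j, ∀ r : ℕ, 2 ≤ r → r ≤ 2 * p →
      ∫ ω, |H ω i j| ^ r ∂μ ≤ C ^ r / (N * q ^ (r - 2)))
    (hpℓ : p ≤ ℓ) (z : ℂ) :
    μ {ω | ¬RowFormBounds (H ω) z (4 * Real.exp 1 * Real.exp 2 * (2 * C ^ 2 + 2 * D)) ℓ q} ≤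
      ENNReal.ofReal (N ^ 2 * (8 * D * Real.exp (2 - p))) := by
  have hn : (0 : ℝ) < N := by exact_mod_cast hN
  have hC0 : 0 < C := by linarith
  have hD0 : 0 < D := by linarith
  have hq0 : 0 < q := by linarith
  have hp0 : p ≠ 0 := by omega
  have hpr : (2 : ℝ) ≤ p := by exact_mod_cast hp
  have hℓ : 0 < ℓ := by linarith
  obtain ⟨C', hC'⟩ : ∃ C', C' = 2 * C ^ 2 + 2 * D := ⟨_, rfl⟩
  rw [← hC']
  have hC'C2 : 2 * C ^ 2 ≤ C' := by linarith
  have hC'C : 2 * C ≤ C' := by nlinarith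
  have hC'0 : 0 < C' := by linarith
  have he1 : (1 : ℝ) ≤ Real.exp 1 := Real.one_le_exp (by norm_num)
  have he2 : (1 : ℝ) ≤ Real.exp 2 := Real.one_le_exp (by norm_num)
  obtain ⟨c, hc⟩ : ∃ c, c = 4 * Real.exp 1 * Real.exp 2 * C' := ⟨_, rfl⟩
  rw [← hc]
  have hcC' : 4 * Real.exp 1 * C' ≤ c := by
    rw [hc]
    have : 0 < 4 * Real.exp 1 * C' := by positivity
    nlinarith
  have hc0 : 0 < c := lt_of_lt_of_le (by positivity) hcC'
  have hLp' : ∀ i j, MemLp (fun ω => H ω i j) p μ := fun i j =>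
    (hLp i j).mono_exponent (by exact_mod_cast (by omega : p ≤ 2 * p))
  have hmom' : ∀ i j, ∀ r : ℕ, 2 ≤ r → r ≤ p →
      ∫ ω, |H ω i j| ^ r ∂μ ≤ C ^ r / (N * q ^ (r - 2)) := fun i j r hr hrp =>
    hmom i j r hr (by omega)
  have hrowind := iIndepFun_row hsymm hind
  have hminor := fun i => indepFun_row_resolventMatrix hmeas hsymm hind i z
  have hGm := fun i => measurable_resolventMatrix_eraseRowCol hmeas i z
  obtain ⟨ε, hε⟩ : ∃ ε, ε = 2 * D * Real.exp (2 - p) := ⟨_, rfl⟩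
  have hε0 : 0 < ε := by rw [hε]; positivity
  have hε2 : 2 * Real.exp (2 - p) ≤ ε := by
    rw [hε]
    have := Real.exp_pos (2 - p)
    nlinarith
  let Aent : Fin N → Fin N → Set Ω := fun i j => {ω | Real.exp 1 * C / q < |H ω i j|}
  let Wlin : Fin N → Fin N → Ω → Fin N → ℂ := fun i j ω k =>
    if k = i ∨ k = j then 0 else resolventMatrix ((H ω).eraseRowCol i) z k j
  let Alin : Fin N → Fin N → Set Ω := fun i j => {ω | ∃ b σ : ℝ, 0 ≤ b ∧ 0 ≤ σ ∧
    (∀ k, ‖Wlin i j ω k‖ ≤ b) ∧ ∑ k, ‖Wlin i j ω k‖ ^ 2 ≤ N * σ ^ 2 ∧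
      2 * (Real.exp 1 * (p * C * (b / q + σ))) < ‖∑ k, (H ω i k : ℂ) * Wlin i j ω k‖}
  let Wdia : Fin N → Ω → Fin N → ℂ := fun i ω k =>
    if k = i then 0 else resolventMatrix ((H ω).eraseRowCol i) z k k
  let Adia : Fin N → Set Ω := fun i => {ω | ∃ b σ : ℝ, 0 ≤ b ∧ 0 ≤ σ ∧
    (∀ k, ‖Wdia i ω k‖ ≤ b) ∧ ∑ k, ‖Wdia i ω k‖ ^ 2 ≤ N * σ ^ 2 ∧
      2 * (Real.exp 1 * (p * C' * (b / q + σ))) <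
        ‖∑ k, ((q * (H ω i k ^ 2 - 1 / N) : ℝ) : ℂ) * Wdia i ω k‖}
  let Woff : Fin N → Ω → Fin N → Fin N → ℂ := fun i ω k l =>
    if k = i ∨ l = i ∨ k = l then 0 else resolventMatrix ((H ω).eraseRowCol i) z k l
  let Aoff : Fin N → Set Ω := fun i => {ω | ∃ b β : ℝ, 0 ≤ b ∧ 0 ≤ β ∧
    (∀ k l, ‖Woff i ω k l‖ ≤ b) ∧ (∀ k, Woff i ω k k = 0) ∧
    (∀ k, ∑ l, ‖Woff i ω k l‖ ^ 2 ≤ N * β ^ 2) ∧ (∀ k, ∑ l, ‖Woff i ω l k‖ ^ 2 ≤ N * β ^ 2) ∧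
      2 * (Real.exp 1 * (2 * Real.exp 2 * (p * C) ^ 2 * (b / q + β))) <
        ‖∑ k, ∑ l, (H ω i k : ℂ) * Woff i ω k l * (H ω i l : ℂ)‖}
  have hent : ∀ i j, μ (Aent i j) ≤ ENNReal.ofReal ε := by
    intro i j
    -- Markov at level eC/q gives (q²/N) e^(-p), where q² ≤ DN is used.
    refine measure_lt_abs_le_of_moment (hmeas i j) hp0 hpe (hLp' i j) (by positivity)
      (M := C ^ p / (N * q ^ (p - 2))) ?_ ?_
    · refine le_trans (le_of_eq ?_) (hmom' i j p hp le_rfl)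
      simp only [hpe.pow_abs]
    · have hpow : (Real.exp 1 * C / q) ^ p = Real.exp p * C ^ p / (q ^ (p - 2) * q ^ 2) := by
        rw [← pow_add, Nat.sub_add_cancel hp, div_pow, mul_pow, ← Real.exp_nat_mul, mul_one]
      have hexp : Real.exp (2 - p) = Real.exp 2 / Real.exp p := Real.exp_sub _ _
      rw [hpow, hε, hexp]
      calc C ^ p / (N * q ^ (p - 2)) / (Real.exp p * C ^ p / (q ^ (p - 2) * q ^ 2))
          = q ^ 2 / N / Real.exp p := by field_simp
        _ ≤ D / Real.exp p := by
            gcongr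
            rwa [div_le_iff₀ hn]
        _ ≤ 2 * D * (Real.exp 2 / Real.exp p) := by
            rw [← mul_div_assoc]
            gcongr
            nlinarith
  have hlin : ∀ i j, μ (Alin i j) ≤ ENNReal.ofReal ε := by
    intro i j
    let φ : (Fin N → Fin N → ℂ) → Fin N → ℂ := fun w k => if k = i ∨ k = j then 0 else w k j
    have hφ : Measurable φ := measurable_pi_lambda _ fun k => by
      by_cases hk : k = i ∨ k = j
      · simp [φ, hk]
      · simp only [φ, hk, if_false]; fun_prop
    exact (measure_random_linear_form_le (hrowind i) (hmeas i) (hmean i) hp hpe (hLp' i) hC0 hn hq0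
      (hmom' i) (hφ.comp (hGm i)) ((hminor i).comp measurable_id hφ)).trans
      (ENNReal.ofReal_le_ofReal hε2)
  have hdia : ∀ i, μ (Adia i) ≤ ENNReal.ofReal ε := by
    intro i
    let φ : (Fin N → Fin N → ℂ) → Fin N → ℂ := fun w k => if k = i then 0 else w k k
    have hφ : Measurable φ := measurable_pi_lambda _ fun k => by
      by_cases hk : k = i
      · simp [φ, hk]
      · simp only [φ, hk, if_false]; fun_prop
    have hsq : Measurable fun x : ℝ => q * (x ^ 2 - 1 / N) := by fun_prop
    have hψ : Measurable fun (x : Fin N → ℝ) k => q * (x k ^ 2 - 1 / N) :=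
      measurable_pi_lambda _ fun k => by fun_prop
    have hcs := fun k => moment_centred_square (hmeas i k) hp (hLp i k) hC0 hD hn hq0 hqN
      (hvar i k) (hmom i k)
    rw [← hC'] at hcs
    exact (measure_random_linear_form_le ((hrowind i).comp _ fun _ => hsq)
      (fun k => hsq.comp (hmeas i k)) (fun k => (hcs k).1) hp hpe (fun k => (hcs k).2.1) hC'0 hn hq0
      (fun k => (hcs k).2.2) (hφ.comp (hGm i)) ((hminor i).comp hψ hφ)).trans
      (ENNReal.ofReal_le_ofReal hε2)
  have hoff : ∀ i, μ (Aoff i) ≤ ENNReal.ofReal ε := by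
    intro i
    let φ : (Fin N → Fin N → ℂ) → Fin N → Fin N → ℂ := fun w k l =>
      if k = i ∨ l = i ∨ k = l then 0 else w k l
    have hφ : Measurable φ := measurable_pi_lambda _ fun k => measurable_pi_lambda _ fun l => by
      by_cases hk : k = i ∨ l = i ∨ k = l
      · simp [φ, hk]
      · simp only [φ, hk, if_false]; fun_prop
    exact (measure_random_quadratic_form_le (hrowind i) (hmeas i) (hmean i) hp hpe (hLp' i) hC0 hn hq
      (hmom' i) (by simp) (hφ.comp (hGm i)) ((hminor i).comp measurable_id hφ)).trans
      (ENNReal.ofReal_le_ofReal hε2)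
  have hsub : {ω | ¬RowFormBounds (H ω) z c ℓ q} ⊆
      ⋃ x : Fin N × Fin N, (Aent x.1 x.2 ∪ Alin x.1 x.2) ∪ (Adia x.1 ∪ Aoff x.1) := by
    intro ω hω
    by_contra hcon
    simp only [Set.mem_iUnion, Set.mem_union, not_exists, not_or, Prod.forall] at hcon
    refine hω ⟨fun i j => ?_, fun i j hij b β hb hβ hGb hGβ => ?_, fun i b hb hGb => ?_,
      fun i b β hb hβ hGb hGβ => ?_⟩
    · refine (not_lt.1 (hcon i j).1.1).trans ?_
      gcongr
      calc Real.exp 1 * C ≤ 4 * Real.exp 1 * C' := by nlinarith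
        _ ≤ c := hcC'
    · have h := (hcon i j).1.2
      have hW : ∀ k, ‖Wlin i j ω k‖ ≤ ‖resolventMatrix ((H ω).eraseRowCol i) z k j‖ := by
        intro k
        by_cases hk : k = i ∨ k = j <;> simp [Wlin, hk]
      have h1 : ‖∑ k, (H ω i k : ℂ) * Wlin i j ω k‖ ≤
          2 * (Real.exp 1 * (p * C * (b / q + β))) := by
        refine not_lt.1 fun hlt => h ⟨b, β, hb, hβ, fun k => ?_, ?_, hlt⟩
        · by_cases hk : k = i ∨ k = j
          · simpa [Wlin, hk] using hb
          · simp only [Wlin, hk, if_false]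
            push Not at hk
            exact hGb k hk.1 hk.2
        · refine le_trans (Finset.sum_le_sum fun k _ => ?_) hGβ
          gcongr
          exact hW k
      simp only [Wlin, mul_ite, mul_zero] at h1
      refine h1.trans ?_
      have hc1 : 2 * Real.exp 1 * C ≤ c := by nlinarith
      calc 2 * (Real.exp 1 * (p * C * (b / q + β)))
          = (2 * Real.exp 1 * C) * p * (b / q + β) := by ring
        _ ≤ c * ℓ * (b / q + β) := by gcongr
    · have h := (hcon i i).2.1
      have hW : ∀ k, ‖Wdia i ω k‖ ≤ b := by
        intro k
        by_cases hk : k = i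
        · simpa [Wdia, hk] using hb
        · simpa [Wdia, hk] using hGb k hk
      have h1 : ‖∑ k, ((q * (H ω i k ^ 2 - 1 / N) : ℝ) : ℂ) * Wdia i ω k‖ ≤
          2 * (Real.exp 1 * (p * C' * (b / q + b))) := by
        -- The sup bound b also serves as the ℓ² parameter. The variables were scaled up by q, so
        -- dividing by q restores the rate b/q.
        refine not_lt.1 fun hlt => h ⟨b, b, hb, hb, hW, ?_, hlt⟩
        calc ∑ k, ‖Wdia i ω k‖ ^ 2 ≤ ∑ _k : Fin N, b ^ 2 := by
              gcongr with k
              exact hW k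
          _ = N * b ^ 2 := by simp
      have h2 : ∑ k, ((q * (H ω i k ^ 2 - 1 / N) : ℝ) : ℂ) * Wdia i ω k = (q : ℂ) *
          ∑ k, if k = i then 0 else ((H ω i k ^ 2 - 1 / N : ℝ) : ℂ) *
            resolventMatrix ((H ω).eraseRowCol i) z k k := by
        rw [Finset.mul_sum]
        refine Finset.sum_congr rfl fun k _ => ?_
        by_cases hk : k = i
        · simp [Wdia, hk]
        · simp only [Wdia, hk, if_false]
          push_cast
          ring
      rw [h2, norm_mul, Complex.norm_real, Real.norm_eq_abs, abs_of_pos hq0] at h1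
      rw [le_div_iff₀ hq0, mul_comm]
      refine h1.trans ?_
      have hbq : b / q ≤ b := div_le_self hb hq
      calc 2 * (Real.exp 1 * (p * C' * (b / q + b)))
          ≤ 2 * (Real.exp 1 * (p * C' * (b + b))) := by gcongr
        _ = (4 * Real.exp 1 * C') * p * b := by ring
        _ ≤ c * ℓ * b := by gcongr
    · have h := (hcon i i).2.2
      have hW : ∀ k l, ‖Woff i ω k l‖ ≤ ‖resolventMatrix ((H ω).eraseRowCol i) z k l‖ := by
        intro k l
        by_cases hk : k = i ∨ l = i ∨ k = l <;> simp [Woff, hk]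
      have hWsymm : ∀ k l, Woff i ω k l = Woff i ω l k := by
        intro k l
        have := resolventMatrix_symm (z := z) (Matrix.eraseRowCol_symm (hsymm ω) i) k l
        by_cases hk : k = i ∨ l = i ∨ k = l
        · have hk' : l = i ∨ k = i ∨ l = k := by tauto
          simp [Woff, hk, hk']
        · have hk' : ¬(l = i ∨ k = i ∨ l = k) := by tauto
          simp only [Woff, hk, hk', if_false, this]
      have hrow : ∀ k, ∑ l, ‖Woff i ω k l‖ ^ 2 ≤ N * β ^ 2 := by
        intro k
        by_cases hk : k = i
        · simp only [Woff, hk, true_or, if_true, norm_zero, ne_eq, OfNat.ofNat_ne_zero,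
            not_false_eq_true, zero_pow, Finset.sum_const_zero]
          positivity
        · refine le_trans (Finset.sum_le_sum fun l _ => ?_) (hGβ k hk)
          gcongr
          exact hW k l
      have h1 : ‖∑ k, ∑ l, (H ω i k : ℂ) * Woff i ω k l * (H ω i l : ℂ)‖ ≤
          2 * (Real.exp 1 * (2 * Real.exp 2 * (p * C) ^ 2 * (b / q + β))) := by
        refine not_lt.1 fun hlt => h ⟨b, β, hb, hβ, fun k l => ?_, fun k => ?_, hrow,
          fun k => ?_, hlt⟩
        · by_cases hk : k = i ∨ l = i ∨ k = l
          · simpa [Woff, hk] using hb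
          · simp only [Woff, hk, if_false]
            push Not at hk
            exact hGb k l hk.1 hk.2.1 hk.2.2
        · simp [Woff]
        · simpa only [hWsymm _ k] using hrow k
      simp only [Woff, mul_ite, mul_zero, ite_mul, zero_mul] at h1
      refine h1.trans ?_
      calc 2 * (Real.exp 1 * (2 * Real.exp 2 * (p * C) ^ 2 * (b / q + β)))
          = (4 * Real.exp 1 * Real.exp 2 * C ^ 2) * (p : ℝ) ^ 2 * (b / q + β) := by ring
        _ ≤ c * ℓ ^ 2 * (b / q + β) := by
            rw [hc]
            gcongr
            nlinarith
  -- Four bad events for each of the N² pairs, each of probability at most ε, where 4ε = 8D e^(2-p);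
  -- the diagonal and off-diagonal form events are repeated over the second index.
  refine (measure_mono hsub).trans ((measure_iUnion_fintype_le μ _).trans ?_)
  calc ∑ x : Fin N × Fin N, μ ((Aent x.1 x.2 ∪ Alin x.1 x.2) ∪ (Adia x.1 ∪ Aoff x.1))
      ≤ ∑ _x : Fin N × Fin N, ENNReal.ofReal (4 * ε) := by
        refine Finset.sum_le_sum fun x _ => ?_
        have h4 : ENNReal.ofReal (4 * ε) = (ENNReal.ofReal ε + ENNReal.ofReal ε) +
            (ENNReal.ofReal ε + ENNReal.ofReal ε) := by
          rw [← ENNReal.ofReal_add hε0.le hε0.le, ← ENNReal.ofReal_add (by linarith) (by linarith)]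
          congr 1
          ring
        rw [h4]
        exact (measure_union_le _ _).trans (add_le_add
          ((measure_union_le _ _).trans (add_le_add (hent _ _) (hlin _ _)))
          ((measure_union_le _ _).trans (add_le_add (hdia _) (hoff _))))
    _ = ENNReal.ofReal (N ^ 2 * (8 * D * Real.exp (2 - p))) := by
        rw [Finset.sum_const, nsmul_eq_mul, ← ENNReal.ofReal_natCast,
          ← ENNReal.ofReal_mul (by positivity)]
        congr 1
        simp only [Finset.card_univ, Fintype.card_prod, Fintype.card_fin]
        rw [hε]
        push_cast
        ring

end RowFormProbability

/-! ### Union bound over the grid and choice of parameters. -/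

theorem measure_not_forall_gridPoint_le {Ω : Type*} [MeasurableSpace Ω] {μ : Measure Ω}
    {P : Ω → ℂ → Prop} {ε : ℝ} (hε : 0 ≤ ε) (h : ∀ z, μ {ω | ¬P ω z} ≤ ENNReal.ofReal ε)
    {S : ℝ} {N : ℕ} (hS : 0 ≤ S) (hN : 3 ≤ N) (hNS : 2 * S + 1 ≤ N) :
    μ {ω | ¬∀ (a : ℤ) (k : ℕ), |(a : ℝ) * (1 / (N : ℝ) ^ 4)| ≤ S → 0 < 3 - k * (1 / (N : ℝ) ^ 4) →
      P ω (gridPoint (1 / (N : ℝ) ^ 4) a k)} ≤ ENNReal.ofReal ((N : ℝ) ^ 10 * ε) := by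
  have hN3 : (3 : ℝ) ≤ N := by exact_mod_cast hN
  have hN4 : (1 : ℝ) ≤ (N : ℝ) ^ 4 := one_le_pow₀ (by linarith)
  have hN0 : (0 : ℝ) < (N : ℝ) ^ 4 := by linarith
  obtain ⟨M, hM⟩ : ∃ M : ℤ, M = ⌊S * (N : ℝ) ^ 4⌋ := ⟨_, rfl⟩
  have hM0 : 0 ≤ M := by rw [hM]; exact Int.floor_nonneg.2 (by positivity)
  have hMle : (M : ℝ) ≤ S * (N : ℝ) ^ 4 := by rw [hM]; exact Int.floor_le _
  let T : Finset (ℤ × ℕ) := Finset.Icc (-M) M ×ˢ Finset.range (3 * N ^ 4)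
  have hsub : {ω | ¬∀ (a : ℤ) (k : ℕ), |(a : ℝ) * (1 / (N : ℝ) ^ 4)| ≤ S →
      0 < 3 - k * (1 / (N : ℝ) ^ 4) → P ω (gridPoint (1 / (N : ℝ) ^ 4) a k)} ⊆
      ⋃ x ∈ T, {ω | ¬P ω (gridPoint (1 / (N : ℝ) ^ 4) x.1 x.2)} := by
    intro ω hω
    rw [Set.mem_ofPred_eq] at hω
    push Not at hω
    obtain ⟨a, k, ha, hk, hP⟩ := hω
    refine Set.mem_biUnion (x := (a, k)) ?_ hP
    have ha' : |(a : ℝ)| ≤ S * (N : ℝ) ^ 4 := by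
      rwa [abs_mul, abs_of_pos (by positivity : 0 < 1 / (N : ℝ) ^ 4), mul_one_div,
        div_le_iff₀ hN0] at ha
    have hk' : (k : ℝ) < 3 * (N : ℝ) ^ 4 := by
      rwa [mul_one_div, sub_pos, div_lt_iff₀ hN0] at hk
    simp only [T, Finset.coe_product, Set.mem_prod, Finset.mem_coe, Finset.mem_Icc,
      Finset.mem_range]
    refine ⟨abs_le.1 ?_, by exact_mod_cast hk'⟩
    rw [hM]
    exact Int.le_floor.2 (by push_cast; exact ha')
  have hcard : (T.card : ℝ) ≤ (N : ℝ) ^ 10 := by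
    have h1 : ((Finset.Icc (-M) M).card : ℝ) ≤ (N : ℝ) ^ 5 := by
      have h2 : ((Finset.Icc (-M) M).card : ℤ) = 2 * M + 1 := by
        rw [Int.card_Icc, Int.toNat_of_nonneg (by omega)]
        ring
      have h3 : ((Finset.Icc (-M) M).card : ℝ) = 2 * M + 1 := by exact_mod_cast h2
      rw [h3]
      calc 2 * (M : ℝ) + 1 ≤ 2 * (S * (N : ℝ) ^ 4) + (N : ℝ) ^ 4 := by linarith
        _ = (2 * S + 1) * (N : ℝ) ^ 4 := by ring
        _ ≤ N * (N : ℝ) ^ 4 := by gcongr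
        _ = (N : ℝ) ^ 5 := by ring
    have h4 : ((Finset.range (3 * N ^ 4)).card : ℝ) ≤ (N : ℝ) ^ 5 := by
      rw [Finset.card_range]
      push_cast
      calc 3 * (N : ℝ) ^ 4 ≤ N * (N : ℝ) ^ 4 := by gcongr
        _ = (N : ℝ) ^ 5 := by ring
    rw [Finset.card_product]
    push_cast
    calc _ ≤ (N : ℝ) ^ 5 * (N : ℝ) ^ 5 := by gcongr
      _ = (N : ℝ) ^ 10 := by ring
  refine (measure_mono hsub).trans ((measure_biUnion_finset_le _ _).trans ?_)
  calc ∑ x ∈ T, μ {ω | ¬P ω (gridPoint (1 / (N : ℝ) ^ 4) x.1 x.2)}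
      ≤ ∑ _x ∈ T, ENNReal.ofReal ε := Finset.sum_le_sum fun x _ => h _
    _ = ENNReal.ofReal (T.card * ε) := by
        rw [Finset.sum_const, nsmul_eq_mul, ← ENNReal.ofReal_natCast,
          ← ENNReal.ofReal_mul (by positivity)]
    _ ≤ _ := by
        refine ENNReal.ofReal_le_ofReal ?_
        gcongr

/-- The role of ξ ≥ 1 + a₀: (log N)^ξ exceeds any multiple of log N, with a threshold uniform in ξ,
so exp(-(log N)^ξ/8) survives polynomial losses. -/
theorem exists_forall_log_rpow_ge {a₀ : ℝ} (ha₀ : 0 < a₀) (T : ℝ) :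
    ∃ N₀ : ℕ, ∀ N : ℕ, N₀ ≤ N → T ≤ N ∧ 1 ≤ Real.log N ∧
      ∀ ξ, 1 + a₀ ≤ ξ → T * Real.log N ≤ Real.log N ^ ξ := by
  have hlog : Filter.Tendsto (fun N : ℕ => Real.log N) Filter.atTop Filter.atTop :=
    Real.tendsto_log_atTop.comp tendsto_natCast_atTop_atTop
  have h1 := ((tendsto_rpow_atTop ha₀).comp hlog).eventually_ge_atTop T
  have h2 := hlog.eventually_ge_atTop 1
  have h3 := (tendsto_natCast_atTop_atTop (R := ℝ)).eventually_ge_atTop T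
  obtain ⟨N₀, hN₀⟩ := Filter.eventually_atTop.1 (h1.and (h2.and h3))
  refine ⟨N₀, fun N hN => ?_⟩
  obtain ⟨hT, hl, hTN⟩ := hN₀ N hN
  refine ⟨hTN, hl, fun ξ hξ => ?_⟩
  have hl0 : 0 < Real.log N := by linarith
  calc T * Real.log N ≤ Real.log N ^ a₀ * Real.log N := by gcongr; exact hT
    _ = Real.log N ^ (1 + a₀) := by rw [Real.rpow_add hl0, Real.rpow_one, mul_comm]
    _ ≤ Real.log N ^ ξ := Real.rpow_le_rpow_of_exponent_le hl hξ

/-- The order of the moments: 2p ≤ ℓ, because the squared entries need moments of order 2p, while p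
≥ ℓ/2 - 2 keeps the decay. -/
theorem exists_even_nat_near {ℓ : ℝ} (hℓ : 4 ≤ ℓ) :
    ∃ p : ℕ, 2 ≤ p ∧ Even p ∧ 2 * (p : ℝ) ≤ ℓ ∧ ℓ / 2 - 2 ≤ p := by
  refine ⟨2 * ⌊ℓ / 4⌋₊, ?_, even_two_mul _, ?_, ?_⟩
  · have : 1 ≤ ⌊ℓ / 4⌋₊ := Nat.le_floor (by push_cast; linarith)
    omega
  · have := Nat.floor_le (by linarith : 0 ≤ ℓ / 4)
    push_cast
    linarith
  · have := Nat.lt_floor_add_one (ℓ / 4)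
    push_cast
    linarith

/-- The polynomial losses total at most N¹³ ≤ exp(13ℓ/40), and 13/40 - 1/2 ≤ -1/8; this fixes ν =
1/8. -/
theorem union_bound_le_exp {N : ℕ} {ℓ D p : ℝ} (hN : 1 ≤ Real.log N) (hℓ : 40 * Real.log N ≤ ℓ)
    (hD : 8 * D * Real.exp 4 ≤ N) (hp : ℓ / 2 - 2 ≤ p) :
    (N : ℝ) ^ 10 * ((N : ℝ) ^ 2 * (8 * D * Real.exp (2 - p))) ≤ Real.exp (-(1 / 8 * ℓ)) := by
  have hN0 : (0 : ℝ) < N := by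
    rcases Nat.eq_zero_or_pos N with h | h
    · rw [h] at hN
      norm_num at hN
    · exact_mod_cast h
  have hN13 : (N : ℝ) ^ 13 = Real.exp (13 * Real.log N) := by
    rw [show (13 : ℝ) = (13 : ℕ) by norm_num, Real.exp_nat_mul, Real.exp_log hN0]
  calc (N : ℝ) ^ 10 * ((N : ℝ) ^ 2 * (8 * D * Real.exp (2 - p)))
      = (N : ℝ) ^ 12 * (8 * D * Real.exp 4) * Real.exp (-2 - p) := by
        rw [show (2 - p : ℝ) = 4 + (-2 - p) by ring, Real.exp_add]
        ring
    _ ≤ (N : ℝ) ^ 12 * N * Real.exp (-2 - p) := by gcongr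
    _ = Real.exp (13 * Real.log N + (-2 - p)) := by
        rw [← pow_succ, hN13, Real.exp_add]
    _ ≤ _ := Real.exp_le_exp.2 (by linarith)

theorem theorem3p1 (S Cm Cq : ℝ) (hS : 3 ≤ S) (hCm : 0 < Cm) (hCq : 0 < Cq) :
    ∃ ν : ℝ, 0 < ν ∧
    ∀ a₀ A₀ : ℝ, 0 < a₀ → 10 ≤ A₀ →
    ∃ C : ℝ, 0 < C ∧ ∃ N₀ : ℕ,
    ∀ N : ℕ, N₀ ≤ N →
    ∀ ξ L q : ℝ, 1 + a₀ ≤ ξ → ξ ≤ A₀ * Real.log (Real.log N) → 8 * ξ ≤ L →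
    ∀ (Ω : Type*) [MeasurableSpace Ω] (μ : Measure Ω) [IsProbabilityMeasure μ]
      (H : Ω → Matrix (Fin N) (Fin N) ℝ),
    IsSparseRandomMatrix μ A₀ ξ Cm Cq q H →
    HighProbBound μ N ξ ν
      (⋂ z ∈ spectralDomain S N L, {ω | ∀ i j : Fin N, i ≠ j →
        ‖resolventMatrix (H ω) z i j‖ ≤
          C / q + C * Real.log N ^ (2 * ξ) / √((N : ℝ) * z.im)}) ∧
    HighProbBound μ N ξ ν
      (⋂ z ∈ spectralDomain S N L, {ω | ∀ i : Fin N,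
        ‖resolventMatrix (H ω) z i i - empiricalStieltjes (H ω) z‖ ≤
          C * Real.log N ^ ξ / q + C * Real.log N ^ (2 * ξ) / √((N : ℝ) * z.im)}) ∧
    HighProbBound μ N ξ ν
      (⋂ z ∈ spectralDomain S N L, {ω |
        ‖empiricalStieltjes (H ω) z - semicircleStieltjes z‖ ≤
          C * Real.log N ^ ξ / √q +
            C * Real.log N ^ (2 * ξ) / ((N : ℝ) * z.im) ^ (1 / 3 : ℝ)}) := by
  refine ⟨1 / 8, by norm_num, fun a₀ A₀ ha₀ hA₀ => ?_⟩
  -- With C₁ ≥ 1 the variance condition becomes the case r = 2 of the moment bounds.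
  obtain ⟨C₁, hC₁⟩ : ∃ C₁, C₁ = max Cm 1 := ⟨_, rfl⟩
  obtain ⟨D, hD⟩ : ∃ D, D = max (Cq ^ 2) 1 := ⟨_, rfl⟩
  have hC₁1 : 1 ≤ C₁ := hC₁ ▸ le_max_right _ _
  have hC₁m : Cm ≤ C₁ := hC₁ ▸ le_max_left _ _
  have hD1 : 1 ≤ D := hD ▸ le_max_right _ _
  have hDq : Cq ^ 2 ≤ D := hD ▸ le_max_left _ _
  obtain ⟨c, hcdef⟩ : ∃ c, c = 4 * Real.exp 1 * Real.exp 2 * (2 * C₁ ^ 2 + 2 * D) := ⟨_, rfl⟩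
  have hc : 1 ≤ c := by
    have he1 : (1 : ℝ) ≤ Real.exp 1 := Real.one_le_exp (by norm_num)
    have he2 : (1 : ℝ) ≤ Real.exp 2 := Real.one_le_exp (by norm_num)
    have hCD : 1 ≤ 2 * C₁ ^ 2 + 2 * D := by nlinarith
    have he : 1 ≤ 4 * Real.exp 1 * Real.exp 2 := by nlinarith
    rw [hcdef]
    nlinarith
  have hlaw := (lawConst_ge hc (by linarith : 2 ≤ 2 * (S + 4))).1
  obtain ⟨K, hK⟩ : ∃ K, K = 8 * lawConst c (2 * (S + 4)) := ⟨_, rfl⟩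
  obtain ⟨R, hR⟩ : ∃ R, R = (28 * lawConst c (2 * (S + 4)) * (2 * (S + 4))) ^ 2 := ⟨_, rfl⟩
  have hR0 : 0 ≤ R := hR ▸ sq_nonneg _
  -- One threshold for all largeness conditions: 40 for the exponential decay, R for renewing the a
  -- priori bound, 16(S + 4) for the mesh, 8De⁴ for the prefactor of the union bound.
  obtain ⟨N₀, hN₀⟩ := exists_forall_log_rpow_ge ha₀
    (40 + R + 16 * (S + 4) + 8 * D * Real.exp 4)
  refine ⟨K, by rw [hK]; linarith, N₀, fun N hN ξ L q hξ hξA hξL Ω _ μ _ H hH => ?_⟩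
  obtain ⟨hTN, hlog, hTℓ⟩ := hN₀ N hN
  have hlog0 : 0 < Real.log N := by linarith
  have hDe : 0 < 8 * D * Real.exp 4 := by positivity
  have hN40 : (40 : ℝ) ≤ N := by linarith
  have hN40' : 40 ≤ N := by exact_mod_cast hN40
  obtain ⟨ℓ, hℓdef⟩ : ∃ ℓ, ℓ = Real.log N ^ ξ := ⟨_, rfl⟩
  have hTℓ' := hTℓ ξ hξ
  rw [← hℓdef] at hTℓ'
  have hℓR : R ≤ ℓ := by nlinarith
  have hℓ40 : 40 * Real.log N ≤ ℓ := by
    refine le_trans ?_ hTℓ'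
    gcongr
    linarith
  have hℓ4 : 4 ≤ ℓ := by linarith
  have hpow : ∀ k : ℕ, Real.log N ^ ((k : ℝ) * ξ) = ℓ ^ k := by
    intro k
    rw [hℓdef, mul_comm, Real.rpow_mul_natCast hlog0.le]
  have hℓ2 : Real.log N ^ (2 * ξ) = ℓ ^ 2 := by simpa using hpow 2
  have hℓ3 : ℓ ^ 3 ≤ q := by
    have := hpow 3
    push_cast at this
    rw [← this]
    exact hH.q_lower
  have hq1 : 1 ≤ q := (one_le_pow₀ (by linarith)).trans hℓ3
  have hq0 : 0 ≤ q := by linarith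
  have hqN : q ^ 2 ≤ D * N := by
    calc q ^ 2 ≤ (Cq * √(N : ℝ)) ^ 2 := by
          gcongr
          exact hH.q_upper
      _ = Cq ^ 2 * N := by rw [mul_pow, Real.sq_sqrt (by positivity)]
      _ ≤ D * N := by gcongr
  obtain ⟨p, hp2, hpe, hpℓ, hℓp⟩ := exists_even_nat_near hℓ4
  -- Moments are needed only up to 2p ≤ (log N)^ξ, and ξ ≤ A₀ log log N puts these in the assumed
  -- range.
  have hpA : ∀ r : ℕ, r ≤ 2 * p → (r : ℝ) ≤ Real.log N ^ (A₀ * Real.log (Real.log N)) := by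
    intro r hr
    have hr' : (r : ℝ) ≤ 2 * p := by exact_mod_cast hr
    refine (hr'.trans hpℓ).trans ?_
    rw [hℓdef]
    exact Real.rpow_le_rpow_of_exponent_le hlog hξA
  have hmom : ∀ i j, ∀ r : ℕ, 2 ≤ r → r ≤ 2 * p →
      ∫ ω, |H ω i j| ^ r ∂μ ≤ C₁ ^ r / (N * q ^ (r - 2)) := by
    intro i j r hr hrp
    rcases hr.eq_or_lt with rfl | hr
    · rw [hH.variance]
      simp only [Nat.sub_self, pow_zero, mul_one]
      gcongr
      exact one_le_pow₀ hC₁1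
    · refine (hH.moments i j r hr (hpA r hrp)).2.trans ?_
      gcongr
  have hLp : ∀ i j, MemLp (fun ω => H ω i j) (2 * p : ℕ) μ := fun i j =>
    (memLp_iff_integrable_abs_pow (hH.measurable i j) (by omega)).2
      (hH.moments i j (2 * p) (by omega) (hpA _ le_rfl)).1
  have hvar : ∀ i j, ∫ ω, H ω i j ^ 2 ∂μ = 1 / (N : ℝ) := by
    intro i j
    simpa only [sq_abs] using hH.variance i j
  have hfix := measure_not_rowFormBounds_le hH.measurable hH.symm hH.indep hH.mean hvar hp2 hpe
    hLp hC₁1 hD1 (by omega) hq1 hqN hmom (by linarith : (p : ℝ) ≤ ℓ)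
  rw [← hcdef] at hfix
  have hbad := (measure_not_forall_gridPoint_le (by positivity) hfix (S := S) (by linarith)
    (by omega) (by linarith)).trans (ENNReal.ofReal_le_ofReal
      (union_bound_le_exp hlog hℓ40 (by linarith) hℓp))
  have hlocal : ∀ ω, (∀ (a : ℤ) (k : ℕ), |(a : ℝ) * (1 / (N : ℝ) ^ 4)| ≤ S →
      0 < 3 - k * (1 / (N : ℝ) ^ 4) →
      RowFormBounds (H ω) (gridPoint (1 / (N : ℝ) ^ 4) a k) c ℓ q) →
      ∀ z ∈ spectralDomain S N L, _ := fun ω hω z hz =>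
    local_law_of_grid (z := z) hS (by linarith) (by linarith) (hH.symm ω) hc (hR ▸ hℓR) hℓ3 rfl hω
      hz.1 (by
        have h8 := hpow 8
        push_cast at h8
        rw [← h8]
        refine (Real.rpow_le_rpow_of_exponent_le hlog hξL).trans ?_
        have := hz.2.1
        rwa [div_le_iff₀ (by linarith), mul_comm] at this) hz.2.2
  simp only [← hK] at hlocal
  simp only [HighProbBound, hℓ2, ← hℓdef]
  -- All three complements lie in the same bad event, the failure of the row bounds at some grid
  -- point. Only monotonicity of the measure is used, so the intersections over uncountably many z
  -- need not be measurable.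
  refine ⟨?_, ?_, ?_⟩ <;> refine (measure_mono ?_).trans hbad <;> intro ω hω hgood <;>
    refine hω (Set.mem_iInter₂.2 fun z hz => ?_)
  · intro i j hij
    refine ((hlocal ω hgood z hz).1 i j hij).trans (le_of_eq ?_)
    ring
  · intro i
    refine ((hlocal ω hgood z hz).2.1 i).trans (le_of_eq ?_)
    rw [entryError]
    ring
  · refine ((hlocal ω hgood z hz).2.2).trans (le_of_eq ?_)
    rw [traceError]
    ring
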